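/- **Setting.** Unit-free MALL formulas are generated from atoms $X$ and dual atoms $X^\perp$ by the binary connectives $\otimes,\parr,\&,\oplus$, with $(X^{\perp})^\perp=X$, $(A\otimes B)^\perp=B^\perp\parr A^\perp$, $(A\parr B)^\perp=B^\perp\otimes A^\perp$, $(A\mathbin{\&} B)^\perp=B^\perp\oplus A^\perp$, $(A\oplus B)^\perp=B^\perp\mathbin{\&}A^\perp$. A unit-free formula is *distributed* if it has no sub-formula of the form $A\otimes(B\oplus C)$, $(A\oplus B)\otimes C$, $(C\mathbin{\&}B)\parr A$ or $C\parr(B\mathbin{\&}A)$. Proof-nets are those of Hughes and van Glabbeek. A cut sequent $[\Sigma]\,\Gamma$ is a list $\Sigma$ of cut pairs $A\ast A^\perp$ with a list $\Gamma$ of formulas, seen as a forest of syntactic trees. An additive resolution deletes any number of cut pairs and one argument of each $\&$ and $\oplus$; a $\&$-resolution deletes one argument of each $\&$. A linking $\lambda$ is a set of disjoint links (pairs of complementary leaves) whose leaves are exactly those of an additive resolution, written $[\Sigma]\,\Gamma\upharpoonright\lambda$. A set $\Lambda$ of linkings toggles a $\&$-vertex $W$ if both premises of $W$ are in $\bigcup_{\lambda\in\Lambda}[\Sigma]\,\Gamma\upharpoonright\lambda$;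 a link $a$ depends on $W$ in $\Lambda$ if there are $\lambda,\lambda'\in\Lambda$ with $a\in\lambda\setminus\lambda'$ such that $W$ is the only $\&$-vertex toggled by $\{\lambda,\lambda'\}$. The graph $\mathcal G_\Lambda$ is $\bigcup_{\lambda\in\Lambda}[\Sigma]\,\Gamma\upharpoonright\lambda$ with the links of $\Lambda$ and a jump edge between each leaf $l$ and each $\&$-vertex on which some link of $\Lambda$ at $l$ depends. A switch edge of a $\parr$- or $\&$-vertex is an edge to one of its premises or a jump to it; a switching cycle is a cycle with at most one switch edge of each $\parr$- and $\&$-vertex. A *proof-net* on $[\Sigma]\,\Gamma$ is a set $\theta$ of linkings such that: (P0) every cut pair has a leaf in $\theta$; (P1) exactly one linking of $\theta$ is on any given $\&$-resolution; (P2) for every $\lambda\in\theta$, deleting from $\mathcal G_{\{\lambda\}}$ one switch edge of each $\parr$-vertex always yields a tree; (P3) every $\Lambda\subseteq\theta$ with at least two linkings toggles a $\&$-vertex that is in no switching cycle of $\mathcal G_\Lambda$. It is *cut-free* if $\Sigma=\emptyset$. The composition of proof-nets $\theta$ and $\psi$ over a cut is $\{\lambda\cup\mu\mid\lambda\in\theta,\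 \mu\in\psi\}$. Cut elimination repeatedly (a) removes an atomic cut $X\ast X^\perp$, replacing links $(l,X)$ and $(X^\perp,m)$ of a linking by $(l,m)$; (b) replaces a $\otimes/\parr$ cut by the two cuts on the dual arguments, keeping all linkings; (c) does the same for a $\&/\oplus$ cut, then deletes the linkings in whose additive resolution the two sides of that cut do not keep dual premises, and then deletes the cut pairs no leaf of which is used any more. The identity proof-net of $A$, on $A^\perp,A$, is the one of the full axiom-expansion of the axiom on $A$. **Theorem.** Let $A$ and $B$ be distributed unit-free MALL formulas, and let $\theta$, $\theta'$ be cut-free proof-nets of respective conclusions $A^\perp,B$ and $B^\perp,A$ that witness an isomorphism between $A$ and $B$: their composition over $B$ reduces by cut elimination to the identity proof-net of $A$, and their composition over $A$ reduces to the identity proof-net of $B$. Then each of $\theta$ and $\theta'$ is * *bipartite*: every link of $\theta$ is between a leaf of $A^\perp$ and a leaf of $B$, and every link of $\theta'$ is between a leaf of $B^\perp$ and a leaf of $A$; * *ax-unique*: every leaf of the conclusions of $\theta$ (resp. $\theta'$) has exactly one axiom link of $\theta$ (resp. $\theta'$) on it (that link may be shared among several linkings). -/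

import Mathlib

namespace MALL

/-! ### Unit-free formulas -/

/-- The four binary connectives `⊗`, `⅋`, `&`, `⊕`. -/
inductive Conn : Type
  | tens | parr | amp | plus

/-- The De Morgan dual of a connective. -/
def Conn.dual : Conn → Conn
  | tens => parr
  | parr => tens
  | amp => plus
  | plus => amp

/-- `&` and `⊕` are the additive connectives. -/
def Conn.IsAdditive (c : Conn) : Prop := c = amp ∨ c = plus

/-- `⅋` and `&` are the negative connectives. -/
def Conn.IsNegative (c : Conn) : Prop := c = parr ∨ c = amp

/-- Unit-free MALL formulas over a set `α` of atoms: `lit X true` is the atom `X`,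
`lit X false` is its dual, and `bin c A B` is `A c B`. -/
inductive Formula (α : Type*) : Type _
  | lit (X : α) (b : Bool) : Formula α
  | bin (c : Conn) (A B : Formula α) : Formula α

namespace Formula

variable {α : Type*}

/-- Orthogonality, with the non-commutative De Morgan laws: the two arguments are swapped. -/
def dual : Formula α → Formula α
  | lit X b => lit X (!b)
  | bin c A B => bin c.dual B.dual A.dual

/-- `Sub C A`: `C` is a sub-formula of `A`. -/
inductive Sub : Formula α → Formula α → Prop
  | refl (A : Formula α) : Sub A A
  | left {C A : Formula α} (c : Conn) (B : Formula α) : Sub C A → Sub C (bin c A B)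
  | right {C B : Formula α} (c : Conn) (A : Formula α) : Sub C B → Sub C (bin c A B)

/-- A unit-free formula is distributed when it has no sub-formula of the form
`A ⊗ (B ⊕ C)`, `(A ⊕ B) ⊗ C`, `(C & B) ⅋ A` or `C ⅋ (B & A)`. -/
def Distributed (F : Formula α) : Prop :=
  ∀ A B C : Formula α,
    ¬ Sub (bin .tens A (bin .plus B C)) F ∧
    ¬ Sub (bin .tens (bin .plus A B) C) F ∧
    ¬ Sub (bin .parr (bin .amp C B) A) F ∧
    ¬ Sub (bin .parr C (bin .amp B A)) F

end Formula

/-! ### Occurrences and cut sequents -/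

/-- Names of formula occurrences: a root name together with the path from that root, the last
step first (`false` is "left argument", `true` is "right argument"). -/
abbrev Occ (ι : Type*) : Type _ := ι × List Bool

/-- The left (`b = false`) or right (`b = true`) premise of an occurrence. -/
def Occ.child {ι : Type*} (v : Occ ι) (b : Bool) : Occ ι := (v.1, b :: v.2)

/-- `r.Below v`: the occurrence `v` lies in the tree rooted at `r` (possibly `v = r`). -/
def Occ.Below {ι : Type*} (r v : Occ ι) : Prop := r.1 = v.1 ∧ r.2 <:+ v.2

/-- A cut pair `A ∗ A⊥`, with `A` occurring at `left` and `A⊥` occurring at `right`. -/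
structure CutPair (ι α : Type*) where
  left : Occ ι
  right : Occ ι
  formula : Formula α

/-- The two formula occurrences of a cut pair. -/
def CutPair.sides {ι α : Type*} (c : CutPair ι α) : List (Occ ι × Formula α) :=
  [(c.left, c.formula), (c.right, c.formula.dual)]

/-- A cut sequent `[Σ] Γ`: a list of cut pairs and a list of formulas. Every formula carries the
name of its occurrence, and distinct formulas of the sequent have disjoint trees. -/
structure CutSequent (ι α : Type*) where
  cuts : List (CutPair ι α)
  concl : List (Occ ι × Formula α)
  disjoint : (concl ++ cuts.flatMap CutPair.sides).Pairwise
    fun r s => ¬ r.1.Below s.1 ∧ ¬ s.1.Below r.1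

/-- An (axiom) link is an unordered pair of occurrences, a linking is a set of those. -/
abbrev Linking (ι : Type*) : Type _ := Set (Sym2 (Occ ι))

/-- The occurrences carrying a link of the linking `l`. -/
def Linking.support {ι : Type*} (l : Linking ι) : Set (Occ ι) := {v | ∃ e ∈ l, v ∈ e}

/-- Some leaf of the cut pair `c` is used in the set of linkings `θ`. -/
def CutPair.Used {ι α : Type*} (c : CutPair ι α) (θ : Set (Linking ι)) : Prop :=
  ∃ l ∈ θ, ∃ v ∈ Linking.support l, c.left.Below v ∨ c.right.Below v

/-- Vertices of the graphs attached to a cut sequent: occurrences of formulas (identified with the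
roots of their syntactic trees), and one `∗`-vertex per cut pair. -/
inductive Vertex (ι α : Type*) : Type _
  | occ (v : Occ ι) : Vertex ι α
  | cut (c : CutPair ι α) : Vertex ι α

namespace CutSequent

variable {ι α : Type*}

/-- All formulas of `Σ ∪ Γ`. -/
def roots (S : CutSequent ι α) : List (Occ ι × Formula α) :=
  S.concl ++ S.cuts.flatMap CutPair.sides

/-- `S.At v A`: `v` is a vertex of the syntactic forest of `S`, and the sub-formula of which it is
the root is `A`. -/
inductive At (S : CutSequent ι α) : Occ ι → Formula α → Prop
  | root {v : Occ ι} {A : Formula α} : (v, A) ∈ S.roots → S.At v A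
  | left {v : Occ ι} {c : Conn} {A B : Formula α} :
      S.At v (.bin c A B) → S.At (v.child false) A
  | right {v : Occ ι} {c : Conn} {A B : Formula α} :
      S.At v (.bin c A B) → S.At (v.child true) B

/-- The leaf `v` belongs to the syntactic forest of `S`. -/
def IsLeaf (S : CutSequent ι α) (v : Occ ι) : Prop := ∃ X b, S.At v (.lit X b)

/-- `v` is a vertex of `S` labelled by the connective `c`. -/
def IsConn (S : CutSequent ι α) (c : Conn) (v : Occ ι) : Prop := ∃ A B, S.At v (.bin c A B)

/-! ### Resolutions and linkings -/

/-- `R` is the set of vertices that remain in (some formulas of) `S` after one argument sub-tree of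
each connective `c` with `P c` has been deleted. -/
structure IsPruning (S : CutSequent ι α) (P : Conn → Prop) (R : Set (Occ ι)) : Prop where
  vertex : ∀ v ∈ R, ∃ A, S.At v A
  parent : ∀ c v b, S.IsConn c v → v.child b ∈ R → v ∈ R
  both : ∀ c v, ¬ P c → S.IsConn c v → v ∈ R → v.child false ∈ R ∧ v.child true ∈ R
  one : ∀ c v, P c → S.IsConn c v → v ∈ R → Xor (v.child false ∈ R) (v.child true ∈ R)

/-- `R` is (the vertex set of) an additive resolution of `S`: zero or more cut pairs, and one
argument of each additive connective, are deleted. -/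
structure IsAdditiveResolution (S : CutSequent ι α) (R : Set (Occ ι)) : Prop where
  pruning : S.IsPruning Conn.IsAdditive R
  concl : ∀ r ∈ S.concl, r.1 ∈ R
  cuts : ∀ c ∈ S.cuts, (c.left ∈ R ↔ c.right ∈ R)

/-- `R` is (the vertex set of) a `&`-resolution of `S`: one argument of each `&` is deleted. -/
structure IsWithResolution (S : CutSequent ι α) (R : Set (Occ ι)) : Prop where
  pruning : S.IsPruning (fun c => c = .amp) R
  roots : ∀ r ∈ S.roots, r.1 ∈ R

/-- `e` is an axiom link on `S`: an unordered pair of leaves with complementary labels. -/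
def IsLink (S : CutSequent ι α) (e : Sym2 (Occ ι)) : Prop :=
  ∃ u v X, e = s(u, v) ∧ S.At u (.lit X true) ∧ S.At v (.lit X false)

/-- `R` is the additive resolution of the linking `l`: its leaves are those used by `l`. -/
def IsResolutionOf (S : CutSequent ι α) (l : Linking ι) (R : Set (Occ ι)) : Prop :=
  S.IsAdditiveResolution R ∧ Linking.support l = {v | v ∈ R ∧ S.IsLeaf v}

/-- `l` is a linking on `S`. -/
structure IsLinking (S : CutSequent ι α) (l : Linking ι) : Prop where
  link : ∀ e ∈ l, S.IsLink e
  disjoint : ∀ e ∈ l, ∀ f ∈ l, ∀ v, v ∈ e → v ∈ f → e = f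
  resolution : ∃ R, S.IsResolutionOf l R

/-- The vertices of the (unique) additive resolution `S ↾ l` of a linking `l`. -/
def res (S : CutSequent ι α) (l : Linking ι) : Set (Occ ι) :=
  {v | ∃ R, S.IsResolutionOf l R ∧ v ∈ R}

/-- `S ↾ Λ`, the union of the additive resolutions of the linkings in `Λ`. -/
def resSet (S : CutSequent ι α) (L : Set (Linking ι)) : Set (Occ ι) :=
  {v | ∃ l ∈ L, v ∈ S.res l}

/-! ### The graphs `G_Λ` and the correctness criterion -/

/-- The set of linkings `L` toggles the `&`-vertex `W`. -/
def Toggles (S : CutSequent ι α) (L : Set (Linking ι)) (W : Occ ι) : Prop :=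
  S.IsConn .amp W ∧ W.child false ∈ S.resSet L ∧ W.child true ∈ S.resSet L

/-- The link `a` depends on the `&`-vertex `W` in `L`. -/
def Depends (S : CutSequent ι α) (L : Set (Linking ι)) (a : Sym2 (Occ ι)) (W : Occ ι) : Prop :=
  ∃ l ∈ L, ∃ l' ∈ L, a ∈ l ∧ a ∉ l' ∧
    S.Toggles {l, l'} W ∧ ∀ W', S.Toggles {l, l'} W' → W' = W

/-- There is a jump edge from the leaf `x` to the `&`-vertex `W` in `G_L`. -/
def Jump (S : CutSequent ι α) (L : Set (Linking ι)) (x W : Occ ι) : Prop :=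
  ∃ l ∈ L, ∃ a ∈ l, x ∈ a ∧ S.Depends L a W

/-- The edges of `G_L`: the edges of the forest `S ↾ L`, those of its `∗`-vertices, the links, and
the jumps. -/
inductive Edge (S : CutSequent ι α) (L : Set (Linking ι)) : Vertex ι α → Vertex ι α → Prop
  | tree (v : Occ ι) (b : Bool) : v ∈ S.resSet L → v.child b ∈ S.resSet L →
      S.Edge L (.occ v) (.occ (v.child b))
  | cutLeft (c : CutPair ι α) : c ∈ S.cuts → c.left ∈ S.resSet L →
      S.Edge L (.occ c.left) (.cut c)
  | cutRight (c : CutPair ι α) : c ∈ S.cuts → c.right ∈ S.resSet L →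
      S.Edge L (.occ c.right) (.cut c)
  | link (l : Linking ι) (u v : Occ ι) : l ∈ L → s(u, v) ∈ l → S.Edge L (.occ u) (.occ v)
  | jump (x W : Occ ι) : S.Jump L x W → S.Edge L (.occ x) (.occ W)

/-- The vertices of `G_L`. -/
def verts (S : CutSequent ι α) (L : Set (Linking ι)) : Set (Vertex ι α) :=
  {x | (∃ v ∈ S.resSet L, x = .occ v) ∨ ∃ c ∈ S.cuts, c.left ∈ S.resSet L ∧ x = .cut c}

/-- The graph `G_L`, on the type of all conceivable vertices (those outside `S.verts L` being
isolated). A jump parallel to a tree edge is a switch edge of the same `&`-vertex, so that nothing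
is lost in considering simple graphs. -/
def graph (S : CutSequent ι α) (L : Set (Linking ι)) : SimpleGraph (Vertex ι α) :=
  SimpleGraph.fromRel (S.Edge L)

/-- `e` is a switch edge of `N` in `G_L`: an edge between `N` and one of its premises, or a jump
to `N`. -/
def IsSwitchEdge (S : CutSequent ι α) (L : Set (Linking ι)) (N : Occ ι)
    (e : Sym2 (Vertex ι α)) : Prop :=
  (∃ b, e = s(.occ N, .occ (N.child b))) ∨ ∃ x, S.Jump L x N ∧ e = s(.occ x, .occ N)

/-- A switching cycle of `G_L`: a cycle with at most one switch edge of each negative vertex. -/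
def IsSwitchingCycle (S : CutSequent ι α) (L : Set (Linking ι)) {x : Vertex ι α}
    (p : (S.graph L).Walk x x) : Prop :=
  p.IsCycle ∧ ∀ c N, Conn.IsNegative c → S.IsConn c N →
    ∀ e ∈ p.edges, ∀ f ∈ p.edges, S.IsSwitchEdge L N e → S.IsSwitchEdge L N f → e = f

/-- The graph `G_φ` of the `⅋`-switching `φ` of the linking `l`: for each `⅋`-vertex `v`, the edge
between `v` and its premise number `φ v` is deleted from `G_l`. -/
def switchingGraph (S : CutSequent ι α) (l : Linking ι) (φ : Occ ι → Bool) :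
    SimpleGraph (S.verts {l}) :=
  ((S.graph {l}).deleteEdges
    {e | ∃ v, S.IsConn .parr v ∧ e = s(.occ v, .occ (v.child (φ v)))}).induce (S.verts {l})

/-- `θ` is a unit-free MALL proof-net on the cut sequent `S`. -/
structure IsProofNet (S : CutSequent ι α) (θ : Set (Linking ι)) : Prop where
  linking : ∀ l ∈ θ, S.IsLinking l
  /-- (P0) Cut. -/
  cut : ∀ c ∈ S.cuts, c.Used θ
  /-- (P1) Resolution. -/
  resolution : ∀ R, S.IsWithResolution R → ∃! l, l ∈ θ ∧ Linking.support l ⊆ R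
  /-- (P2) MLL. -/
  mll : ∀ l ∈ θ, ∀ φ : Occ ι → Bool, (S.switchingGraph l φ).IsTree
  /-- (P3) Toggling. -/
  toggling : ∀ L ⊆ θ, L.Nontrivial → ∃ W, S.Toggles L W ∧
    ∀ (x : Vertex ι α) (p : (S.graph L).Walk x x), S.IsSwitchingCycle L p → .occ W ∉ p.support

/-- A proof-net is ax-unique when each leaf of its cut sequent has exactly one link on it (that
link may be shared among several linkings). -/
def IsAxUnique (S : CutSequent ι α) (θ : Set (Linking ι)) : Prop :=
  ∀ v, S.IsLeaf v → ∃! e : Sym2 (Occ ι), (∃ l ∈ θ, e ∈ l) ∧ v ∈ e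

/-- A cut-free proof-net is bipartite when it has two conclusions and each of its links is between
a leaf of the first one and a leaf of the second one. -/
def IsBipartite (S : CutSequent ι α) (θ : Set (Linking ι)) : Prop :=
  S.cuts = [] ∧ ∃ r s : Occ ι × Formula α, S.concl = [r, s] ∧
    ∀ l ∈ θ, ∀ e ∈ l, ∃ u v, e = s(u, v) ∧
      S.IsLeaf u ∧ r.1.Below u ∧ S.IsLeaf v ∧ s.1.Below v

/-! ### Cut elimination -/

/-- In `S ↾ l`, the two children of the cut `c` on an additive formula do not take dual premises.
By the De Morgan laws the dual of a left premise is a right premise; the condition fails when `c` is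
not in `S ↾ l`. -/
def Inconsistent (S : CutSequent ι α) (c : CutPair ι α) (l : Linking ι) : Prop :=
  ∃ b, c.left.child b ∈ S.res l ∧ c.right.child b ∈ S.res l

end CutSequent

variable {ι α : Type*}

/-- The effect on a linking of the elimination of an atomic cut `c` between `c.left` and `c.right`:
the links `(u, c.left)` and `(c.right, v)` are replaced by the link `(u, v)`. -/
def elimAtom (c : CutPair ι α) (l : Linking ι) : Linking ι :=
  {e | e ∈ l ∧ c.left ∉ e ∧ c.right ∉ e} ∪
    {e | ∃ u v, u ≠ c.right ∧ v ≠ c.left ∧ s(u, c.left) ∈ l ∧ s(c.right, v) ∈ l ∧ e = s(u, v)}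

/-- The cut pair `A₁ ∗ A₁⊥` obtained from a cut on `A₁ c A₂`, whose dual is `A₂⊥ c⊥ A₁⊥`. -/
def CutPair.first (c : CutPair ι α) (A₁ : Formula α) : CutPair ι α :=
  ⟨c.left.child false, c.right.child true, A₁⟩

/-- The cut pair `A₂ ∗ A₂⊥` obtained from a cut on `A₁ c A₂`, whose dual is `A₂⊥ c⊥ A₁⊥`. -/
def CutPair.second (c : CutPair ι α) (A₂ : Formula α) : CutPair ι α :=
  ⟨c.left.child true, c.right.child false, A₂⟩

open Classical in
/-- One step of cut elimination, on sets of linkings on cut sequents. -/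
inductive Step : CutSequent ι α × Set (Linking ι) → CutSequent ι α × Set (Linking ι) → Prop
  /-- (a) Elimination of a cut between atoms. -/
  | atom (S S' : CutSequent ι α) (θ : Set (Linking ι)) (C D : List (CutPair ι α))
      (c : CutPair ι α) (X : α) (b : Bool) :
      c.formula = .lit X b →
      S.cuts = C ++ c :: D → S'.cuts = C ++ D → S'.concl = S.concl →
      Step (S, θ) (S', elimAtom c '' θ)
  /-- (b) Elimination of a cut between a `⊗` and a `⅋`. -/
  | mult (S S' : CutSequent ι α) (θ : Set (Linking ι)) (C D : List (CutPair ι α))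
      (c : CutPair ι α) (k : Conn) (A₁ A₂ : Formula α) :
      ¬ k.IsAdditive → c.formula = .bin k A₁ A₂ →
      S.cuts = C ++ c :: D → S'.cuts = C ++ c.first A₁ :: c.second A₂ :: D →
      S'.concl = S.concl →
      Step (S, θ) (S', θ)
  /-- (c) Elimination of a cut between a `&` and a `⊕`: the inconsistent linkings are deleted, then
  the cut pairs no leaf of which is in the remaining linkings are garbage collected. -/
  | add (S S' : CutSequent ι α) (θ θ' : Set (Linking ι)) (C D : List (CutPair ι α))
      (c : CutPair ι α) (k : Conn) (A₁ A₂ : Formula α) :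
      k.IsAdditive → c.formula = .bin k A₁ A₂ →
      S.cuts = C ++ c :: D →
      θ' = {l | l ∈ θ ∧ ¬ S.Inconsistent c l} →
      S'.cuts = (C ++ c.first A₁ :: c.second A₂ :: D).filter (fun d => decide (d.Used θ')) →
      S'.concl = S.concl →
      Step (S, θ) (S', θ')

/-- The set of all unions of a linking of `θ` and a linking of `ψ`. -/
def joins (θ ψ : Set (Linking ι)) : Set (Linking ι) := {m | ∃ l ∈ θ, ∃ l' ∈ ψ, m = l ∪ l'}

open Classical in
/-- The identity proof-net of `A`, on the sequent `A⊥, A` with `A⊥` occurring at `u` and `A` at `v`.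
It is the set of linkings of the full axiom-expansion of the axiom on `A`: a `⅋`- and a `⊗`-rule
for a multiplicative connective, a `&`-rule and one `⊕`-rule in each of its branches for an additive
connective. -/
def idNet : Formula α → Occ ι → Occ ι → Set (Linking ι)
  | .lit _ _, u, v => {{s(u, v)}}
  | .bin c A₁ A₂, u, v =>
      if c.IsAdditive then
        idNet A₁ (u.child true) (v.child false) ∪ idNet A₂ (u.child false) (v.child true)
      else
        joins (idNet A₁ (u.child true) (v.child false)) (idNet A₂ (u.child false) (v.child true))

/-! ### Isomorphisms -/

/-- The sequent `F, G` (no cut), the two formulas being named `i` and `j`. -/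
def seq (i j : ι) (h : i ≠ j) (F G : Formula α) : CutSequent ι α where
  cuts := []
  concl := [((i, []), F), ((j, []), G)]
  disjoint := by simp [Occ.Below, h, h.symm]

/-- The cut sequent `[F ∗ F⊥] G, H` in which the formulas `F`, `F⊥`, `G` and `H` are named
`i`, `i'`, `j` and `k`. -/
def cutSeq (i i' j k : ι) (h : [i, i', j, k].Nodup) (F G H : Formula α) : CutSequent ι α where
  cuts := [⟨(i, []), (i', []), F⟩]
  concl := [((j, []), G), ((k, []), H)]
  disjoint := by
    simp only [List.nodup_cons, List.mem_cons, List.not_mem_nil, not_or] at h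
    obtain ⟨⟨h1, h2, h3, -⟩, ⟨h4, h5, -⟩, ⟨h6, -⟩, -⟩ := h
    simp [Occ.Below, CutPair.sides, h1, h2, h3, h4, h5, h6,
      Ne.symm h1, Ne.symm h2, Ne.symm h3, Ne.symm h4, Ne.symm h5, Ne.symm h6]

/-- Names for the formula occurrences of two sequents `A⊥, B` and `B⊥, A`. -/
inductive Root : Type
  | dualA | B | dualB | A

/-- The sequent `A⊥, B`. -/
def seqAB (A B : Formula α) : CutSequent Root α := seq .dualA .B (by simp) A.dual B

/-- The sequent `B⊥, A`. -/
def seqBA (A B : Formula α) : CutSequent Root α := seq .dualB .A (by simp) B.dual A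

/-- `θ` and `θ'` witness an isomorphism between `A` and `B`: they are cut-free proof-nets of
respective conclusions `A⊥, B` and `B⊥, A`, their composition over `B` reduces by cut elimination to
the identity proof-net of `A`, and their composition over `A` to the identity proof-net of `B`. -/
structure IsIso (A B : Formula α) (θ θ' : Set (Linking Root)) : Prop where
  net : (seqAB A B).IsProofNet θ
  net' : (seqBA A B).IsProofNet θ'
  comp_B : Relation.ReflTransGen Step
    (cutSeq .B .dualB .dualA .A (by simp) B A.dual A, joins θ θ')
    (seq .dualA .A (by simp) A.dual A, idNet A (.dualA, []) (.A, []))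
  comp_A : Relation.ReflTransGen Step
    (cutSeq .A .dualA .dualB .B (by simp) A B.dual B, joins θ' θ)
    (seq .dualB .B (by simp) B.dual B, idNet B (.dualB, []) (.B, []))

end MALL

/-! The proof reads proof-nets in coherence spaces. A point of a formula selects one argument of
each surviving additive connective. Two points are compared by a sign (strictly coherent, strictly
incoherent or equal), once signs are chosen for the atoms at their common leaves. A linking on two
conclusions is thus a pair of points, and two linkings may be compared under any signs that are
opposite at the two ends of each shared link.

Coherence (`IsProofNet.coherent`). In a cut-free proof-net two linkings cannot be incoherent in one
conclusion and incoherent or equal in the others. Otherwise one walks up along incoherent vertices,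
across shared links and down along coherent vertices, jumping to a toggled `&`-vertex from a leaf
whose link is lost. No conclusion is coherent, so the walk never ends, and its recurrent part
consists of switching cycles. By (P3) some toggled `&`-vertex is on none of them, so the recurrent
jumps survive when the choice at that vertex is frozen. Repeating this leaves a single linking,
whose switching cycle contradicts (P2).

Mirror images (`reduction_spec`, `Iso.exists_matched`, `Iso.isRigid`). Following single linkings
through cut elimination shows that two linkings compose when they use dual leaves of the cut
formula, and which links result. Identities have no link inside one conclusion, whence
bipartiteness. As both compositions are identities, each linking of `θ` has a mirror image in `θ'`,
with dual points and dual links. Mirroring reverses signs, so coherence of both proof-nets forces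
the signs of two distinct linkings in `A⊥` and in `B` to be nonzero and opposite.

Ax-uniqueness (`matters_chain`, `link_unique`). If two linkings have different links at a leaf `x`,
the sign at `x` is free and is not felt in the other conclusion; this contradicts rigidity whenever
that sign determines the one of the conclusion of `x`. In a distributed formula any two points
through `x` are joined by a chain of pairs for which it does: a factor of a `⊗` is not a `⊕`, so it
can be changed in steps of sign `0` or `1`, which do not disturb the other factor; dually for `⅋`.
Every point belongs to a linking, so the link at `x` stays the same along the chain. -/

namespace MALL

variable {ι α : Type*}

/-! ### Occurrences -/

namespace Occ

theorem Below.refl (v : Occ ι) : v.Below v := ⟨rfl, List.suffix_refl _⟩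

theorem Below.trans {u v w : Occ ι} (h : u.Below v) (h' : v.Below w) : u.Below w :=
  ⟨h.1.trans h'.1, h.2.trans h'.2⟩

theorem below_child (v : Occ ι) (b : Bool) : v.Below (v.child b) :=
  ⟨rfl, List.suffix_cons _ _⟩

theorem Below.length_le {u v : Occ ι} (h : u.Below v) : u.2.length ≤ v.2.length :=
  h.2.length_le

theorem Below.antisymm {u v : Occ ι} (h : u.Below v) (h' : v.Below u) : u = v :=
  Prod.ext h.1 (h.2.eq_of_length_le h'.length_le)

theorem not_child_below (v : Occ ι) (b : Bool) : ¬ (v.child b).Below v := fun h => by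
  have := h.length_le
  simp [Occ.child] at this

theorem child_ne (v : Occ ι) (b : Bool) : v.child b ≠ v := fun h =>
  not_child_below v b (by rw [h]; exact Below.refl _)

theorem child_inj {u v : Occ ι} {b d : Bool} (h : u.child b = v.child d) : u = v ∧ b = d := by
  obtain ⟨u1, u2⟩ := u
  obtain ⟨v1, v2⟩ := v
  simp only [Occ.child, Prod.mk.injEq, List.cons.injEq] at h
  exact ⟨Prod.ext h.1 h.2.2, h.2.1⟩

theorem below_child_iff {u v : Occ ι} {b : Bool} :
    u.Below (v.child b) ↔ u = v.child b ∨ u.Below v := by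
  constructor
  · rintro ⟨h1, h2⟩
    rcases List.suffix_cons_iff.1 h2 with h | h
    · exact .inl (Prod.ext h1 h)
    · exact .inr ⟨h1, h⟩
  · rintro (rfl | h)
    · exact Below.refl _
    · exact h.trans (below_child v b)

theorem Below.total {u v w : Occ ι} (h : u.Below w) (h' : v.Below w) : u.Below v ∨ v.Below u := by
  rcases List.suffix_or_suffix_of_suffix h.2 h'.2 with h2 | h2
  · exact .inl ⟨h.1.trans h'.1.symm, h2⟩
  · exact .inr ⟨h'.1.trans h.1.symm, h2⟩

theorem child_below_inj {v w : Occ ι} {b d : Bool} (h : (v.child b).Below w)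
    (h' : (v.child d).Below w) : b = d := by
  rcases h.total h' with h2 | h2
  · exact (child_inj ((below_child_iff.1 h2).resolve_right (not_child_below v b))).2
  · exact (child_inj ((below_child_iff.1 h2).resolve_right (not_child_below v d))).2.symm

/-- Induction on the occurrences above a given one. -/
theorem Below.rec_above {v : Occ ι} {p : Occ ι → Prop} (h0 : p v)
    (h1 : ∀ w b, v.Below w → p w → p (w.child b)) {w : Occ ι} (h : v.Below w) : p w := by
  obtain ⟨v1, v2⟩ := v
  obtain ⟨w1, w2⟩ := w
  obtain ⟨rfl, q, rfl⟩ : v1 = w1 ∧ _ := h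
  induction q with
  | nil => exact h0
  | cons b q ih => exact h1 (v1, q ++ v2) b ⟨rfl, List.suffix_append _ _⟩ ih

theorem Below.eq_or_child {v w : Occ ι} (h : v.Below w) : w = v ∨ ∃ b, (v.child b).Below w := by
  refine Below.rec_above (p := fun w => w = v ∨ ∃ b, (v.child b).Below w) (.inl rfl) ?_ h
  rintro w b - (rfl | ⟨d, hd⟩)
  · exact .inr ⟨b, Below.refl _⟩
  · exact .inr ⟨d, hd.trans (below_child _ _)⟩

end Occ

/-! ### Vertices of a cut sequent -/

namespace CutSequent

variable {S : CutSequent ι α}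

theorem At.child {v : Occ ι} {c : Conn} {A B : Formula α} (h : S.At v (.bin c A B)) (b : Bool) :
    S.At (v.child b) (cond b B A) := by
  cases b
  · exact h.left
  · exact h.right

theorem At.inv {v : Occ ι} {A : Formula α} (h : S.At v A) :
    (v, A) ∈ S.roots ∨ ∃ u b c A₁ A₂, v = Occ.child u b ∧ S.At u (.bin c A₁ A₂) ∧
      A = cond b A₂ A₁ := by
  cases h with
  | root h => exact .inl h
  | left h => exact .inr ⟨_, false, _, _, _, rfl, h, rfl⟩
  | right h => exact .inr ⟨_, true, _, _, _, rfl, h, rfl⟩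

theorem roots_eq {r s : Occ ι × Formula α} (hr : r ∈ S.roots) (hs : s ∈ S.roots)
    (h : r.1.Below s.1) : r = s := by
  by_contra hne
  have : Std.Symm fun r s : Occ ι × Formula α => ¬ r.1.Below s.1 ∧ ¬ s.1.Below r.1 :=
    ⟨fun r s h => ⟨h.2, h.1⟩⟩
  have := S.disjoint.forall hr hs hne
  exact this.1 h

theorem At.exists_root {v : Occ ι} {A : Formula α} (h : S.At v A) :
    ∃ r ∈ S.roots, r.1.Below v := by
  induction h with
  | root h => exact ⟨_, h, Occ.Below.refl _⟩
  | left _ ih =>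
    obtain ⟨r, h1, h2⟩ := ih
    exact ⟨r, h1, h2.trans (Occ.below_child _ _)⟩
  | right _ ih =>
    obtain ⟨r, h1, h2⟩ := ih
    exact ⟨r, h1, h2.trans (Occ.below_child _ _)⟩

theorem At.eq_root {v : Occ ι} {A : Formula α} (h : S.At v A) {r : Occ ι × Formula α}
    (hr : r ∈ S.roots) (hv : v.Below r.1) : v = r.1 := by
  obtain ⟨s, hs, hsv⟩ := h.exists_root
  obtain rfl := roots_eq hs hr (hsv.trans hv)
  exact hv.antisymm hsv

/-- Disjointness of the trees makes a vertex either a root or the child of a known parent, never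
both, so the path leaves no choice. -/
theorem At.functional {v : Occ ι} {A B : Formula α} (h : S.At v A) (h' : S.At v B) : A = B := by
  have key : ∀ (u : Occ ι) (b : Bool) (c : Conn) (A₁ A₂ C : Formula α),
      S.At u (.bin c A₁ A₂) → (∀ D, S.At u D → .bin c A₁ A₂ = D) → S.At (u.child b) C →
      cond b A₂ A₁ = C := by
    intro u b c A₁ A₂ C hu ih hC
    rcases hC.inv with hC | ⟨u', b', c', B₁, B₂, he, hu', rfl⟩
    · exact absurd (hu.eq_root hC (Occ.below_child _ _)).symm (Occ.child_ne _ _)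
    · obtain ⟨rfl, rfl⟩ := Occ.child_inj he
      cases ih _ hu'
      rfl
  induction h generalizing B with
  | root h =>
    rcases h'.inv with h' | ⟨u, b, c, B₁, B₂, rfl, hu, rfl⟩
    · exact congrArg Prod.snd (roots_eq h h' (Occ.Below.refl _))
    · exact absurd (hu.eq_root h (Occ.below_child _ _)).symm (Occ.child_ne _ _)
  | left hu ih => exact key _ false _ _ _ _ hu (fun D hD => ih hD) h'
  | right hu ih => exact key _ true _ _ _ _ hu (fun D hD => ih hD) h'

/-- A vertex `v` on the path to `u` prevents `u.child b` from being a root itself, so its parent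
lies in the forest too. -/
theorem At.parent {u v : Occ ι} {A : Formula α} {b : Bool} (h : S.At (u.child b) A)
    (hv : ∃ B, S.At v B) (hvu : v.Below u) : ∃ c A₁ A₂, S.At u (.bin c A₁ A₂) := by
  obtain ⟨B, hv⟩ := hv
  rcases h.inv with h | ⟨u', b', c, A₁, A₂, he, hu, -⟩
  · have := hv.eq_root h (hvu.trans (Occ.below_child _ _))
    subst this
    exact absurd hvu (Occ.not_child_below _ _)
  · obtain ⟨rfl, rfl⟩ := Occ.child_inj he
    exact ⟨_, _, _, hu⟩

theorem At.of_child_below {v w : Occ ι} {A B : Formula α} {b : Bool} (hv : S.At v A)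
    (hw : S.At w B) (h : (v.child b).Below w) : ∃ c A₁ A₂, A = .bin c A₁ A₂ := by
  revert B
  refine Occ.Below.rec_above (p := fun w => ∀ {B}, S.At w B → ∃ c A₁ A₂, A = .bin c A₁ A₂) ?_ ?_ h
  · intro B hB
    obtain ⟨c, A₁, A₂, h⟩ := hB.parent ⟨_, hv⟩ (Occ.Below.refl _)
    exact ⟨c, A₁, A₂, hv.functional h⟩
  · intro w d hvw ih B hB
    obtain ⟨c, A₁, A₂, h⟩ := hB.parent ⟨_, hv⟩ ((Occ.below_child _ _).trans hvw)
    exact ih h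

theorem At.eq_of_lit {v w : Occ ι} {X : α} {x : Bool} {B : Formula α} (hv : S.At v (.lit X x))
    (hw : S.At w B) (h : v.Below w) : w = v := by
  rcases h.eq_or_child with h | ⟨b, h⟩
  · exact h
  · obtain ⟨c, A₁, A₂, h⟩ := hv.of_child_below hw h
    cases h

theorem IsLeaf.not_conn {v : Occ ι} {c : Conn} (h : S.IsLeaf v) (h' : S.IsConn c v) : False := by
  obtain ⟨X, b, h⟩ := h
  obtain ⟨A, B, h'⟩ := h'
  cases h.functional h'

theorem IsConn.unique {v : Occ ι} {c d : Conn} (h : S.IsConn c v) (h' : S.IsConn d v) : c = d := by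
  obtain ⟨_, _, h⟩ := h
  obtain ⟨_, _, h'⟩ := h'
  cases h.functional h'
  rfl

theorem IsPruning.of_below {P : Conn → Prop} {R : Set (Occ ι)} (hR : S.IsPruning P R)
    {v w : Occ ι} {A : Formula α} (hv : S.At v A) (h : v.Below w) (hw : w ∈ R) : v ∈ R := by
  revert hw
  refine Occ.Below.rec_above (p := fun w => w ∈ R → v ∈ R) id ?_ h
  intro w b hvw ih hw
  obtain ⟨B, hB⟩ := hR.vertex _ hw
  obtain ⟨c, A₁, A₂, h⟩ := hB.parent ⟨_, hv⟩ hvw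
  exact ih (hR.parent c w b ⟨_, _, h⟩ hw)

theorem IsPruning.exists_leaf {P : Conn → Prop} {R : Set (Occ ι)} (hR : S.IsPruning P R)
    {v : Occ ι} (hv : v ∈ R) : ∃ w ∈ R, S.IsLeaf w ∧ v.Below w := by
  obtain ⟨A, hA⟩ := hR.vertex v hv
  induction A generalizing v with
  | lit X b => exact ⟨v, hv, ⟨X, b, hA⟩, Occ.Below.refl _⟩
  | bin c A B ihA ihB =>
    have hc : S.IsConn c v := ⟨_, _, hA⟩
    have key : v.child false ∈ R ∨ v.child true ∈ R := by
      by_cases h : P c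
      · rcases hR.one c v h hc hv with h | h
        · exact .inl h.1
        · exact .inr h.1
      · exact .inl (hR.both c v h hc hv).1
    rcases key with h | h
    · obtain ⟨w, h1, h2, h3⟩ := ihA h hA.left
      exact ⟨w, h1, h2, (Occ.below_child _ _).trans h3⟩
    · obtain ⟨w, h1, h2, h3⟩ := ihB h hA.right
      exact ⟨w, h1, h2, (Occ.below_child _ _).trans h3⟩

theorem finite_above {v : Occ ι} {A : Formula α} (hv : S.At v A) :
    {w | v.Below w ∧ ∃ B, S.At w B}.Finite := by
  induction A generalizing v with
  | lit X b =>
    refine (Set.finite_singleton v).subset ?_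
    rintro w ⟨h, B, hB⟩
    exact hv.eq_of_lit hB h
  | bin c A B ihA ihB =>
    refine (((ihA hv.left).union (ihB hv.right)).union (Set.finite_singleton v)).subset ?_
    rintro w ⟨h, hB⟩
    rcases h.eq_or_child with h | ⟨b, h⟩
    · exact .inr h
    · cases b
      · exact .inl (.inl ⟨h, hB⟩)
      · exact .inl (.inr ⟨h, hB⟩)

theorem finite_vertices (S : CutSequent ι α) : {v | ∃ A, S.At v A}.Finite := by
  have : (⋃ r ∈ {r | r ∈ S.roots}, {w | r.1.Below w ∧ ∃ B, S.At w B}).Finite :=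
    S.roots.finite_toSet.biUnion fun r hr => finite_above (.root hr)
  refine this.subset ?_
  rintro v ⟨A, hA⟩
  obtain ⟨r, hr, h⟩ := hA.exists_root
  exact Set.mem_biUnion hr ⟨h, A, hA⟩

/-- A resolution is the set of vertices lying between the roots and its leaves. Hence the support of
a linking determines its resolution. -/
theorem IsResolutionOf.mem_iff {l : Linking ι} {R : Set (Occ ι)} (hR : S.IsResolutionOf l R)
    {v : Occ ι} : v ∈ R ↔ (∃ A, S.At v A) ∧ ∃ w ∈ l.support, v.Below w := by
  constructor
  · intro h
    refine ⟨hR.1.pruning.vertex v h, ?_⟩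
    obtain ⟨w, h1, h2, h3⟩ := hR.1.pruning.exists_leaf h
    exact ⟨w, by rw [hR.2]; exact ⟨h1, h2⟩, h3⟩
  · rintro ⟨⟨A, hA⟩, w, hw, h⟩
    rw [hR.2] at hw
    exact hR.1.pruning.of_below hA h hw.1

theorem IsResolutionOf.unique {l : Linking ι} {R R' : Set (Occ ι)} (hR : S.IsResolutionOf l R)
    (hR' : S.IsResolutionOf l R') : R = R' := by
  ext v
  rw [hR.mem_iff, hR'.mem_iff]

theorem IsResolutionOf.res_eq {l : Linking ι} {R : Set (Occ ι)} (hR : S.IsResolutionOf l R) :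
    S.res l = R := by
  ext v
  exact ⟨fun ⟨R', hR', h⟩ => hR.unique hR' ▸ h, fun h => ⟨R, hR, h⟩⟩

theorem IsResolutionOf.isLeaf {l : Linking ι} {R : Set (Occ ι)} (hR : S.IsResolutionOf l R)
    {v : Occ ι} (h : v ∈ l.support) : S.IsLeaf v := by
  rw [hR.2] at h
  exact h.2

theorem IsResolutionOf.mem_of_support {l : Linking ι} {R : Set (Occ ι)}
    (hR : S.IsResolutionOf l R) {v : Occ ι} (h : v ∈ l.support) : v ∈ R := by
  rw [hR.2] at h
  exact h.1

end CutSequent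

end MALL

namespace MALL

variable {ι α : Type*}

/-! ### Points of a formula, and their coherence -/

/-- The points of a formula: choices of one argument of each additive connective, as far as these
connectives are not themselves deleted. -/
def Pt : Formula α → Type
  | .lit _ _ => Unit
  | .bin .tens A B => Pt A × Pt B
  | .bin .parr A B => Pt A × Pt B
  | .bin .amp A B => Pt A ⊕ Pt B
  | .bin .plus A B => Pt A ⊕ Pt B

/-- The leaves of a point of a formula occurring at `v`. -/
def leaves : (F : Formula α) → Pt F → Occ ι → Set (Occ ι)
  | .lit _ _, _, v => {v}
  | .bin .tens A B, a, v => leaves A a.1 (v.child false) ∪ leaves B a.2 (v.child true)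
  | .bin .parr A B, a, v => leaves A a.1 (v.child false) ∪ leaves B a.2 (v.child true)
  | .bin .amp A B, a, v =>
      Sum.elim (fun a => leaves A a (v.child false)) (fun a => leaves B a (v.child true)) a
  | .bin .plus A B, a, v =>
      Sum.elim (fun a => leaves A a (v.child false)) (fun a => leaves B a (v.child true)) a

/-- Coherence in a tensor product of coherence spaces: `1` is strict coherence, `-1` is strict
incoherence, `0` is equality. -/
def tensSign (a b : SignType) : SignType :=
  if a = -1 ∨ b = -1 then -1 else if a = 0 ∧ b = 0 then 0 else 1

/-- Coherence in a par of coherence spaces. -/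
def parrSign (a b : SignType) : SignType :=
  if a = 1 ∨ b = 1 then 1 else if a = 0 ∧ b = 0 then 0 else -1

/-- Coherence in a sum of coherence spaces, points of different summands having coherence `d`. -/
def sumSign {P Q : Type} (d : SignType) (f : P → P → SignType) (g : Q → Q → SignType) :
    P ⊕ Q → P ⊕ Q → SignType
  | .inl a, .inl b => f a b
  | .inr a, .inr b => g a b
  | _, _ => d

/-- The coherence of two points of a formula occurring at `v`, given the coherence of their values
at common leaves. -/
def typ : (F : Formula α) → Pt F → Pt F → Occ ι → (Occ ι → SignType) → SignType
  | .lit _ _, _, _, v, s => s v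
  | .bin .tens A B, a, b, v, s =>
      tensSign (typ A a.1 b.1 (v.child false) s) (typ B a.2 b.2 (v.child true) s)
  | .bin .parr A B, a, b, v, s =>
      parrSign (typ A a.1 b.1 (v.child false) s) (typ B a.2 b.2 (v.child true) s)
  | .bin .amp A B, a, b, v, s =>
      sumSign 1 (fun a b => typ A a b (v.child false) s) (fun a b => typ B a b (v.child true) s) a b
  | .bin .plus A B, a, b, v, s =>
      sumSign (-1) (fun a b => typ A a b (v.child false) s)
        (fun a b => typ B a b (v.child true) s) a b

theorem tensSign_eq_zero : ∀ {a b : SignType}, tensSign a b = 0 → a = 0 ∧ b = 0 := by decide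

theorem parrSign_eq_zero : ∀ {a b : SignType}, parrSign a b = 0 → a = 0 ∧ b = 0 := by decide

theorem parrSign_neg : ∀ a b : SignType, parrSign (-a) (-b) = -tensSign b a := by decide

theorem tensSign_neg : ∀ a b : SignType, tensSign (-a) (-b) = -parrSign b a := by decide

theorem tensSign_zero : ∀ a : SignType, tensSign a 0 = a := by decide

theorem parrSign_zero : ∀ a : SignType, parrSign a 0 = a := by decide

theorem tensSign_self : ∀ a : SignType, tensSign a a = a := by decide

theorem parrSign_self : ∀ a : SignType, parrSign a a = a := by decide

theorem tensSign_comm : ∀ a b : SignType, tensSign a b = tensSign b a := by decide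

theorem parrSign_comm : ∀ a b : SignType, parrSign a b = parrSign b a := by decide

theorem leaves_below {F : Formula α} {a : Pt F} {v w : Occ ι} (h : w ∈ leaves F a v) :
    v.Below w := by
  induction F generalizing v with
  | lit X b =>
    cases h
    exact Occ.Below.refl _
  | bin c A B ihA ihB =>
    have key : (∃ a, w ∈ leaves A a (v.child false)) ∨ ∃ b, w ∈ leaves B b (v.child true) := by
      cases c
      · exact h.imp (fun h => ⟨_, h⟩) (fun h => ⟨_, h⟩)
      · exact h.imp (fun h => ⟨_, h⟩) (fun h => ⟨_, h⟩)
      all_goals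
        rcases a with a | a
        · exact .inl ⟨_, h⟩
        · exact .inr ⟨_, h⟩
    rcases key with ⟨a, h⟩ | ⟨a, h⟩
    · exact (Occ.below_child _ _).trans (ihA h)
    · exact (Occ.below_child _ _).trans (ihB h)

theorem leaves_nonempty (F : Formula α) (a : Pt F) (v : Occ ι) : (leaves F a v).Nonempty := by
  induction F generalizing v with
  | lit X b => exact ⟨v, rfl⟩
  | bin c A B ihA ihB =>
    cases c
    · exact (ihA _ _).inl
    · exact (ihA _ _).inl
    all_goals
      rcases a with a | a
      · exact ihA a _
      · exact ihB a _

theorem leaves_disjoint {A B : Formula α} {a : Pt A} {b : Pt B} {v w : Occ ι}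
    (h : w ∈ leaves A a (v.child false)) (h' : w ∈ leaves B b (v.child true)) : False :=
  Bool.false_ne_true (Occ.child_below_inj (leaves_below h) (leaves_below h'))

theorem leaves_injective {F : Formula α} {a b : Pt F} {v : Occ ι}
    (h : leaves F a v = leaves F b v) : a = b := by
  have split : ∀ {A B : Formula α} {a a' : Pt A} {b b' : Pt B} {v : Occ ι},
      leaves A a (v.child false) ∪ leaves B b (v.child true) =
        leaves A a' (v.child false) ∪ leaves B b' (v.child true) →
      leaves A a (v.child false) = leaves A a' (v.child false) ∧
        leaves B b (v.child true) = leaves B b' (v.child true) := by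
    intro A B a a' b b' v h
    constructor <;> ext w
    · constructor <;> intro hw
      · exact (h.subset (.inl hw)).resolve_right fun h' => leaves_disjoint hw h'
      · exact (h.superset (.inl hw)).resolve_right fun h' => leaves_disjoint hw h'
    · constructor <;> intro hw
      · exact (h.subset (.inr hw)).resolve_left fun h' => leaves_disjoint h' hw
      · exact (h.superset (.inr hw)).resolve_left fun h' => leaves_disjoint h' hw
  induction F generalizing v with
  | lit X b => rfl
  | bin c A B ihA ihB =>
    cases c
    · exact Prod.ext (ihA (split h).1) (ihB (split h).2)
    · exact Prod.ext (ihA (split h).1) (ihB (split h).2)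
    all_goals
      rcases a with a | a <;> rcases b with b | b
      · exact congrArg Sum.inl (ihA h)
      · obtain ⟨w, hw⟩ := leaves_nonempty A a (v.child false)
        exact (leaves_disjoint hw (h.subset hw)).elim
      · obtain ⟨w, hw⟩ := leaves_nonempty A b (v.child false)
        exact (leaves_disjoint hw (h.superset hw)).elim
      · exact congrArg Sum.inr (ihB h)

/-- Different arguments of an additive never have sign `0`, and a pair has sign `0` only if both
components do, so all choices agree. -/
theorem eq_of_typ_eq_zero {F : Formula α} {a b : Pt F} {v : Occ ι} {s : Occ ι → SignType}
    (h : typ F a b v s = 0) : a = b := by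
  induction F generalizing v with
  | lit X b => rfl
  | bin c A B ihA ihB =>
    cases c
    · exact Prod.ext (ihA (tensSign_eq_zero h).1) (ihB (tensSign_eq_zero h).2)
    · exact Prod.ext (ihA (parrSign_eq_zero h).1) (ihB (parrSign_eq_zero h).2)
    all_goals
      rcases a with a | a <;> rcases b with b | b
      · exact congrArg Sum.inl (ihA h)
      · cases h
      · cases h
      · exact congrArg Sum.inr (ihB h)

theorem typ_congr {F : Formula α} {a b : Pt F} {v : Occ ι} {s t : Occ ι → SignType}
    (h : ∀ w, v.Below w → s w = t w) : typ F a b v s = typ F a b v t := by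
  induction F generalizing v with
  | lit X b => exact h v (Occ.Below.refl _)
  | bin c A B ihA ihB =>
    have hA : ∀ a b, typ A a b (v.child false) s = typ A a b (v.child false) t :=
      fun a b => ihA fun w hw => h w ((Occ.below_child _ _).trans hw)
    have hB : ∀ a b, typ B a b (v.child true) s = typ B a b (v.child true) t :=
      fun a b => ihB fun w hw => h w ((Occ.below_child _ _).trans hw)
    cases c <;> simp only [typ, hA, hB]

theorem typ_self_zero {F : Formula α} {a : Pt F} {v : Occ ι} {s : Occ ι → SignType}
    (h : ∀ w ∈ leaves F a v, s w = 0) : typ F a a v s = 0 := by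
  induction F generalizing v with
  | lit X b => exact h v rfl
  | bin c A B ihA ihB =>
    cases c
    · simp only [typ]
      rw [ihA fun w hw => h w (.inl hw), ihB fun w hw => h w (.inr hw)]
      rfl
    · simp only [typ]
      rw [ihA fun w hw => h w (.inl hw), ihB fun w hw => h w (.inr hw)]
      rfl
    all_goals
      rcases a with a | a
      · exact ihA h
      · exact ihB h

/-- Both sign operations are idempotent. This provides signs that give an unchanged component any
prescribed coherence. -/
theorem typ_self_const {F : Formula α} {a : Pt F} {v : Occ ι} (ε : SignType) :
    typ F a a v (fun _ => ε) = ε := by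
  induction F generalizing v with
  | lit X b => rfl
  | bin c A B ihA ihB =>
    cases c
    · simp only [typ, ihA, ihB, tensSign_self]
    · simp only [typ, ihA, ihB, parrSign_self]
    all_goals
      rcases a with a | a
      · exact ihA
      · exact ihB

/-! ### Duality -/

section Dual

variable (ρ : ι → ι)

/-- The dual occurrence, the roots being renamed by `ρ`. -/
def Occ.flip (v : Occ ι) : Occ ι := (ρ v.1, v.2.map not)

@[simp] theorem Occ.flip_child (v : Occ ι) (b : Bool) :
    (v.child b).flip ρ = (v.flip ρ).child (!b) := rfl

variable {ρ} in
theorem Occ.flip_flip (hρ : ∀ i, ρ (ρ i) = i) (v : Occ ι) : (v.flip ρ).flip ρ = v := by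
  simp [Occ.flip, hρ, Function.comp_def]

theorem Formula.dual_dual (F : Formula α) : F.dual.dual = F := by
  induction F with
  | lit X b => simp [Formula.dual]
  | bin c A B ihA ihB => cases c <;> simp [Formula.dual, Conn.dual, ihA, ihB]

/-- The point of the dual formula that makes dual choices. -/
def Pt.dual : (F : Formula α) → Pt F → Pt F.dual
  | .lit _ _, _ => ()
  | .bin .tens A B, a => (Pt.dual B a.2, Pt.dual A a.1)
  | .bin .parr A B, a => (Pt.dual B a.2, Pt.dual A a.1)
  | .bin .amp A B, a => a.elim (fun a => .inr (Pt.dual A a)) (fun b => .inl (Pt.dual B b))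
  | .bin .plus A B, a => a.elim (fun a => .inr (Pt.dual A a)) (fun b => .inl (Pt.dual B b))

theorem leaves_dual {F : Formula α} (a : Pt F) (v : Occ ι) :
    leaves F.dual (Pt.dual F a) (v.flip ρ) = Occ.flip ρ '' leaves F a v := by
  induction F generalizing v with
  | lit X b => simp [Formula.dual, leaves]
  | bin c A B ihA ihB =>
    have hA := fun a => ihA a (v.child false)
    have hB := fun a => ihB a (v.child true)
    rw [Occ.flip_child] at hA
    simp only [Occ.flip_child, Bool.not_true, Bool.not_false] at hA hB
    cases c
    · exact (congrArg₂ _ (hB _) (hA _)).trans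
        ((Set.union_comm _ _).trans (Set.image_union ..).symm)
    · exact (congrArg₂ _ (hB _) (hA _)).trans
        ((Set.union_comm _ _).trans (Set.image_union ..).symm)
    all_goals
      rcases a with a | a
      · exact hA a
      · exact hB a

theorem typ_dual {F : Formula α} (a b : Pt F) (v : Occ ι) (s : Occ ι → SignType) :
    typ F.dual (Pt.dual F a) (Pt.dual F b) (v.flip ρ) s = -typ F a b v fun w => -s (w.flip ρ) := by
  induction F generalizing v with
  | lit X b => exact (neg_neg _).symm
  | bin c A B ihA ihB =>
    have hA := fun a b => ihA a b (v.child false)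
    have hB := fun a b => ihB a b (v.child true)
    simp only [Occ.flip_child, Bool.not_true, Bool.not_false] at hA hB
    cases c
    · exact (congrArg₂ parrSign (hB _ _) (hA _ _)).trans (parrSign_neg _ _)
    · exact (congrArg₂ tensSign (hB _ _) (hA _ _)).trans (tensSign_neg _ _)
    all_goals
      rcases a with a | a <;> rcases b with b | b
      · exact hA a b
      · rfl
      · rfl
      · exact hB a b

/-- Points follow the same recursion as `idNet`: pairs at a multiplicative connective, alternatives
at an additive one. -/
theorem mem_idNet {F : Formula α} {v : Occ ι} {m : Linking ι} :
    m ∈ idNet F (v.flip ρ) v ↔ ∃ a : Pt F, m = (fun w => s(w.flip ρ, w)) '' leaves F a v := by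
  induction F generalizing v m with
  | lit X b =>
    simp only [idNet, Set.mem_singleton_iff, leaves, Set.image_singleton]
    exact ⟨fun h => ⟨(), h⟩, fun ⟨_, h⟩ => h⟩
  | bin c A B ihA ihB =>
    have hA := fun m => @ihA (v.child false) m
    have hB := fun m => @ihB (v.child true) m
    simp only [Occ.flip_child, Bool.not_true, Bool.not_false] at hA hB
    cases c
    case tens | parr =>
      simp only [idNet, Conn.IsAdditive, reduceCtorEq, or_self, if_false, joins, Set.mem_ofPred_eq,
        hA, hB]
      constructor
      · rintro ⟨_, ⟨a, rfl⟩, _, ⟨b, rfl⟩, rfl⟩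
        exact ⟨(a, b), (Set.image_union ..).symm⟩
      · rintro ⟨⟨a, b⟩, rfl⟩
        exact ⟨_, ⟨a, rfl⟩, _, ⟨b, rfl⟩, Set.image_union ..⟩
    case amp | plus =>
      simp only [idNet, Conn.IsAdditive, reduceCtorEq, or_true, true_or, if_true, Set.mem_union,
        hA, hB]
      constructor
      · rintro (⟨a, rfl⟩ | ⟨a, rfl⟩)
        · exact ⟨.inl a, rfl⟩
        · exact ⟨.inr a, rfl⟩
      · rintro ⟨a | a, rfl⟩
        · exact .inl ⟨a, rfl⟩
        · exact .inr ⟨a, rfl⟩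

end Dual

/-! ### The points of a resolution -/

open Classical in
/-- The point of the formula occurring at `v` that is chosen by the resolution `R`. -/
noncomputable def ptAt (R : Set (Occ ι)) : (F : Formula α) → Occ ι → Pt F
  | .lit _ _, _ => ()
  | .bin .tens A B, v => (ptAt R A (v.child false), ptAt R B (v.child true))
  | .bin .parr A B, v => (ptAt R A (v.child false), ptAt R B (v.child true))
  | .bin .amp A B, v =>
      if v.child false ∈ R then .inl (ptAt R A (v.child false)) else .inr (ptAt R B (v.child true))
  | .bin .plus A B, v =>
      if v.child false ∈ R then .inl (ptAt R A (v.child false)) else .inr (ptAt R B (v.child true))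

theorem ptAt_additive_left {R : Set (Occ ι)} {v : Occ ι} (h : v.child false ∈ R)
    (A B : Formula α) :
    ptAt R (.bin .amp A B) v = (Sum.inl (ptAt R A (v.child false)) : Pt A ⊕ Pt B) ∧
    ptAt R (.bin .plus A B) v = (Sum.inl (ptAt R A (v.child false)) : Pt A ⊕ Pt B) :=
  ⟨if_pos h, if_pos h⟩

theorem ptAt_additive_right {R : Set (Occ ι)} {v : Occ ι} (h : v.child false ∉ R)
    (A B : Formula α) :
    ptAt R (.bin .amp A B) v = (Sum.inr (ptAt R B (v.child true)) : Pt A ⊕ Pt B) ∧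
    ptAt R (.bin .plus A B) v = (Sum.inr (ptAt R B (v.child true)) : Pt A ⊕ Pt B) :=
  ⟨if_neg h, if_neg h⟩

/-- The bridge from resolutions to points. Testing the left premise alone in `ptAt` suffices because
a resolution keeps exactly one premise of an additive vertex. -/
theorem mem_leaves_ptAt {S : CutSequent ι α} {R : Set (Occ ι)}
    (hR : S.IsPruning Conn.IsAdditive R) {F : Formula α} {v w : Occ ι} (hv : v ∈ R)
    (hF : S.At v F) : w ∈ leaves F (ptAt R F v) v ↔ v.Below w ∧ w ∈ R ∧ S.IsLeaf w := by
  induction F generalizing v with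
  | lit X b =>
    constructor
    · rintro rfl
      exact ⟨Occ.Below.refl _, hv, X, b, hF⟩
    · rintro ⟨h, -, X', b', hw⟩
      exact hF.eq_of_lit hw h
  | bin c A B ihA ihB =>
    have hc : S.IsConn c v := ⟨_, _, hF⟩
    have up : v.Below w ∧ w ∈ R ∧ S.IsLeaf w ↔
        (v.child false ∈ R ∧ (v.child false).Below w ∧ w ∈ R ∧ S.IsLeaf w) ∨
        (v.child true ∈ R ∧ (v.child true).Below w ∧ w ∈ R ∧ S.IsLeaf w) := by
      constructor
      · rintro ⟨h, hw, hl⟩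
        rcases h.eq_or_child with rfl | ⟨b, h⟩
        · exact (hl.not_conn hc).elim
        · have := hR.of_below (hF.child b) h hw
          cases b
          · exact .inl ⟨this, h, hw, hl⟩
          · exact .inr ⟨this, h, hw, hl⟩
      · rintro (⟨-, h, h'⟩ | ⟨-, h, h'⟩) <;> exact ⟨(Occ.below_child _ _).trans h, h'⟩
    rw [up]
    cases c
    case tens | parr =>
      obtain ⟨h1, h2⟩ := hR.both _ v (by simp [Conn.IsAdditive]) hc hv
      simp only [leaves, ptAt, Set.mem_union, ihA h1 hF.left, ihB h2 hF.right, h1, h2, true_and]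
    case amp | plus =>
      have h := hR.one _ v (by simp [Conn.IsAdditive]) hc hv
      by_cases h1 : v.child false ∈ R
      · have h2 : v.child true ∉ R := fun h2 => by simp [Xor, h1, h2] at h
        simp only [leaves, (ptAt_additive_left h1 A B).1, (ptAt_additive_left h1 A B).2, h1, h2,
          Sum.elim_inl, ihA h1 hF.left, true_and, false_and, or_false]
      · have h2 : v.child true ∈ R := by simpa [Xor, h1] using h
        simp only [leaves, (ptAt_additive_right h1 A B).1, (ptAt_additive_right h1 A B).2, h1, h2,
          Sum.elim_inr, ihB h2 hF.right, true_and, false_and, false_or]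

end MALL

namespace MALL

variable {ι α : Type*}

/-! ### Cycles from directed walks -/

theorem exists_path_of_reflTransGen {V : Type*} {G : SimpleGraph V} {r : V → V → Prop}
    (hr : ∀ x y, r x y → G.Adj x y) {x y : V} (h : Relation.ReflTransGen r x y) :
    ∃ p : G.Walk x y, p.IsPath ∧ ∀ d ∈ p.darts, r d.fst d.snd := by
  classical
  have : ∃ p : G.Walk x y, ∀ d ∈ p.darts, r d.fst d.snd := by
    induction h using Relation.ReflTransGen.head_induction_on with
    | refl => exact ⟨.nil, by simp⟩
    | head h _ ih =>
      obtain ⟨p, hp⟩ := ih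
      exact ⟨.cons (hr _ _ h) p, by simpa [h] using hp⟩
  obtain ⟨p, hp⟩ := this
  exact ⟨p.bypass, p.bypass_isPath, fun d hd => hp d (p.darts_bypass_subset_darts hd)⟩

/-- A closed walk of an asymmetric relation yields a cycle that follows the relation and passes
through every vertex at most once. -/
theorem exists_cycle_of_reflTransGen {V : Type*} {G : SimpleGraph V} {r : V → V → Prop}
    (hr : ∀ x y, r x y → G.Adj x y) (has : ∀ x y, r x y → ¬ r y x) {x y : V} (h : r x y)
    (h' : Relation.ReflTransGen r y x) :
    ∃ p : G.Walk x x, p.IsCycle ∧ (∀ d ∈ p.darts, r d.fst d.snd) ∧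
      (∀ d ∈ p.darts, ∀ e ∈ p.darts, d.fst = e.fst → d = e) ∧
      ∀ d ∈ p.darts, ∀ e ∈ p.darts, d.snd = e.snd → d = e := by
  obtain ⟨p, hp, hd⟩ := exists_path_of_reflTransGen hr h'
  have hc : (SimpleGraph.Walk.cons (hr _ _ h) p).IsCycle := by
    rw [SimpleGraph.Walk.cons_isCycle_iff]
    refine ⟨hp, fun he => ?_⟩
    -- The closing edge can recur only as the first edge of the path, which does not return to `y`;
    -- the relation would then hold both ways between `x` and `y`.
    cases p with
    | nil => exact has _ _ h h
    | cons h2 p =>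
      rw [SimpleGraph.Walk.cons_isPath_iff] at hp
      rw [SimpleGraph.Walk.edges_cons, List.mem_cons] at he
      rcases he with he | he
      · rw [Sym2.eq_iff] at he
        rcases he with ⟨h3, h4⟩ | ⟨h3, -⟩
        · exact (hr _ _ h).ne h3
        · subst h3
          exact has _ _ h (hd ⟨(_, _), h2⟩ (by simp))
      · exact hp.2 (SimpleGraph.Walk.snd_mem_support_of_mem_edges _ he)
  refine ⟨_, hc, ?_, ?_, ?_⟩
  · intro d hd'
    rw [SimpleGraph.Walk.darts_cons, List.mem_cons] at hd'
    rcases hd' with rfl | hd'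
    · exact h
    · exact hd d hd'
  · refine fun d hd e he hde => List.inj_on_of_nodup_map (f := fun d => d.fst) ?_ hd he hde
    rw [SimpleGraph.Walk.map_fst_darts]
    exact hc.nodup_dropLast_support
  · refine fun d hd e he hde => List.inj_on_of_nodup_map (f := fun d => d.snd) ?_ hd he hde
    rw [SimpleGraph.Walk.map_snd_darts]
    exact hc.support_nodup

/-- In a finite set, a relation without dead ends has a strongly connected component that cannot
be left. -/
theorem exists_terminal {V : Type*} {r : V → V → Prop} {s : Set V} (hs : s.Finite)
    (hne : s.Nonempty) (hr : ∀ x y, r x y → y ∈ s) :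
    ∃ x ∈ s, ∀ y, Relation.ReflTransGen r x y → Relation.ReflTransGen r y x := by
  have hr' : ∀ x y, x ∈ s → Relation.ReflTransGen r x y → y ∈ s := by
    intro x y hx h
    induction h with
    | refl => exact hx
    | tail _ h _ => exact hr _ _ h
  obtain ⟨x, hx, hmin⟩ := Set.exists_min_image s
    (fun x => {y | Relation.ReflTransGen r x y}.ncard) hs hne
  refine ⟨x, hx, fun y hy => ?_⟩
  have hsub : {z | Relation.ReflTransGen r y z} ⊆ {z | Relation.ReflTransGen r x z} :=
    fun z hz => hy.trans hz
  have hfin : {z | Relation.ReflTransGen r x z}.Finite := hs.subset fun z hz => hr' x z hx hz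
  have := Set.eq_of_subset_of_ncard_le hsub (hmin y (hr' x y hx hy)) hfin
  exact this.superset (Relation.ReflTransGen.refl : Relation.ReflTransGen r x x)

/-! ### Dependency in a cube -/

section Cube

variable {V : Type*} [DecidableEq V] {f : Finset V → Prop}

/-- Going from `∅` to `T` one element at a time, a change of `f` must occur at a single insertion.
This locates a `&`-vertex on which a lost link depends. -/
theorem exists_flip {T : Finset V} (h0 : f ∅) (h1 : ¬ f T) :
    ∃ w ∈ T, ∃ X ⊆ T, ¬ (f X ↔ f (insert w X)) := by
  by_contra! h
  refine h1 ?_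
  have : ∀ X ⊆ T, f X := by
    intro X
    induction X using Finset.induction_on with
    | empty => exact fun _ => h0
    | insert w X _ ih =>
      intro hX
      rw [Finset.insert_subset_iff] at hX
      exact (h w hX.1 X hX.2).1 (ih hX.2)
  exact this T (Finset.Subset.refl _)

/-- As `w` never influences `f` on the face `U`, it can be erased from `X`; dependencies on other
elements thus persist on the smaller face. -/
theorem exists_flip_erase {U X : Finset V} {w z : V} (hX : X ⊆ U) (hz : z ∈ U)
    (h : ¬ (f X ↔ f (insert z X))) (hw : ∀ Y ⊆ U, (f Y ↔ f (insert w Y))) :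
    z ≠ w ∧ ∃ Y ⊆ U.erase w, ¬ (f Y ↔ f (insert z Y)) := by
  have hzw : z ≠ w := by
    rintro rfl
    exact h (hw X hX)
  refine ⟨hzw, X.erase w, Finset.erase_subset_erase _ hX, fun h' => h ?_⟩
  by_cases hwX : w ∈ X
  · have h1 := hw (X.erase w) ((Finset.erase_subset _ _).trans hX)
    have h2 := hw (insert z (X.erase w))
      (Finset.insert_subset hz ((Finset.erase_subset _ _).trans hX))
    rw [Finset.insert_erase hwX] at h1
    rw [Finset.insert_comm, Finset.insert_erase hwX] at h2
    exact h1.symm.trans (h'.trans h2)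
  · rwa [Finset.erase_eq_of_notMem hwX] at h'

end Cube

namespace CutSequent

variable {S : CutSequent ι α}

/-! ### Resolutions given by a choice of sides -/

/-- The `&`-resolution that keeps the premise number `φ N` of each `&`-vertex `N`. -/
def sideRes (S : CutSequent ι α) (φ : Occ ι → Bool) : Set (Occ ι) :=
  {v | (∃ A, S.At v A) ∧ ∀ N b, S.IsConn .amp N → (N.child b).Below v → b = φ N}

theorem isWithResolution_sideRes (S : CutSequent ι α) (φ : Occ ι → Bool) :
    S.IsWithResolution (S.sideRes φ) := by
  refine ⟨⟨fun v hv => hv.1, ?_, ?_, ?_⟩, ?_⟩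
  · rintro c v b ⟨A, B, hv⟩ ⟨-, h⟩
    exact ⟨⟨_, hv⟩, fun N d hN hd => h N d hN (hd.trans (Occ.below_child _ _))⟩
  · intro c v hc hv h
    have key : ∀ b, v.child b ∈ S.sideRes φ := by
      obtain ⟨A, B, hA⟩ := id hv
      refine fun b => ⟨⟨_, hA.child b⟩, fun N d hN hd => ?_⟩
      rcases Occ.below_child_iff.1 hd with he | hd
      · obtain ⟨rfl, -⟩ := Occ.child_inj he
        exact absurd (hv.unique hN) hc
      · exact h.2 N d hN hd
    exact ⟨key _, key _⟩
  · rintro c v rfl hv h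
    have key : ∀ b, v.child b ∈ S.sideRes φ ↔ b = φ v := by
      obtain ⟨A, B, hA⟩ := id hv
      refine fun b => ⟨fun hb => hb.2 v b hv (Occ.Below.refl _), fun hb => ⟨⟨_, hA.child b⟩, ?_⟩⟩
      intro N d hN hd
      rcases Occ.below_child_iff.1 hd with he | hd
      · obtain ⟨rfl, rfl⟩ := Occ.child_inj he
        exact hb
      · exact h.2 N d hN hd
    rw [key, key]
    cases φ v <;> simp [Xor]
  · refine fun r hr => ⟨⟨_, .root hr⟩, fun N d hN hd => ?_⟩
    obtain ⟨A, B, hN⟩ := hN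
    have := (hN.eq_root hr ((Occ.below_child _ _).trans hd))
    subst this
    exact absurd hd (Occ.not_child_below _ _)

theorem IsResolutionOf.support_subset_sideRes {l : Linking ι} {R : Set (Occ ι)}
    (hR : S.IsResolutionOf l R) {φ : Occ ι → Bool}
    (h : ∀ N b, S.IsConn .amp N → N.child b ∈ R → b = φ N) : l.support ⊆ S.sideRes φ := by
  intro w hw
  have hwR := hR.mem_of_support hw
  refine ⟨hR.1.pruning.vertex w hwR, fun N b hN hb => h N b hN ?_⟩
  obtain ⟨A, B, hA⟩ := hN
  exact hR.1.pruning.of_below (hA.child b) hb hwR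

theorem IsResolutionOf.side_eq {l : Linking ι} {R : Set (Occ ι)}
    (hR : S.IsResolutionOf l R) {φ : Occ ι → Bool} (h : l.support ⊆ S.sideRes φ) {N : Occ ι}
    {b : Bool} (hN : S.IsConn .amp N) (hb : N.child b ∈ R) : b = φ N := by
  obtain ⟨w, h1, h2, h3⟩ := hR.1.pruning.exists_leaf hb
  exact (h (by rw [hR.2]; exact ⟨h1, h2⟩)).2 N b hN h3

theorem IsPruning.not_both {P : Conn → Prop} {R : Set (Occ ι)} (hR : S.IsPruning P R) {c : Conn}
    (hc : P c) {v : Occ ι} (hv : S.IsConn c v) {b : Bool} (h : v.child b ∈ R)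
    (h' : v.child (!b) ∈ R) : False := by
  have := hR.one c v hc hv (hR.parent c v b hv h)
  cases b <;> simp_all [Xor]

namespace IsProofNet

variable {θ : Set (Linking ι)}

theorem isResolutionOf (hθ : S.IsProofNet θ) {l : Linking ι} (hl : l ∈ θ) : S.IsResolutionOf l (S.res l) := by
  obtain ⟨R, hR⟩ := (hθ.linking l hl).resolution
  rwa [hR.res_eq]

theorem exists_on (hθ : S.IsProofNet θ) (φ : Occ ι → Bool) : ∃ l, l ∈ θ ∧ l.support ⊆ S.sideRes φ :=
  (hθ.resolution _ (S.isWithResolution_sideRes φ)).exists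

theorem eq_on (hθ : S.IsProofNet θ) {φ : Occ ι → Bool} {l l' : Linking ι} (hl : l ∈ θ) (hl' : l' ∈ θ)
    (h : l.support ⊆ S.sideRes φ) (h' : l'.support ⊆ S.sideRes φ) : l = l' :=
  (hθ.resolution _ (S.isWithResolution_sideRes φ)).unique ⟨hl, h⟩ ⟨hl', h'⟩

theorem eq_of_support_eq (hθ : S.IsProofNet θ) {l l' : Linking ι} (hl : l ∈ θ) (hl' : l' ∈ θ)
    (h : l.support = l'.support) : l = l' := by
  classical
  have hR := hθ.isResolutionOf hl
  -- The side is read off the right premise; a `&`-vertex outside the resolution gets the harmless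
  -- default `false`.
  have : l.support ⊆ S.sideRes fun N => decide (N.child true ∈ S.res l) := by
    refine hR.support_subset_sideRes fun N b hN hb => ?_
    cases b
    · exact (decide_eq_false fun h => hR.1.pruning.not_both (.inl rfl) hN hb h).symm
    · exact (decide_eq_true hb).symm
  exact hθ.eq_on hl hl' this (h ▸ this)

/-- The linking of a proof-net on the `&`-resolution given by a choice of sides. -/
noncomputable def netAt (hθ : S.IsProofNet θ) (φ : Occ ι → Bool) : Linking ι := (hθ.exists_on φ).choose

theorem netAt_mem (hθ : S.IsProofNet θ) (φ : Occ ι → Bool) : hθ.netAt φ ∈ θ := (hθ.exists_on φ).choose_spec.1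

theorem netAt_support (hθ : S.IsProofNet θ) (φ : Occ ι → Bool) : (hθ.netAt φ).support ⊆ S.sideRes φ :=
  (hθ.exists_on φ).choose_spec.2

end IsProofNet

end CutSequent

end MALL

namespace MALL

variable {ι α : Type*}

namespace CutSequent

variable {S : CutSequent ι α}

/-! ### The cube spanned by two linkings -/

open Classical in
/-- The side of `N` chosen by `R`, or by `R'` if `R` does not choose one. -/
noncomputable def startSide (R R' : Set (Occ ι)) (N : Occ ι) : Bool :=
  -- Where `R` makes no choice that of `R'` is copied, with `false` if there is none either. So the
  -- two starting sides differ only where both resolutions choose.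
  if N.child true ∈ R then true else if N.child false ∈ R then false else decide (N.child true ∈ R')

open Classical in
/-- The sides chosen by `R'` at the vertices in `X`, and by `R` at the other ones. -/
noncomputable def cubeSide (R R' : Set (Occ ι)) (X : Finset (Occ ι)) (N : Occ ι) : Bool :=
  if N ∈ X then startSide R' R N else startSide R R' N

theorem startSide_eq {P : Conn → Prop} {R R' : Set (Occ ι)} (hR : S.IsPruning P R) (hP : P .amp)
    {N : Occ ι} {b : Bool} (hN : S.IsConn .amp N) (hb : N.child b ∈ R) : b = startSide R R' N := by
  unfold startSide
  cases b
  · have : N.child true ∉ R := fun h => hR.not_both hP hN hb h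
    rw [if_neg this, if_pos hb]
  · rw [if_pos hb]

theorem toggled_of_startSide_ne {R R' : Set (Occ ι)} {N : Occ ι}
    (h : startSide R R' N ≠ startSide R' R N) :
    ∃ b, N.child b ∈ R ∧ N.child (!b) ∈ R' := by
  unfold startSide at h
  by_cases h1 : N.child true ∈ R <;> by_cases h2 : N.child true ∈ R' <;>
    by_cases h3 : N.child false ∈ R <;> by_cases h4 : N.child false ∈ R' <;>
    simp [h1, h2, h3, h4] at h ⊢

/-- The `&`-vertices at which the choices of `R` and `R'` differ. -/
def toggledSet (S : CutSequent ι α) (R R' : Set (Occ ι)) : Set (Occ ι) :=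
  {N | S.IsConn .amp N ∧ startSide R R' N ≠ startSide R' R N}

theorem finite_toggledSet (R R' : Set (Occ ι)) : (S.toggledSet R R').Finite :=
  S.finite_vertices.subset fun _ ⟨⟨_, _, h⟩, _⟩ => ⟨_, h⟩

variable {θ : Set (Linking ι)}

/-- The linking at the corner `X` of the cube spanned by `R` and `R'`. -/
noncomputable def cubeNet (hθ : S.IsProofNet θ) (R R' : Set (Occ ι)) (X : Finset (Occ ι)) :
    Linking ι := hθ.netAt (cubeSide R R' X)

/-- The linkings at the corners of a face of the cube. -/
def faceNet (hθ : S.IsProofNet θ) (R R' : Set (Occ ι)) (U : Finset (Occ ι)) : Set (Linking ι) :=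
  {l | ∃ X ⊆ U, l = cubeNet hθ R R' X}

open Classical in
/-- Going from some corner of the face `U` to another one by changing the side of `W` changes
whether the link `c` is present. -/
def CubeDep (hθ : S.IsProofNet θ) (R R' : Set (Occ ι)) (U : Finset (Occ ι)) (c : Sym2 (Occ ι))
    (W : Occ ι) : Prop :=
  W ∈ U ∧ ∃ X ⊆ U, ¬ (c ∈ cubeNet hθ R R' X ↔ c ∈ cubeNet hθ R R' (insert W X))

section

variable (hθ : S.IsProofNet θ) {l l' : Linking ι} (R R' : Set (Occ ι))

theorem cubeNet_mem (X : Finset (Occ ι)) : cubeNet hθ R R' X ∈ θ := hθ.netAt_mem _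

theorem faceNet_subset (U : Finset (Occ ι)) : faceNet hθ R R' U ⊆ θ := by
  rintro _ ⟨X, -, rfl⟩
  exact cubeNet_mem hθ R R' X

variable {R R'}

theorem cubeNet_side {X : Finset (Occ ι)} {N : Occ ι} {b : Bool} (hN : S.IsConn .amp N)
    (hb : N.child b ∈ S.res (cubeNet hθ R R' X)) : b = cubeSide R R' X N :=
  (hθ.isResolutionOf (cubeNet_mem hθ R R' X)).side_eq (hθ.netAt_support _) hN hb

/-- The sides at the empty corner agree with every choice made by `R`, so uniqueness in (P1)
identifies the linking there. -/
theorem cubeNet_empty (hl : l ∈ θ) (hR : S.IsResolutionOf l R) : cubeNet hθ R R' ∅ = l := by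
  refine hθ.eq_on (cubeNet_mem hθ R R' ∅) hl (hθ.netAt_support _)
    (hR.support_subset_sideRes fun N b hN hb => ?_)
  rw [cubeSide, if_neg (Finset.notMem_empty _)]
  exact startSide_eq hR.1.pruning (.inl rfl) hN hb

theorem cubeNet_toggledSet (hl' : l' ∈ θ) (hR' : S.IsResolutionOf l' R') :
    cubeNet hθ R R' (S.finite_toggledSet R R').toFinset = l' := by
  refine hθ.eq_on (cubeNet_mem hθ R R' _) hl' (hθ.netAt_support _)
    (hR'.support_subset_sideRes fun N b hN hb => ?_)
  have := startSide_eq (R' := R) hR'.1.pruning (.inl rfl) hN hb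
  rw [cubeSide]
  split_ifs with h
  · exact this
  · rw [Set.Finite.mem_toFinset] at h
    by_contra hne
    exact h ⟨hN, fun h => hne (this.trans h.symm)⟩

/-- Linkings at two corners keep different premises of `W` only if the corners themselves differ at
`W`. -/
theorem exists_of_toggles {L : Set (Linking ι)} {I : Set (Finset (Occ ι))}
    (hL : L ⊆ cubeNet hθ R R' '' I) {W : Occ ι} (h : S.Toggles L W) :
    ∃ X ∈ I, ∃ Y ∈ I, W ∈ X ∧ W ∉ Y := by
  obtain ⟨hW, ⟨k, hk, h1⟩, ⟨k', hk', h2⟩⟩ := h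
  obtain ⟨X, hX, rfl⟩ := hL hk
  obtain ⟨Y, hY, rfl⟩ := hL hk'
  have h1 := cubeNet_side hθ hW h1
  have h2 := cubeNet_side hθ hW h2
  rw [cubeSide] at h1 h2
  by_cases hWX : W ∈ X <;> by_cases hWY : W ∈ Y <;> simp only [hWX, hWY, if_true, if_false] at h1 h2
  · exact absurd (h1.trans h2.symm) Bool.false_ne_true
  · exact ⟨X, hX, Y, hY, hWX, hWY⟩
  · exact ⟨Y, hY, X, hX, hWY, hWX⟩
  · exact absurd (h1.trans h2.symm) Bool.false_ne_true

theorem mem_of_toggles_faceNet {U : Finset (Occ ι)} {W : Occ ι}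
    (h : S.Toggles (faceNet hθ R R' U) W) : W ∈ U := by
  obtain ⟨X, hX, -, -, hWX, -⟩ := exists_of_toggles hθ (I := {X | X ⊆ U})
    (by rintro _ ⟨X, hX, rfl⟩; exact ⟨X, hX, rfl⟩) h
  exact hX hWX

-- The two corners differ only at `W`, so their linkings can toggle no other `&`-vertex. These
-- linkings being distinct, (P3) says that some vertex is toggled, and it must be `W`.
open Classical in
theorem CubeDep.jump {U : Finset (Occ ι)} {c : Sym2 (Occ ι)} {W x : Occ ι}
    (h : CubeDep hθ R R' U c W) (hx : x ∈ c) : S.Jump (faceNet hθ R R' U) x W := by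
  obtain ⟨hWU, X, hX, hc⟩ := h
  have hX' : insert W X ⊆ U := Finset.insert_subset hWU hX
  have huniq : ∀ W', S.Toggles {cubeNet hθ R R' X, cubeNet hθ R R' (insert W X)} W' → W' = W := by
    intro W' hW'
    obtain ⟨Y, hY, Z, hZ, h1, h2⟩ := exists_of_toggles hθ (I := {X, insert W X})
      (by rw [Set.image_pair]) hW'
    by_contra hne
    have key : ∀ Y ∈ ({X, insert W X} : Set (Finset (Occ ι))), (W' ∈ Y ↔ W' ∈ X) := by
      rintro Y (rfl | rfl)
      · rfl
      · simp [hne]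
    exact h2 ((key Z hZ).2 ((key Y hY).1 h1))
  have hne : cubeNet hθ R R' X ≠ cubeNet hθ R R' (insert W X) := fun h => hc (by rw [← h])
  obtain ⟨W', hW', -⟩ := hθ.toggling {cubeNet hθ R R' X, cubeNet hθ R R' (insert W X)}
    (by rintro _ (rfl | rfl) <;> exact cubeNet_mem hθ R R' _) ⟨_, .inl rfl, _, .inr rfl, hne⟩
  obtain rfl := huniq W' hW'
  have m1 : cubeNet hθ R R' X ∈ faceNet hθ R R' U := ⟨_, hX, rfl⟩
  have m2 : cubeNet hθ R R' (insert W' X) ∈ faceNet hθ R R' U := ⟨_, hX', rfl⟩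
  by_cases h : c ∈ cubeNet hθ R R' X
  · have h' : c ∉ cubeNet hθ R R' (insert W' X) := fun h' => hc ⟨fun _ => h', fun _ => h⟩
    exact ⟨_, m1, c, h, hx, _, m1, _, m2, h, h', hW', huniq⟩
  · have h' : c ∈ cubeNet hθ R R' (insert W' X) := by
      by_contra h'
      exact hc ⟨fun h'' => absurd h'' h, fun h'' => absurd h'' h'⟩
    refine ⟨_, m2, c, h', hx, _, m2, _, m1, h', h, ?_⟩
    rw [Set.pair_comm]
    exact ⟨hW', huniq⟩

end

/-! ### Moves along coherent and incoherent vertices -/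

section Moves

variable (S) (R R' : Set (Occ ι)) (s : Occ ι → SignType)

/-- `v` is a common vertex of `R` and `R'`, of coherence `ε`. -/
def HasSign (ε : SignType) (v : Occ ι) : Prop :=
  v ∈ R ∧ v ∈ R' ∧ ∃ F, S.At v F ∧ typ F (ptAt R F v) (ptAt R' F v) v s = ε

/-- The vertices that are traversed upwards: those of strict incoherence, and those of `R` that are
not in `R'`. -/
def Upward (v : Occ ι) : Prop := S.HasSign R R' s (-1) v ∨ (v ∈ R ∧ v ∉ R')

/-- The moves along the links of `l`, the edges of its resolution `R`, and the jumps given by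
`D`. -/
inductive Move (l : Linking ι) (D : Occ ι → Occ ι → Prop) : Occ ι → Occ ι → Prop
  | down (v : Occ ι) (b : Bool) : S.HasSign R R' s 1 (v.child b) → v ∈ R → v ∈ R' →
      Move l D (v.child b) v
  | up (v : Occ ι) (b : Bool) : S.Upward R R' s v → S.Upward R R' s (v.child b) →
      Move l D v (v.child b)
  | link (u v : Occ ι) : S.Upward R R' s u → S.HasSign R R' s 1 v → s(u, v) ∈ l → Move l D u v
  | jump (x W : Occ ι) : S.Upward R R' s x → S.IsLeaf x → S.HasSign R R' s 1 W →
      S.IsConn .amp W → D x W → Move l D x W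

variable {S R R' s}

theorem HasSign.typ_eq {ε : SignType} {v : Occ ι} (h : S.HasSign R R' s ε v) {F : Formula α}
    (hF : S.At v F) : typ F (ptAt R F v) (ptAt R' F v) v s = ε := by
  obtain ⟨-, -, F', hF', h⟩ := h
  rwa [hF.functional hF']

theorem HasSign.not_upward {v : Occ ι} (h : S.HasSign R R' s 1 v) (h' : S.Upward R R' s v) :
    False := by
  obtain ⟨h1, h2, F, hF, h3⟩ := h
  rcases h' with h' | h'
  · have := h'.typ_eq hF
    rw [h3] at this
    exact absurd this (by decide)
  · exact h'.2 h2

variable (hR : S.IsPruning Conn.IsAdditive R) (hR' : S.IsPruning Conn.IsAdditive R')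

theorem isAdditive_amp : Conn.IsAdditive .amp := .inl rfl

theorem isAdditive_plus : Conn.IsAdditive .plus := .inr rfl

theorem ptAt_child {R : Set (Occ ι)} (hR : S.IsPruning Conn.IsAdditive R) {c : Conn}
    (hc : c.IsAdditive) {A B : Formula α} {v : Occ ι} (hv : S.At v (.bin c A B)) {b : Bool} :
    v.child b ∈ R → (ptAt R (.bin .amp A B) v =
      (cond b (Sum.inr (ptAt R B (v.child true))) (Sum.inl (ptAt R A (v.child false))) :
        Pt A ⊕ Pt B)) ∧
      ptAt R (.bin .plus A B) v =
      (cond b (Sum.inr (ptAt R B (v.child true))) (Sum.inl (ptAt R A (v.child false))) :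
        Pt A ⊕ Pt B) := by
  intro h
  cases b
  · exact ptAt_additive_left h A B
  · exact ptAt_additive_right (fun h' => hR.not_both hc ⟨_, _, hv⟩ h' h) A B

include hR hR' in
theorem typ_same {c : Conn} (hc : c.IsAdditive) {A B : Formula α} {v : Occ ι}
    (hv : S.At v (.bin c A B)) {b : Bool} (h : v.child b ∈ R) (h' : v.child b ∈ R') :
    typ (.bin c A B) (ptAt R (.bin c A B) v) (ptAt R' (.bin c A B) v) v s =
      typ (cond b B A) (ptAt R (cond b B A) (v.child b)) (ptAt R' (cond b B A) (v.child b))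
        (v.child b) s := by
  have h1 := ptAt_child hR hc hv h
  have h2 := ptAt_child hR' hc hv h'
  rcases hc with rfl | rfl
  · rw [h1.1, h2.1]
    cases b <;> rfl
  · rw [h1.2, h2.2]
    cases b <;> rfl

include hR hR' in
theorem typ_toggled {c : Conn} (hc : c.IsAdditive) {A B : Formula α} {v : Occ ι}
    (hv : S.At v (.bin c A B)) {b : Bool} (h : v.child b ∈ R) (h' : v.child (!b) ∈ R') :
    (c = .amp → typ (.bin c A B) (ptAt R (.bin c A B) v) (ptAt R' (.bin c A B) v) v s = 1) ∧
    (c = .plus → typ (.bin c A B) (ptAt R (.bin c A B) v) (ptAt R' (.bin c A B) v) v s = -1) := by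
  have h1 := ptAt_child hR hc hv h
  have h2 := ptAt_child hR' hc hv h'
  constructor
  · rintro rfl
    rw [h1.1, h2.1]
    cases b <;> rfl
  · rintro rfl
    rw [h1.2, h2.2]
    cases b <;> rfl

theorem parrSign_one : ∀ a b : SignType, (a = 1 ∨ b = 1) → parrSign a b = 1 := by decide

theorem tensSign_one : ∀ a b : SignType, (a = 1 ∨ b = 1) →
    tensSign a b = 1 ∨ tensSign a b = -1 := by decide

theorem parrSign_neg_one : ∀ a b : SignType, parrSign a b = -1 → a = -1 ∨ b = -1 := by decide

theorem tensSign_neg_one : ∀ a b : SignType, tensSign a b = -1 → a = -1 ∨ b = -1 := by decide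

include hR hR' in
/-- The parent of a coherent vertex is coherent, or incoherent if it is a tensor. -/
theorem HasSign.parent {v : Occ ι} {b : Bool} {c : Conn} (hc : S.IsConn c v)
    (h : S.HasSign R R' s 1 (v.child b)) :
    S.HasSign R R' s 1 v ∨ (c = .tens ∧ S.HasSign R R' s (-1) v) := by
  have hv := hR.parent c v b hc h.1
  have hv' := hR'.parent c v b hc h.2.1
  obtain ⟨A, B, hF⟩ := hc
  have ht := h.typ_eq (hF.child b)
  cases c
  -- The only case where the parent may fail to be coherent: an incoherent other premise prevails,
  -- and the walk can then turn up into that premise.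
  case tens =>
    have : typ A (ptAt R A (v.child false)) (ptAt R' A (v.child false)) (v.child false) s = 1 ∨
        typ B (ptAt R B (v.child true)) (ptAt R' B (v.child true)) (v.child true) s = 1 := by
      cases b
      · exact .inl ht
      · exact .inr ht
    exact (tensSign_one _ _ this).imp (fun h => ⟨hv, hv', _, hF, h⟩)
      (fun h => ⟨rfl, hv, hv', _, hF, h⟩)
  case parr =>
    have : typ A (ptAt R A (v.child false)) (ptAt R' A (v.child false)) (v.child false) s = 1 ∨
        typ B (ptAt R B (v.child true)) (ptAt R' B (v.child true)) (v.child true) s = 1 := by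
      cases b
      · exact .inl ht
      · exact .inr ht
    exact .inl ⟨hv, hv', _, hF, parrSign_one _ _ this⟩
  case amp =>
    exact .inl ⟨hv, hv', _, hF, (typ_same hR hR' isAdditive_amp hF h.1 h.2.1).trans ht⟩
  case plus =>
    exact .inl ⟨hv, hv', _, hF, (typ_same hR hR' isAdditive_plus hF h.1 h.2.1).trans ht⟩

theorem exists_child_mem {R : Set (Occ ι)} (hR : S.IsPruning Conn.IsAdditive R) {c : Conn}
    {v : Occ ι} (hv : v ∈ R) (hc : S.IsConn c v) : ∃ b, v.child b ∈ R := by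
  by_cases h : c.IsAdditive
  · rcases hR.one c v h hc hv with h | h
    · exact ⟨_, h.1⟩
    · exact ⟨_, h.1⟩
  · exact ⟨_, (hR.both c v h hc hv).1⟩

include hR hR' in
/-- A vertex that is traversed upwards and is not a leaf has a premise that is, too. -/
theorem Upward.exists_child {v : Occ ι} {c : Conn} (hc : S.IsConn c v)
    (h : S.Upward R R' s v) : ∃ b, S.Upward R R' s (v.child b) := by
  rcases h with ⟨hv, hv', F, hF, ht⟩ | ⟨hv, hv'⟩
  · obtain ⟨A, B, hAB⟩ := id hc
    obtain rfl := hF.functional hAB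
    have pick : ∀ b, v.child b ∈ R → v.child b ∈ R' →
        typ (cond b B A) (ptAt R (cond b B A) (v.child b)) (ptAt R' (cond b B A) (v.child b))
          (v.child b) s = -1 → ∃ b, S.Upward R R' s (v.child b) :=
      fun b h h' ht => ⟨b, .inl ⟨h, h', _, hF.child b, ht⟩⟩
    have add : c.IsAdditive → ∃ b, S.Upward R R' s (v.child b) := by
      intro hadd
      obtain ⟨b, hb⟩ := exists_child_mem hR hv hc
      by_cases hb' : v.child b ∈ R'
      · exact pick b hb hb' ((typ_same hR hR' hadd hF hb hb').symm.trans ht)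
      · exact ⟨b, .inr ⟨hb, hb'⟩⟩
    cases c
    case tens =>
      have h1 := hR.both _ v (by simp [Conn.IsAdditive]) hc hv
      have h2 := hR'.both _ v (by simp [Conn.IsAdditive]) hc hv'
      rcases tensSign_neg_one _ _ ht with h | h
      · exact pick false h1.1 h2.1 h
      · exact pick true h1.2 h2.2 h
    case parr =>
      have h1 := hR.both _ v (by simp [Conn.IsAdditive]) hc hv
      have h2 := hR'.both _ v (by simp [Conn.IsAdditive]) hc hv'
      rcases parrSign_neg_one _ _ ht with h | h
      · exact pick false h1.1 h2.1 h
      · exact pick true h1.2 h2.2 h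
    case amp => exact add isAdditive_amp
    case plus => exact add isAdditive_plus
  · obtain ⟨b, hb⟩ := exists_child_mem hR hv hc
    exact ⟨b, .inr ⟨hb, fun h => hv' (hR'.parent c v b hc h)⟩⟩

theorem HasSign.upward {v : Occ ι} (h : S.HasSign R R' s (-1) v) : S.Upward R R' s v := .inl h

theorem Upward.mem {v : Occ ι} (h : S.Upward R R' s v) : v ∈ R := h.elim (fun h => h.1) (fun h => h.1)

theorem isConn_of_child {u v : Occ ι} {b : Bool} (hu : u = v.child b) (hu' : ∃ A, S.At u A)
    (hv : ∃ A, S.At v A) : ∃ c, S.IsConn c v := by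
  subst hu
  obtain ⟨A, hA⟩ := hu'
  obtain ⟨c, A₁, A₂, h⟩ := hA.parent hv (Occ.Below.refl _)
  exact ⟨c, A₁, A₂, h⟩

section

variable {l : Linking ι} {D : Occ ι → Occ ι → Prop} {x y : Occ ι}

/-- Links and jumps look alike here: both lead from an upward leaf to a coherent vertex. Asymmetry
and the analysis of switch edges need nothing more. -/
theorem Move.kinds (hl : ∀ v ∈ l.support, S.IsLeaf v) (h : S.Move R R' s l D x y) :
    (S.HasSign R R' s 1 x ∧ y ∈ R ∧ ∃ b, x = y.child b) ∨
    (S.Upward R R' s x ∧ S.Upward R R' s y ∧ ∃ b, y = x.child b) ∨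
    (S.Upward R R' s x ∧ S.HasSign R R' s 1 y ∧ S.IsLeaf x) := by
  cases h with
  | down v b h1 h2 h3 => exact .inl ⟨h1, h2, b, rfl⟩
  | up v b h1 h2 => exact .inr (.inl ⟨h1, h2, b, rfl⟩)
  | link u v h1 h2 h3 => exact .inr (.inr ⟨h1, h2, hl _ ⟨_, h3, Sym2.mem_mk_left _ _⟩⟩)
  | jump x W h1 h2 h3 => exact .inr (.inr ⟨h1, h3, h2⟩)

theorem ne_child_child {x y : Occ ι} {b d : Bool} (h : x = y.child b) (h' : y = x.child d) :
    False := by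
  have h1 := congrArg (fun v => v.2.length) h
  have h2 := congrArg (fun v => v.2.length) h'
  simp only [Occ.child, List.length_cons] at h1 h2
  omega

theorem Move.mem_left (h : S.Move R R' s l D x y) : x ∈ R := by
  cases h with
  | down v b h1 _ _ => exact h1.1
  | up v b h1 _ => exact h1.mem
  | link u v h1 _ _ => exact h1.mem
  | jump x W h1 _ _ => exact h1.mem

include hR

theorem leaf_child_absurd {u v : Occ ι} {b : Bool} (hv : S.IsLeaf v) (hu : u ∈ R)
    (h : u = v.child b) : False := by
  obtain ⟨X, x, hX⟩ := id hv
  obtain ⟨c, hc⟩ := isConn_of_child h (hR.vertex u hu) ⟨_, hX⟩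
  exact hv.not_conn hc

theorem Move.asymm (hl : ∀ v ∈ l.support, S.IsLeaf v) (h : S.Move R R' s l D x y)
    (h' : S.Move R R' s l D y x) : False := by
  rcases h.kinds hl with ⟨h1, h2, b, h3⟩ | ⟨h1, h2, b, h3⟩ | ⟨h1, h2, h3⟩ <;>
    rcases h'.kinds hl with ⟨k1, k2, d, k3⟩ | ⟨k1, k2, d, k3⟩ | ⟨k1, k2, k3⟩
  · exact ne_child_child h3 k3
  · exact h1.not_upward k2
  · exact leaf_child_absurd hR k3 h1.1 h3
  · exact k1.not_upward h2
  · exact ne_child_child h3 k3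
  · exact k2.not_upward h1
  · exact leaf_child_absurd hR h3 k1.1 k3
  · exact h2.not_upward k1
  · exact h2.not_upward k1

include hR'

theorem Move.active (h : S.Move R R' s l D x y) :
    S.HasSign R R' s 1 y ∨ S.Upward R R' s y := by
  cases h with
  | down v b h1 h2 h3 =>
    obtain ⟨c, hc⟩ := isConn_of_child rfl (hR.vertex _ h1.1) (hR.vertex _ h2)
    exact (HasSign.parent hR hR' hc h1).imp id fun h => h.2.upward
  | up v b h1 h2 => exact .inr h2
  | link u v h1 h2 h3 => exact .inl h2
  | jump x W h1 h2 h3 => exact .inl h3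

/-- A move along a switch edge of `N` enters `N` if `N` is coherent, and leaves it otherwise. -/
theorem Move.switch (hl : ∀ v ∈ l.support, S.IsLeaf v) (h : S.Move R R' s l D x y)
    {L : Set (Linking ι)} (hL : ∀ k ∈ L, ∀ v ∈ k.support, S.IsLeaf v) {c : Conn}
    (hc : c.IsNegative) {N : Occ ι} (hN : S.IsConn c N)
    (he : S.IsSwitchEdge L N s(.occ x, .occ y)) :
    (S.HasSign R R' s 1 N ∧ y = N) ∨ (¬ S.HasSign R R' s 1 N ∧ x = N) := by
  -- A negative vertex inherits coherence from its premises, the tensor being the only exception in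
  -- `HasSign.parent`.
  have coh : ∀ b, S.HasSign R R' s 1 (N.child b) → S.HasSign R R' s 1 N := by
    intro b hb
    rcases HasSign.parent hR hR' hN hb with h | ⟨rfl, -⟩
    · exact h
    · simp [Conn.IsNegative] at hc
  have hk := h.kinds hl
  rcases he with ⟨b, he⟩ | ⟨z, ⟨k, hkL, a, ha, hza, -⟩, he⟩
  · simp only [Sym2.eq_iff, Vertex.occ.injEq] at he
    rcases he with ⟨rfl, rfl⟩ | ⟨rfl, rfl⟩
    · rcases hk with ⟨-, -, d, h1⟩ | ⟨h1, -, -⟩ | ⟨h1, -, -⟩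
      · exact (ne_child_child h1 rfl).elim
      · exact .inr ⟨fun h => h.not_upward h1, rfl⟩
      · exact .inr ⟨fun h => h.not_upward h1, rfl⟩
    · rcases hk with ⟨h1, -, -⟩ | ⟨-, -, d, h1⟩ | ⟨-, h1, -⟩
      · exact .inl ⟨coh b h1, rfl⟩
      · exact (ne_child_child h1 rfl).elim
      · exact .inl ⟨h1, rfl⟩
  · have hz : S.IsLeaf z := hL k hkL z ⟨a, ha, hza⟩
    simp only [Sym2.eq_iff, Vertex.occ.injEq] at he
    rcases he with ⟨rfl, rfl⟩ | ⟨rfl, rfl⟩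
    · rcases hk with ⟨h1, -, d, rfl⟩ | ⟨-, h1, d, h2⟩ | ⟨-, h1, -⟩
      · exact .inl ⟨coh d h1, rfl⟩
      · exact (leaf_child_absurd hR hz h1.mem h2).elim
      · exact .inl ⟨h1, rfl⟩
    · rcases hk with ⟨h1, -, d, h2⟩ | ⟨h1, -, -⟩ | ⟨h1, -, -⟩
      · exact (leaf_child_absurd hR hz h1.1 h2).elim
      · exact .inr ⟨fun h => h.not_upward h1, rfl⟩
      · exact .inr ⟨fun h => h.not_upward h1, rfl⟩

end

end Moves

/-! ### The points of a proof-net are pairwise coherent -/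

/-- Some `⅋`-switching deletes no edge of the cycle, which then survives in a graph that is a tree
by (P2). -/
theorem IsProofNet.no_switching_cycle {θ : Set (Linking ι)} (hθ : S.IsProofNet θ) {l : Linking ι}
    (hl : l ∈ θ) {x : Vertex ι α} {p : (S.graph {l}).Walk x x} (hp : S.IsSwitchingCycle {l} p)
    (hs : ∀ z ∈ p.support, z ∈ S.verts {l}) : False := by
  classical
  obtain ⟨hc, hsw⟩ := hp
  -- `φ` names the premise to be cut off: the right one where the cycle uses the left one, otherwise
  -- the left one.
  let φ : Occ ι → Bool := fun N => decide (s(.occ N, .occ (N.child false)) ∈ p.edges)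
  have hdel : ∀ e ∈ p.edges, e ∈ ((S.graph {l}).deleteEdges
      {e | ∃ v, S.IsConn .parr v ∧ e = s(.occ v, .occ (v.child (φ v)))}).edgeSet := by
    intro e he
    rw [SimpleGraph.edgeSet_deleteEdges]
    refine ⟨p.edges_subset_edgeSet he, ?_⟩
    rintro ⟨v, hv, rfl⟩
    by_cases h : s(.occ v, .occ (v.child false)) ∈ p.edges
    · have hφ : φ v = true := decide_eq_true h
      rw [hφ] at he
      have := hsw .parr v (.inl rfl) hv _ h _ he (.inl ⟨_, rfl⟩) (.inl ⟨_, rfl⟩)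
      simp only [Sym2.eq_iff, Vertex.occ.injEq] at this
      rcases this with ⟨-, h⟩ | ⟨h, -⟩
      · exact Bool.false_ne_true (Occ.child_inj h).2
      · exact Occ.child_ne _ _ h.symm
    · have hφ : φ v = false := decide_eq_false h
      rw [hφ] at he
      exact h he
  have hq := hc.transfer hdel
  have hs' : ∀ z ∈ (p.transfer _ hdel).support, z ∈ S.verts {l} := by
    rwa [SimpleGraph.Walk.support_transfer]
  refine (hθ.mll l hl φ).isAcyclic ((p.transfer _ hdel).induce _ hs') ?_
  refine SimpleGraph.Walk.IsCycle.of_map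
    (f := (SimpleGraph.Embedding.induce (S.verts {l})).toHom) ?_
  rwa [SimpleGraph.Walk.map_induce]

end CutSequent

end MALL

/-! ### Incoherent pairs of linkings and switching cycles. -/

namespace MALL

variable {ι α : Type*}

namespace CutSequent

variable {S : CutSequent ι α}

section

variable {θ : Set (Linking ι)} (hθ : S.IsProofNet θ) {l l' : Linking ι} {R R' : Set (Occ ι)}
  {s : Occ ι → SignType}

/-- Some link at `x` depends on `W` in the face `U` of the cube spanned by `R` and `R'`. -/
def FaceJump (R R' : Set (Occ ι)) (U : Finset (Occ ι)) (x W : Occ ι) : Prop :=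
  ∃ c, x ∈ c ∧ CubeDep hθ R R' U c W

/-- Both resolutions choose at `W`, differently, and points in different arguments of a `&` are
strictly coherent. -/
theorem hasSign_of_mem_toggledSet (hR : S.IsPruning Conn.IsAdditive R)
    (hR' : S.IsPruning Conn.IsAdditive R') {W : Occ ι} (h : W ∈ S.toggledSet R R') :
    S.HasSign R R' s 1 W := by
  obtain ⟨hW, hne⟩ := h
  obtain ⟨b, hb, hb'⟩ := toggled_of_startSide_ne hne
  obtain ⟨A, B, hF⟩ := id hW
  exact ⟨hR.parent _ W b hW hb, hR'.parent _ W _ hW hb', _, hF,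
    (typ_toggled hR hR' isAdditive_amp hF hb hb').1 rfl⟩

/-- The walk never gets stuck. A coherent vertex is not a root, hence has a parent; an upward vertex
that is no leaf has an upward premise. An upward leaf either has a shared link, whose other end has
the opposite sign and is coherent, or a link that is lost between the corners `∅` and `T` of the
cube, hence depends on a toggled `&`-vertex. -/
theorem exists_move (hl : l ∈ θ) (hl' : l' ∈ θ) (hR : S.IsResolutionOf l R)
    (hR' : S.IsResolutionOf l' R') (hs : ∀ u v, s(u, v) ∈ l → s(u, v) ∈ l' → s v = -s u)
    (hroot : ∀ r ∈ S.roots, ¬ S.HasSign R R' s 1 r.1) {x : Occ ι}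
    (hx : S.HasSign R R' s 1 x ∨ S.Upward R R' s x) :
    ∃ y, S.Move R R' s l (FaceJump hθ R R' (S.finite_toggledSet R R').toFinset) x y := by
  classical
  have pR := hR.1.pruning
  have pR' := hR'.1.pruning
  rcases hx with hx | hx
  · obtain ⟨h1, h2, F, hF, -⟩ := id hx
    rcases hF.inv with h | ⟨u, b, c, A₁, A₂, rfl, hu, -⟩
    · exact absurd hx (hroot _ h)
    · exact ⟨u, .down u b hx (pR.parent c u b ⟨_, _, hu⟩ h1) (pR'.parent c u b ⟨_, _, hu⟩ h2)⟩
  · obtain ⟨F, hF⟩ := pR.vertex x hx.mem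
    cases F with
    | bin c A B =>
      obtain ⟨b, hb⟩ := Upward.exists_child pR pR' ⟨_, _, hF⟩ hx
      exact ⟨_, .up x b hx hb⟩
    | lit X b =>
      have hleaf : S.IsLeaf x := ⟨X, b, hF⟩
      have hsupp : x ∈ l.support := by
        rw [hR.2]
        exact ⟨hx.mem, hleaf⟩
      obtain ⟨c, hc, hxc⟩ := hsupp
      by_cases hc' : c ∈ l'
      · obtain ⟨y, rfl⟩ := hxc
        have hx' : x ∈ R' := hR'.mem_of_support ⟨_, hc', Sym2.mem_mk_left _ _⟩
        have hneg : s x = -1 := by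
          rcases hx with hx | hx
          · exact hx.typ_eq hF
          · exact absurd hx' hx.2
        have hy : y ∈ l.support := ⟨_, hc, Sym2.mem_mk_right _ _⟩
        obtain ⟨Y, d, hY⟩ := hR.isLeaf hy
        refine ⟨y, .link x y hx ⟨hR.mem_of_support hy,
          hR'.mem_of_support ⟨_, hc', Sym2.mem_mk_right _ _⟩, _, hY, ?_⟩ hc⟩
        change s y = 1
        rw [hs x y hc hc', hneg, neg_neg]
      · obtain ⟨W, hW, X, hX, hne⟩ := exists_flip (f := fun X => c ∈ cubeNet hθ R R' X)
          (T := (S.finite_toggledSet R R').toFinset) (by rwa [cubeNet_empty hθ hl hR])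
          (by rwa [cubeNet_toggledSet hθ hl' hR'])
        have hW' := (Set.Finite.mem_toFinset _).1 hW
        refine ⟨W, .jump x W hx hleaf (hasSign_of_mem_toggledSet pR pR' hW') hW'.1
          ⟨c, hxc, hW, X, hX, ?_⟩⟩
        convert hne

theorem Move.adj (hl : l ∈ θ) (hR : S.IsResolutionOf l R)
    (hdiag : ∀ u v, s(u, v) ∈ l → u ≠ v) {U : Finset (Occ ι)} {x y : Occ ι}
    (h : S.Move R R' s l (FaceJump hθ R R' U) x y) :
    (S.graph (faceNet hθ R R' U)).Adj (.occ x) (.occ y) := by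
  have hmem : l ∈ faceNet hθ R R' U := ⟨∅, Finset.empty_subset _, (cubeNet_empty hθ hl hR).symm⟩
  have hres : ∀ v ∈ R, v ∈ S.resSet (faceNet hθ R R' U) :=
    fun v hv => ⟨l, hmem, by rwa [hR.res_eq]⟩
  rw [graph, SimpleGraph.fromRel_adj]
  cases h with
  | down v b h1 h2 _ =>
    exact ⟨fun h => Occ.child_ne _ _ (Vertex.occ.inj h), .inr (.tree _ b (hres _ h2) (hres _ h1.1))⟩
  | up v b h1 h2 =>
    exact ⟨fun h => Occ.child_ne _ _ (Vertex.occ.inj h).symm,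
      .inl (.tree _ b (hres _ h1.mem) (hres _ h2.mem))⟩
  | link _ _ _ _ h =>
    exact ⟨fun h' => hdiag _ _ h (Vertex.occ.inj h'), .inl (.link l _ _ hmem h)⟩
  | jump _ _ _ h1 _ h2 h3 =>
    obtain ⟨c, hxc, hc⟩ := h3
    refine ⟨fun h' => ?_, .inl (.jump _ _ (hc.jump hθ hxc))⟩
    cases h'
    exact h1.not_conn h2

/-- By `Move.switch` the switch edges of a negative vertex on a directed cycle all enter it or all
leave it. A cycle through each vertex at most once therefore contains at most one of them. -/
theorem Move.exists_switching_cycle (hl : l ∈ θ) (hR : S.IsResolutionOf l R)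
    (hR' : S.IsPruning Conn.IsAdditive R') (hdiag : ∀ u v, s(u, v) ∈ l → u ≠ v)
    {U : Finset (Occ ι)} {r : Occ ι → Occ ι → Prop}
    (hr : ∀ x y, r x y → S.Move R R' s l (FaceJump hθ R R' U) x y) {x y : Occ ι} (h : r x y)
    (h' : Relation.ReflTransGen r y x) :
    ∃ p : (S.graph (faceNet hθ R R' U)).Walk (.occ x) (.occ x),
      S.IsSwitchingCycle _ p ∧ ∀ z ∈ p.support, ∃ v ∈ R, z = .occ v := by
  have hleaf : ∀ k ∈ θ, ∀ v ∈ Linking.support k, S.IsLeaf v :=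
    fun k hk v hv => (hθ.isResolutionOf hk).isLeaf hv
  obtain ⟨p, hc, hd, hfst, hsnd⟩ := exists_cycle_of_reflTransGen
    (G := S.graph (faceNet hθ R R' U))
    (r := fun a b => ∃ u v, r u v ∧ a = .occ u ∧ b = .occ v) (x := .occ x) (y := .occ y)
    (by
      rintro _ _ ⟨u, v, h, rfl, rfl⟩
      exact (hr u v h).adj hθ hl hR hdiag)
    (by
      rintro _ _ ⟨u, v, h, rfl, rfl⟩ ⟨u', v', h', h1, h2⟩
      cases h1
      cases h2
      exact (hr _ _ h).asymm hR.1.pruning (hleaf l hl) (hr _ _ h'))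
    ⟨x, y, h, rfl, rfl⟩ (h'.lift _ fun u v h => ⟨u, v, h, rfl, rfl⟩)
  refine ⟨p, ⟨hc, ?_⟩, ?_⟩
  · intro c N hcN hN e he f hf hse hsf
    have key : ∀ d ∈ p.darts, S.IsSwitchEdge (faceNet hθ R R' U) N d.edge →
        (S.HasSign R R' s 1 N ∧ d.snd = .occ N) ∨ (¬ S.HasSign R R' s 1 N ∧ d.fst = .occ N) := by
      intro d hdp hsw
      obtain ⟨u, v, huv, h1, h2⟩ := hd d hdp
      have : d.edge = s(.occ u, .occ v) := by
        rw [← h1, ← h2]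
        rfl
      rw [this] at hsw
      have := (hr u v huv).switch hR.1.pruning hR' (hleaf l hl)
        (fun k hk => hleaf k (faceNet_subset hθ R R' U hk)) hcN hN hsw
      rw [h1, h2]
      exact this.imp (fun h => ⟨h.1, congrArg _ h.2⟩) (fun h => ⟨h.1, congrArg _ h.2⟩)
    obtain ⟨d, hdp, rfl⟩ := List.mem_map.1 he
    obtain ⟨d', hdp', rfl⟩ := List.mem_map.1 hf
    rcases key d hdp hse with ⟨h1, h2⟩ | ⟨h1, h2⟩ <;>
      rcases key d' hdp' hsf with ⟨h3, h4⟩ | ⟨h3, h4⟩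
    · rw [hsnd d hdp d' hdp' (h2.trans h4.symm)]
    · exact absurd h1 h3
    · exact absurd h3 h1
    · rw [hfst d hdp d' hdp' (h2.trans h4.symm)]
  · intro z hz
    rw [← SimpleGraph.Walk.cons_tail_support, List.mem_cons] at hz
    rcases hz with rfl | hz
    · exact ⟨x, (hr _ _ h).mem_left, rfl⟩
    · rw [← SimpleGraph.Walk.map_snd_darts, List.mem_map] at hz
      obtain ⟨d, hdp, rfl⟩ := hz
      obtain ⟨u, v, huv, h1, h2⟩ := hd d hdp
      refine ⟨v, ?_, h2⟩
      exact ((hr _ _ huv).active hR.1.pruning hR').elim (fun h => h.1) (fun h => h.mem)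

theorem IsProofNet.link_ne (hθ : S.IsProofNet θ) (hl : l ∈ θ) {u v : Occ ι} (h : s(u, v) ∈ l) : u ≠ v := by
  rintro rfl
  obtain ⟨u', v', X, he, h1, h2⟩ := (hθ.linking l hl).link _ h
  rw [Sym2.eq_iff] at he
  rcases he with ⟨rfl, rfl⟩ | ⟨rfl, rfl⟩ <;>
  · have := h1.functional h2
    simp at this

/-- Two linkings of a cut-free proof-net are coherent: they cannot be incoherent in one conclusion
and incoherent or equal in the other ones. -/
theorem IsProofNet.coherent (hθ : S.IsProofNet θ) (hcut : S.cuts = []) (hl : l ∈ θ) (hl' : l' ∈ θ)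
    (hR : S.IsResolutionOf l R) (hR' : S.IsResolutionOf l' R')
    (hs : ∀ u v, s(u, v) ∈ l → s(u, v) ∈ l' → s v = -s u)
    (hle : ∀ r ∈ S.concl, typ r.2 (ptAt R r.2 r.1) (ptAt R' r.2 r.1) r.1 s ≠ 1)
    (hlt : ∃ r ∈ S.concl, typ r.2 (ptAt R r.2 r.1) (ptAt R' r.2 r.1) r.1 s = -1) : False := by
  classical
  have hroots : S.roots = S.concl := by simp [roots, hcut]
  set T := (S.finite_toggledSet R R').toFinset with hT
  have hroot : ∀ r ∈ S.roots, ¬ S.HasSign R R' s 1 r.1 := by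
    intro r hr h
    exact hle r (hroots ▸ hr) (h.typ_eq (.root hr))
  obtain ⟨r₀, hr₀, hlt⟩ := hlt
  have hstart : S.Upward R R' s r₀.1 :=
    .inl ⟨hR.1.concl _ hr₀, hR'.1.concl _ hr₀, _, .root (hroots ▸ hr₀), hlt⟩
  have pR := hR.1.pruning
  have pR' := hR'.1.pruning
  have hdiag : ∀ u v, s(u, v) ∈ l → u ≠ v := fun u v h => hθ.link_ne hl h
  -- Starting in a recurrent component, every vertex reached lies on a cycle of moves.
  obtain ⟨x₀, hx₀, hterm⟩ := exists_terminal
    (r := S.Move R R' s l (FaceJump hθ R R' T))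
    (s := {v | S.HasSign R R' s 1 v ∨ S.Upward R R' s v})
    (S.finite_vertices.subset fun v hv => pR.vertex v (hv.elim (fun h => h.1) (fun h => h.mem)))
    ⟨_, .inr hstart⟩ (fun x y h => h.active pR pR')
  set reach := Relation.ReflTransGen (S.Move R R' s l (FaceJump hθ R R' T)) x₀ with hreach
  have hact : ∀ y, reach y → S.HasSign R R' s 1 y ∨ S.Upward R R' s y := by
    intro y hy
    induction hy with
    | refl => exact hx₀
    | tail _ h _ => exact h.active pR pR'
  have hcycle : ∀ U, (∀ y z, reach y → S.Move R R' s l (FaceJump hθ R R' T) y z →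
      S.Move R R' s l (FaceJump hθ R R' U) y z) → ∀ y, reach y →
      ∃ p : (S.graph (faceNet hθ R R' U)).Walk (.occ y) (.occ y),
        S.IsSwitchingCycle _ p ∧ ∀ z ∈ p.support, ∃ v ∈ R, z = .occ v := by
    intro U hU y hy
    obtain ⟨z, hyz⟩ := exists_move hθ hl hl' hR hR' hs hroot (hact y hy)
    have hz : reach z := hy.tail hyz
    have back : ∀ w, Relation.ReflTransGen (S.Move R R' s l (FaceJump hθ R R' T)) z w →
        Relation.ReflTransGen
          (fun a b => reach a ∧ S.Move R R' s l (FaceJump hθ R R' T) a b) z w := by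
      intro w hw
      induction hw with
      | refl => exact .refl
      | tail h1 h2 ih => exact ih.tail ⟨hz.trans h1, h2⟩
    exact Move.exists_switching_cycle hθ hl hR pR' hdiag
      (r := fun a b => reach a ∧ S.Move R R' s l (FaceJump hθ R R' T) a b)
      (fun a b h => hU a b h.1 h.2) ⟨hy, hyz⟩ (back y ((hterm z hz).trans hy))
  -- The face shrinks from the whole cube while still supporting all recurrent jumps. It always
  -- contains the corner `∅`, hence `l`.
  suffices main : ∀ U : Finset (Occ ι), U ⊆ T →
      (∀ y z, reach y → S.Move R R' s l (FaceJump hθ R R' T) y z →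
        S.Move R R' s l (FaceJump hθ R R' U) y z) → False from
    main T subset_rfl fun _ _ _ h => h
  intro U
  induction U using Finset.strongInduction with
  | H U ih =>
    intro hUT hU
    have hlU : l ∈ faceNet hθ R R' U := ⟨∅, Finset.empty_subset _, (cubeNet_empty hθ hl hR).symm⟩
    by_cases hnt : (faceNet hθ R R' U).Nontrivial
    · obtain ⟨W, htog, hW⟩ := hθ.toggling _ (faceNet_subset hθ R R' U) hnt
      have hWU : W ∈ U := mem_of_toggles_faceNet hθ htog
      have hWT : W ∈ S.toggledSet R R' := (Set.Finite.mem_toFinset _).1 (hUT hWU)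
      -- A recurrent vertex is on a switching cycle of this face, which (P3) denies of `W`.
      have hWr : ¬ reach W := by
        intro h
        obtain ⟨p, hp, -⟩ := hcycle U hU W h
        exact hW _ p hp p.start_mem_support
      refine ih (U.erase W) (Finset.erase_ssubset hWU) ((Finset.erase_subset _ _).trans hUT) ?_
      intro y z hy hyz
      have hyz' := hU y z hy hyz
      cases hyz' with
      | down _ b h1 h2 h3 => exact .down _ b h1 h2 h3
      | up _ b h1 h2 => exact .up _ b h1 h2
      | link _ _ h1 h2 h3 => exact .link _ _ h1 h2 h3
      | jump _ _ h1 h2 h3 h4 h5 =>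
        obtain ⟨c, hyc, hzU, X, hX, hne⟩ := h5
        -- If the link depended on `W`, a jump would make `W` recurrent. So the presence of the link
        -- ignores the side of `W`, and its dependency on `z` is visible without `W`.
        have hflip : ∀ Y ⊆ U, (c ∈ cubeNet hθ R R' Y ↔ c ∈ cubeNet hθ R R' (insert W Y)) := by
          intro Y hY
          by_contra hc
          refine hWr (hy.tail (.jump y W h1 h2 (hasSign_of_mem_toggledSet pR pR' hWT) hWT.1
            ⟨c, hyc, hUT hWU, Y, hY.trans hUT, ?_⟩))
          convert hc
        obtain ⟨hzW, Y, hY, hne'⟩ := exists_flip_erase (f := fun X => c ∈ cubeNet hθ R R' X)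
          hX hzU (by convert hne) hflip
        refine .jump _ _ h1 h2 h3 h4 ⟨c, hyc, Finset.mem_erase.2 ⟨hzW, hzU⟩, Y, hY, ?_⟩
        convert hne'
    -- Only `l` is left, and the recurrent moves form a switching cycle in its own graph.
    · have hface : faceNet hθ R R' U = {l} :=
        (Set.not_nontrivial_iff.1 hnt).eq_singleton_of_mem hlU
      have hex := hcycle U hU x₀ .refl
      rw [hface] at hex
      obtain ⟨p, hp, hsupp⟩ := hex
      refine hθ.no_switching_cycle hl hp fun z hz => ?_
      obtain ⟨v, hv, rfl⟩ := hsupp z hz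
      exact .inl ⟨v, ⟨l, rfl, by rwa [hR.res_eq]⟩, rfl⟩

end

end CutSequent

end MALL

/-! ### One step of cut elimination, seen from a single linking. -/

namespace MALL

variable {ι α : Type*}

theorem Occ.Below.flip (ρ : ι → ι) {u v : Occ ι} (h : u.Below v) : (u.flip ρ).Below (v.flip ρ) :=
  ⟨congrArg ρ h.1, h.2.map not⟩

/-- No leaf of the cut pair is used in the linking. -/
def CutPair.Unused (c : CutPair ι α) (l : Linking ι) : Prop :=
  ∀ v ∈ l.support, ¬ c.left.Below v ∧ ¬ c.right.Below v

/-- Two vertices neither of which is above the other one. -/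
def Occ.Apart (u v : Occ ι) : Prop := ¬ u.Below v ∧ ¬ v.Below u

/-- All sides of two cut pairs are apart. -/
def CutPair.Apart (c d : CutPair ι α) : Prop :=
  c.left.Apart d.left ∧ c.left.Apart d.right ∧ c.right.Apart d.left ∧ c.right.Apart d.right

namespace CutSequent

/-- `S'` arises from `S` by replacing the cut pair `c` by the cut pairs on its arguments, cut pairs
unused in `l` being possibly deleted. -/
structure Reduct (S S' : CutSequent ι α) (c : CutPair ι α) (l : Linking ι) : Prop where
  concl : S'.concl = S.concl
  mem : c ∈ S.cuts
  apart : ∀ r ∈ S.concl, r.1.Apart c.left ∧ r.1.Apart c.right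
  sides : c.left.Apart c.right
  old : ∀ d ∈ S'.cuts, (d ∈ S.cuts ∧ d.Apart c) ∨
    ∃ k A₁ A₂, c.formula = .bin k A₁ A₂ ∧ (d = c.first A₁ ∨ d = c.second A₂)
  keep : ∀ d ∈ S.cuts, d = c ∨ d ∈ S'.cuts ∨ d.Unused l
  first : ∀ k A₁ A₂, c.formula = .bin k A₁ A₂ → c.first A₁ ∈ S'.cuts ∨ (c.first A₁).Unused l
  second : ∀ k A₁ A₂, c.formula = .bin k A₁ A₂ → c.second A₂ ∈ S'.cuts ∨ (c.second A₂).Unused l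

variable {S S' : CutSequent ι α} {c : CutPair ι α} {l : Linking ι} {R : Set (Occ ι)}

theorem at_left (h : c ∈ S.cuts) : S.At c.left c.formula :=
  .root (List.mem_append_right _ (List.mem_flatMap.2 ⟨c, h, by simp [CutPair.sides]⟩))

theorem at_right (h : c ∈ S.cuts) : S.At c.right c.formula.dual :=
  .root (List.mem_append_right _ (List.mem_flatMap.2 ⟨c, h, by simp [CutPair.sides]⟩))

theorem mem_roots {r : Occ ι × Formula α} : r ∈ S.roots ↔ r ∈ S.concl ∨
    ∃ d ∈ S.cuts, r = (d.left, d.formula) ∨ r = (d.right, d.formula.dual) := by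
  simp [roots, CutPair.sides]

theorem apart_of_cuts_eq {C D : List (CutPair ι α)} (h : S.cuts = C ++ c :: D) :
    (∀ r ∈ S.concl, r.1.Apart c.left ∧ r.1.Apart c.right) ∧ c.left.Apart c.right ∧
      ∀ d ∈ C ++ D, d.Apart c := by
  have hp := S.disjoint
  have swap : ∀ {u v : Occ ι}, ¬ u.Below v ∧ ¬ v.Below u → v.Apart u := fun h => ⟨h.2, h.1⟩
  rw [h] at hp
  simp only [List.flatMap_append, List.flatMap_cons, List.pairwise_append, List.mem_append,
    List.mem_flatMap, CutPair.sides, List.mem_cons, List.not_mem_nil, or_false,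
    List.pairwise_cons] at hp
  obtain ⟨-, ⟨-, ⟨⟨h1, -⟩, -, h3⟩, h4⟩, h5⟩ := hp
  refine ⟨fun r hr => ⟨?_, ?_⟩, ?_, ?_⟩
  · exact h5 r hr _ (.inr (.inl (.inl rfl)))
  · exact h5 r hr _ (.inr (.inl (.inr rfl)))
  · exact h1 _ rfl
  · intro d hd
    rcases List.mem_append.1 hd with hd | hd
    · exact ⟨h4 _ ⟨d, hd, .inl rfl⟩ _ (.inl (.inl rfl)), h4 _ ⟨d, hd, .inl rfl⟩ _ (.inl (.inr rfl)),
        h4 _ ⟨d, hd, .inr rfl⟩ _ (.inl (.inl rfl)), h4 _ ⟨d, hd, .inr rfl⟩ _ (.inl (.inr rfl))⟩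
    · exact ⟨swap (h3 _ (.inl rfl) _ ⟨d, hd, .inl rfl⟩), swap (h3 _ (.inr rfl) _ ⟨d, hd, .inl rfl⟩),
        swap (h3 _ (.inl rfl) _ ⟨d, hd, .inr rfl⟩), swap (h3 _ (.inr rfl) _ ⟨d, hd, .inr rfl⟩)⟩

/-- What a step of cut elimination does to the linkings. -/
theorem exists_reduct_of_step {Θ Θ' : Set (Linking ι)} (h : Step (S, Θ) (S', Θ')) :
    -- All cut pairs are unused in the empty linking, so this clause holds even if no linking
    -- survives; it gives what concerns the sequents alone.
    ∃ c : CutPair ι α, Reduct S S' c ∅ ∧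
      (((∃ X b, c.formula = .lit X b) ∧ Θ' = elimAtom c '' Θ ∧ ∀ l, Reduct S S' c l) ∨
      (∃ k A₁ A₂, c.formula = .bin k A₁ A₂ ∧ Θ' ⊆ Θ ∧ (∀ l ∈ Θ', Reduct S S' c l) ∧
        (∀ l ∈ Θ', k.IsAdditive → ¬ S.Inconsistent c l) ∧
        ∀ l ∈ Θ, (k.IsAdditive → ¬ S.Inconsistent c l) → l ∈ Θ')) := by
  classical
  cases h with
  | atom S S' θ C D c X b hf hS hS' hc =>
    obtain ⟨h1, h2, h3⟩ := apart_of_cuts_eq hS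
    suffices red : ∀ l, Reduct S S' c l from ⟨c, red _, .inl ⟨⟨X, b, hf⟩, rfl, red⟩⟩
    refine fun l => ⟨hc, by simp [hS], h1, h2, ?_, ?_, ?_, ?_⟩
    · intro d hd
      rw [hS'] at hd
      refine .inl ⟨?_, h3 d hd⟩
      rw [hS]
      simp only [List.mem_append, List.mem_cons] at hd ⊢
      tauto
    · intro d hd
      rw [hS] at hd
      rw [hS']
      simp only [List.mem_append, List.mem_cons] at hd ⊢
      tauto
    · intro k A₁ A₂ h
      cases hf.symm.trans h
    · intro k A₁ A₂ h
      cases hf.symm.trans h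
  | mult S S' θ C D c k A₁ A₂ hk hf hS hS' hc =>
    obtain ⟨h1, h2, h3⟩ := apart_of_cuts_eq hS
    suffices red : ∀ l, Reduct S S' c l from ⟨c, red _, .inr ⟨k, A₁, A₂, hf, subset_rfl,
      fun l _ => red l, fun _ _ h => absurd h hk, fun l hl _ => hl⟩⟩
    refine fun l => ⟨hc, by simp [hS], h1, h2, ?_, ?_, ?_, ?_⟩
    · intro d hd
      rw [hS'] at hd
      simp only [List.mem_append, List.mem_cons] at hd
      have hd' : d ∈ C ++ D ∨ d = c.first A₁ ∨ d = c.second A₂ := by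
        simp only [List.mem_append]
        tauto
      rcases hd' with hd | hd
      · refine .inl ⟨?_, h3 d hd⟩
        rw [hS]
        simp only [List.mem_append, List.mem_cons] at hd ⊢
        tauto
      · exact .inr ⟨k, A₁, A₂, hf, hd⟩
    · intro d hd
      rw [hS] at hd
      rw [hS']
      simp only [List.mem_append, List.mem_cons] at hd ⊢
      tauto
    · intro k A₁ A₂ h
      cases hf.symm.trans h
      rw [hS']
      simp
    · intro k A₁ A₂ h
      cases hf.symm.trans h
      rw [hS']
      simp
  | add S S' θ θ' C D c k A₁ A₂ hk hf hS hθ' hS' hc =>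
    obtain ⟨h1, h2, h3⟩ := apart_of_cuts_eq hS
    subst hθ'
    have unused : ∀ l, (l ∈ Θ ∧ ¬ S.Inconsistent c l) → ∀ d : CutPair ι α,
        ¬ d.Used {l | l ∈ Θ ∧ ¬ S.Inconsistent c l} → d.Unused l := by
      intro l hl d hd v hv
      exact ⟨fun h => hd ⟨l, hl, v, hv, .inl h⟩, fun h => hd ⟨l, hl, v, hv, .inr h⟩⟩
    suffices red : ∀ l, (∀ d : CutPair ι α, ¬ d.Used {l | l ∈ Θ ∧ ¬ S.Inconsistent c l} →
        d.Unused l) → Reduct S S' c l from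
      ⟨c, red _ fun d _ v ⟨_, h, _⟩ => h.elim, .inr ⟨k, A₁, A₂, hf, fun l hl => hl.1,
        fun l hl => red l (unused l hl), fun l hl _ => hl.2, fun l hl h => ⟨hl, h hk⟩⟩⟩
    refine fun l hun => ⟨hc, by simp [hS], h1, h2, ?_, ?_, ?_, ?_⟩
    · intro d hd
      rw [hS', List.mem_filter] at hd
      replace hd := hd.1
      simp only [List.mem_append, List.mem_cons] at hd
      have hd' : d ∈ C ++ D ∨ d = c.first A₁ ∨ d = c.second A₂ := by
        simp only [List.mem_append]
        tauto
      rcases hd' with hd | hd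
      · refine .inl ⟨?_, h3 d hd⟩
        rw [hS]
        simp only [List.mem_append, List.mem_cons] at hd ⊢
        tauto
      · exact .inr ⟨k, A₁, A₂, hf, hd⟩
    · intro d hd
      rw [hS] at hd
      rw [hS', List.mem_filter, decide_eq_true_iff]
      have := hun d
      simp only [List.mem_append, List.mem_cons] at hd ⊢
      tauto
    · intro k A₁ A₂ h
      cases hf.symm.trans h
      rw [hS', List.mem_filter, decide_eq_true_iff]
      have := hun (c.first A₁)
      simp only [List.mem_append, List.mem_cons]
      tauto
    · intro k A₁ A₂ h
      cases hf.symm.trans h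
      rw [hS', List.mem_filter, decide_eq_true_iff]
      have := hun (c.second A₂)
      simp only [List.mem_append, List.mem_cons]
      tauto

namespace Reduct

variable (h : S.Reduct S' c l)

include h

/-- The sides of the new cut pairs are premises of the sides of `c`, so a step creates no vertex. -/
theorem at_mono {v : Occ ι} {A : Formula α} (hv : S'.At v A) : S.At v A := by
  induction hv with
  | root hr =>
    rcases mem_roots.1 hr with hr | ⟨d, hd, hr⟩
    · exact .root (mem_roots.2 (.inl (h.concl ▸ hr)))
    · rcases h.old d hd with ⟨hd, -⟩ | ⟨k, A₁, A₂, hf, rfl | rfl⟩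
      · exact .root (mem_roots.2 (.inr ⟨d, hd, hr⟩))
      · have hl := at_left h.mem
        have hr' := at_right h.mem
        rw [hf] at hl hr'
        rcases hr with hr | hr <;> cases hr
        · exact hl.left
        · exact hr'.right
      · have hl := at_left h.mem
        have hr' := at_right h.mem
        rw [hf] at hl hr'
        rcases hr with hr | hr <;> cases hr
        · exact hl.right
        · exact hr'.left
  | left _ ih => exact ih.left
  | right _ ih => exact ih.right

theorem not_below {v : Occ ι} {A : Formula α} (hv : S'.At v A) :
    ¬ v.Below c.left ∧ ¬ v.Below c.right := by
  obtain ⟨r, hr, hrv⟩ := hv.exists_root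
  suffices H : ¬ r.1.Below c.left ∧ ¬ r.1.Below c.right from
    ⟨fun h => H.1 (hrv.trans h), fun h => H.2 (hrv.trans h)⟩
  have hs := h.sides
  rcases mem_roots.1 hr with hr | ⟨d, hd, hr⟩
  · have := h.apart r (h.concl ▸ hr)
    exact ⟨this.1.1, this.2.1⟩
  · rcases h.old d hd with ⟨-, h1, h2, h3, h4⟩ | ⟨k, A₁, A₂, hf, rfl | rfl⟩
    · rcases hr with rfl | rfl
      · exact ⟨h1.1, h2.1⟩
      · exact ⟨h3.1, h4.1⟩
    all_goals
      rcases hr with rfl | rfl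
      · exact ⟨Occ.not_child_below _ _, fun h => hs.1 ((Occ.below_child _ _).trans h)⟩
      · exact ⟨fun h => hs.2 ((Occ.below_child _ _).trans h), Occ.not_child_below _ _⟩

theorem ne_of_at {v : Occ ι} {A : Formula α} (hv : S'.At v A) : v ≠ c.left ∧ v ≠ c.right := by
  have := h.not_below hv
  exact ⟨fun he => this.1 (he ▸ Occ.Below.refl _), fun he => this.2 (he ▸ Occ.Below.refl _)⟩

/-- Apart from the two sides of `c`, only cut pairs unused in `l` are lost, and the resolution of
`l` does not meet them. -/
theorem at_lift (hR : S.IsResolutionOf l R) {v : Occ ι} {A : Formula α} (hv : S.At v A)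
    (hvR : v ∈ R) (h1 : v ≠ c.left) (h2 : v ≠ c.right) : S'.At v A := by
  have hused : ∀ {d : CutPair ι α}, d.Unused l → d.left ∉ R ∧ d.right ∉ R := by
    intro d hd
    constructor <;>
    · intro hm
      obtain ⟨-, w, hw, hb⟩ := hR.mem_iff.1 hm
      first | exact (hd w hw).1 hb | exact (hd w hw).2 hb
  have root' : ∀ {d : CutPair ι α}, d ∈ S'.cuts → S'.At d.left d.formula ∧
      S'.At d.right d.formula.dual := fun hd => ⟨at_left hd, at_right hd⟩
  suffices H : ∃ B, S'.At v B by
    obtain ⟨B, hB⟩ := H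
    rwa [hv.functional (h.at_mono hB)]
  have child : ∀ (u : Occ ι) (b : Bool) (k : Conn) (A B : Formula α), S.At u (.bin k A B) →
      (u ∈ R → u ≠ c.left → u ≠ c.right → ∃ B, S'.At u B) → u.child b ∈ R →
      ∃ B, S'.At (u.child b) B := by
    intro u b k A B hu ih hb
    by_cases h3 : u = c.left
    · subst h3
      have hf := (at_left h.mem).functional hu
      cases b
      · rcases h.first _ _ _ hf with h' | h'
        · exact ⟨_, (root' h').1⟩
        · exact absurd hb (hused h').1
      · rcases h.second _ _ _ hf with h' | h'
        · exact ⟨_, (root' h').1⟩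
        · exact absurd hb (hused h').1
    by_cases h4 : u = c.right
    · subst h4
      -- The right side carries the dual formula with its arguments swapped, so its left premise
      -- belongs to the second new pair and its right premise to the first.
      have hf : c.formula = .bin k.dual B.dual A.dual := by
        rw [← Formula.dual_dual c.formula, (at_right h.mem).functional hu]
        rfl
      cases b
      · rcases h.second _ _ _ hf with h' | h'
        · exact ⟨_, (root' h').2⟩
        · exact absurd hb (hused h').2
      · rcases h.first _ _ _ hf with h' | h'
        · exact ⟨_, (root' h').2⟩
        · exact absurd hb (hused h').2
    obtain ⟨B', hB'⟩ := ih (hR.1.pruning.parent k u b ⟨_, _, hu⟩ hb) h3 h4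
    rw [(h.at_mono hB').functional hu] at hB'
    exact ⟨_, hB'.child b⟩
  induction hv with
  | root hr =>
    rcases mem_roots.1 hr with hr | ⟨d, hd, hr⟩
    · exact ⟨_, .root (mem_roots.2 (.inl (h.concl ▸ hr)))⟩
    · rcases h.keep d hd with rfl | hd' | hd'
      · rcases hr with hr | hr <;> cases hr
        · exact absurd rfl h1
        · exact absurd rfl h2
      · exact ⟨_, .root (mem_roots.2 (.inr ⟨d, hd', hr⟩))⟩
      · rcases hr with hr | hr <;> cases hr
        · exact absurd hvR (hused hd').1
        · exact absurd hvR (hused hd').2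
  | left hu ih => exact child _ _ _ _ _ hu (fun a b d => ih a b d) hvR
  | right hu ih => exact child _ _ _ _ _ hu (fun a b d => ih a b d) hvR

theorem isLeaf_iff (hR : S.IsResolutionOf l R) {v : Occ ι} :
    (v ∈ R ∧ v ≠ c.left ∧ v ≠ c.right) ∧ S'.IsLeaf v ↔
      (v ∈ R ∧ S.IsLeaf v) ∧ v ≠ c.left ∧ v ≠ c.right := by
  constructor
  · rintro ⟨⟨h1, h2⟩, X, b, hX⟩
    exact ⟨⟨h1, X, b, h.at_mono hX⟩, h2⟩
  · rintro ⟨⟨h1, X, b, hX⟩, h2⟩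
    exact ⟨⟨h1, h2⟩, X, b, h.at_lift hR hX h1 h2.1 h2.2⟩

/-- The additive resolution after a step of cut elimination. -/
theorem isAdditiveResolution (hR : S.IsResolutionOf l R)
    (hnew : ∀ k A₁ A₂, c.formula = .bin k A₁ A₂ →
      (c.left.child false ∈ R ↔ c.right.child true ∈ R) ∧
      (c.left.child true ∈ R ↔ c.right.child false ∈ R)) :
    S'.IsAdditiveResolution {v | v ∈ R ∧ v ≠ c.left ∧ v ≠ c.right} := by
  have pR := hR.1.pruning
  have conn : ∀ {k v}, S'.IsConn k v → S.IsConn k v := fun ⟨A, B, hv⟩ => ⟨A, B, h.at_mono hv⟩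
  have hne : ∀ {k v}, S'.IsConn k v → v ≠ c.left ∧ v ≠ c.right := fun ⟨A, B, hv⟩ => h.ne_of_at hv
  have hne' : ∀ {k v} b, S'.IsConn k v → v.child b ≠ c.left ∧ v.child b ≠ c.right :=
    fun b ⟨A, B, hv⟩ => h.ne_of_at (hv.child b)
  refine ⟨⟨?_, ?_, ?_, ?_⟩, ?_, ?_⟩
  · rintro v ⟨h1, h2, h3⟩
    obtain ⟨A, hA⟩ := pR.vertex v h1
    exact ⟨A, h.at_lift hR hA h1 h2 h3⟩
  · rintro k v b hv ⟨h1, -⟩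
    exact ⟨pR.parent k v b (conn hv) h1, hne hv⟩
  · rintro k v hk hv ⟨h1, -⟩
    have := pR.both k v hk (conn hv) h1
    exact ⟨⟨this.1, hne' _ hv⟩, this.2, hne' _ hv⟩
  · rintro k v hk hv ⟨h1, -⟩
    have := pR.one k v hk (conn hv) h1
    have e : ∀ b, v.child b ∈ {v | v ∈ R ∧ v ≠ c.left ∧ v ≠ c.right} ↔ v.child b ∈ R :=
      fun b => ⟨fun h => h.1, fun h => ⟨h, hne' _ hv⟩⟩
    rwa [e, e]
  · intro r hr
    rw [h.concl] at hr
    refine ⟨hR.1.concl r hr, fun he => ?_, fun he => ?_⟩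
    · exact (h.apart r hr).1.1 (he ▸ Occ.Below.refl _)
    · exact (h.apart r hr).2.1 (he ▸ Occ.Below.refl _)
  · intro d hd
    have e1 : d.left ∈ {v | v ∈ R ∧ v ≠ c.left ∧ v ≠ c.right} ↔ d.left ∈ R :=
      ⟨fun h => h.1, fun h' => ⟨h', h.ne_of_at (at_left hd)⟩⟩
    have e2 : d.right ∈ {v | v ∈ R ∧ v ≠ c.left ∧ v ≠ c.right} ↔ d.right ∈ R :=
      ⟨fun h => h.1, fun h' => ⟨h', h.ne_of_at (at_right hd)⟩⟩
    rw [e1, e2]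
    rcases h.old d hd with ⟨hd, -⟩ | ⟨k, A₁, A₂, hf, rfl | rfl⟩
    · exact hR.1.cuts d hd
    · exact (hnew _ _ _ hf).1
    · exact (hnew _ _ _ hf).2

end Reduct

end CutSequent

end MALL

namespace MALL

variable {ι α : Type*}

/-! ### Cut elimination on single linkings -/

namespace CutSequent

variable {S S' : CutSequent ι α} {c : CutPair ι α} {l l' : Linking ι}

/-- A linking with an additive resolution whose links are disjoint and not loops. -/
structure IsPreLinking (S : CutSequent ι α) (l : Linking ι) : Prop where
  resolution : ∃ R, S.IsResolutionOf l R
  disjoint : ∀ e ∈ l, ∀ f ∈ l, ∀ v, v ∈ e → v ∈ f → e = f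
  ne : ∀ u v, s(u, v) ∈ l → u ≠ v

theorem mem_elimAtom_iff {c : CutPair ι α} {l : Linking ι} {e : Sym2 (Occ ι)} :
    e ∈ elimAtom c l ↔ (e ∈ l ∧ c.left ∉ e ∧ c.right ∉ e) ∨
      ∃ u v, u ≠ c.right ∧ v ≠ c.left ∧ s(u, c.left) ∈ l ∧ s(c.right, v) ∈ l ∧ e = s(u, v) :=
  Iff.rfl

/-- A link between the two sides of the cut just disappears: the inequalities in `elimAtom` exclude
it, and by disjointness no other link is at these leaves. Otherwise the two links there are joined
and keep their outer ends. -/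
theorem IsPreLinking.support_elimAtom (h : S.IsPreLinking l)
    (hc : c.left ∈ l.support ↔ c.right ∈ l.support) :
    (elimAtom c l).support = {v | v ∈ l.support ∧ v ≠ c.left ∧ v ≠ c.right} := by
  ext v
  constructor
  · rintro ⟨e, he, hv⟩
    rcases mem_elimAtom_iff.1 he with ⟨he, h1, h2⟩ | ⟨u, w, h1, h2, h3, h4, rfl⟩
    · exact ⟨⟨e, he, hv⟩, fun h => h1 (h ▸ hv), fun h => h2 (h ▸ hv)⟩
    · rcases Sym2.mem_iff.1 hv with rfl | rfl
      · exact ⟨⟨_, h3, Sym2.mem_mk_left _ _⟩, h.ne _ _ h3, h1⟩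
      · exact ⟨⟨_, h4, Sym2.mem_mk_right _ _⟩, h2, (h.ne _ _ h4).symm⟩
  · rintro ⟨⟨e, he, hv⟩, h1, h2⟩
    by_cases h3 : c.left ∈ e
    · obtain rfl : e = s(v, c.left) := ((Sym2.mem_and_mem_iff h1).1 ⟨hv, h3⟩)
      obtain ⟨f, hf, w, rfl⟩ := hc.1 ⟨_, he, h3⟩
      refine ⟨s(v, w), .inr ⟨v, w, h2, ?_, he, hf, rfl⟩, Sym2.mem_mk_left _ _⟩
      rintro rfl
      have := h.disjoint _ he _ hf c.left (Sym2.mem_mk_right _ _) (Sym2.mem_mk_right _ _)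
      have hv : v ∈ s(c.right, c.left) := this ▸ Sym2.mem_mk_left _ _
      rcases Sym2.mem_iff.1 hv with h | h
      · exact h2 h
      · exact h1 h
    by_cases h4 : c.right ∈ e
    · obtain rfl : e = s(c.right, v) :=
        ((Sym2.mem_and_mem_iff (Ne.symm h2)).1 ⟨h4, hv⟩)
      obtain ⟨f, hf, w, rfl⟩ := hc.2 ⟨_, he, h4⟩
      rw [Sym2.eq_swap] at hf
      refine ⟨s(w, v), .inr ⟨w, v, ?_, h1, hf, he, rfl⟩, Sym2.mem_mk_right _ _⟩
      rintro rfl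
      have := h.disjoint _ hf _ he c.right (Sym2.mem_mk_left _ _) (Sym2.mem_mk_left _ _)
      have hv : v ∈ s(c.right, c.left) := this ▸ Sym2.mem_mk_right _ _
      rcases Sym2.mem_iff.1 hv with h | h
      · exact h2 h
      · exact h1 h
    · exact ⟨e, .inl ⟨he, h3, h4⟩, hv⟩

/-- A new loop would come from one leaf linked to both sides of the cut, against disjointness. -/
theorem IsPreLinking.ne_elimAtom (h : S.IsPreLinking l) (hc : c.left ≠ c.right) (u v : Occ ι)
    (hl : s(u, v) ∈ elimAtom c l) : u ≠ v := by
  rcases mem_elimAtom_iff.1 hl with ⟨he, -⟩ | ⟨u', w, h1, h2, h3, h4, he⟩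
  · exact h.ne _ _ he
  · rintro rfl
    obtain ⟨rfl, rfl⟩ : u = u' ∧ u = w := by
      rw [Sym2.eq_iff] at he
      tauto
    have := h.disjoint _ h3 _ h4 u (Sym2.mem_mk_left _ _) (Sym2.mem_mk_right _ _)
    have hm : c.left ∈ s(c.right, u) := this ▸ Sym2.mem_mk_right _ _
    rcases Sym2.mem_iff.1 hm with h | h
    · exact hc h
    · exact h2 h.symm

theorem IsPreLinking.disjoint_elimAtom (h : S.IsPreLinking l) :
    ∀ e ∈ elimAtom c l, ∀ f ∈ elimAtom c l, ∀ v, v ∈ e → v ∈ f → e = f := by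
  have key : ∀ e ∈ l, c.left ∉ e → c.right ∉ e → ∀ u w, s(u, c.left) ∈ l → s(c.right, w) ∈ l →
      ∀ v, v ∈ e → v ∈ s(u, w) → False := by
    intro e he h1 h2 u w h3 h4 v hv hv'
    rcases Sym2.mem_iff.1 hv' with rfl | rfl
    · exact h1 (h.disjoint _ he _ h3 v hv (Sym2.mem_mk_left _ _) ▸ Sym2.mem_mk_right _ _)
    · exact h2 (h.disjoint _ he _ h4 v hv (Sym2.mem_mk_right _ _) ▸ Sym2.mem_mk_left _ _)
  intro e he f hf v hve hvf
  rcases mem_elimAtom_iff.1 he with ⟨he, h1, h2⟩ | ⟨u, w, -, -, h3, h4, rfl⟩ <;>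
    rcases mem_elimAtom_iff.1 hf with ⟨hf, k1, k2⟩ | ⟨u', w', -, -, k3, k4, rfl⟩
  · exact h.disjoint _ he _ hf v hve hvf
  · exact (key e he h1 h2 u' w' k3 k4 v hve hvf).elim
  · exact (key f hf k1 k2 u w h3 h4 v hvf hve).elim
  · have e1 := h.disjoint _ h3 _ k3 c.left (Sym2.mem_mk_right _ _) (Sym2.mem_mk_right _ _)
    have e2 := h.disjoint _ h4 _ k4 c.right (Sym2.mem_mk_left _ _) (Sym2.mem_mk_left _ _)
    rw [Sym2.congr_left.1 e1, Sym2.congr_right.1 e2]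

theorem lit_left_right {X : α} {b : Bool} (hc : c ∈ S.cuts) (hf : c.formula = .lit X b) :
    S.At c.left (.lit X b) ∧ S.At c.right (.lit X (!b)) := by
  have h1 := at_left hc
  have h2 := at_right hc
  rw [hf] at h1 h2
  exact ⟨h1, h2⟩

theorem Reduct.isPreLinking_elimAtom (h : S.Reduct S' c l) (hl : S.IsPreLinking l) {X : α} {b : Bool}
    (hf : c.formula = .lit X b) :
    (c.left ∈ l.support ↔ c.right ∈ l.support) ∧ S'.IsPreLinking (elimAtom c l) := by
  obtain ⟨R, hR⟩ := hl.resolution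
  obtain ⟨h1, h2⟩ := lit_left_right h.mem hf
  have hc : c.left ∈ l.support ↔ c.right ∈ l.support := by
    rw [hR.2]
    exact ⟨fun h' => ⟨(hR.1.cuts c h.mem).1 h'.1, _, _, h2⟩,
      fun h' => ⟨(hR.1.cuts c h.mem).2 h'.1, _, _, h1⟩⟩
  have hne : c.left ≠ c.right := fun he => h.sides.1 (he ▸ Occ.Below.refl _)
  refine ⟨hc, ⟨_, h.isAdditiveResolution hR ?_, ?_⟩, hl.disjoint_elimAtom, hl.ne_elimAtom hne⟩
  · intro k A₁ A₂ h'
    cases hf.symm.trans h'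
  · rw [hl.support_elimAtom hc, hR.2]
    ext v
    exact (h.isLeaf_iff hR).symm

theorem conn_left_right {k : Conn} {A₁ A₂ : Formula α} (hc : c ∈ S.cuts)
    (hf : c.formula = .bin k A₁ A₂) :
    S.At c.left (.bin k A₁ A₂) ∧ S.At c.right (.bin k.dual A₂.dual A₁.dual) := by
  have h1 := at_left hc
  have h2 := at_right hc
  rw [hf] at h1 h2
  exact ⟨h1, h2⟩

theorem isAdditive_dual {k : Conn} : k.dual.IsAdditive ↔ k.IsAdditive := by
  cases k <;> simp [Conn.IsAdditive, Conn.dual]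

/-- The new cut pairs must each be kept or deleted as a whole. A multiplicative vertex keeps both
premises; for additives, consistency says that the two sides keep dual ones. -/
theorem Reduct.isPreLinking (h : S.Reduct S' c l) (hl : S.IsPreLinking l) {k : Conn}
    {A₁ A₂ : Formula α} (hf : c.formula = .bin k A₁ A₂)
    (hcons : k.IsAdditive → ¬ S.Inconsistent c l) : S'.IsPreLinking l := by
  obtain ⟨R, hR⟩ := hl.resolution
  obtain ⟨h1, h2⟩ := conn_left_right h.mem hf
  have c1 : S.IsConn k c.left := ⟨_, _, h1⟩
  have c2 : S.IsConn k.dual c.right := ⟨_, _, h2⟩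
  have pR := hR.1.pruning
  have hcut := hR.1.cuts c h.mem
  have key : ∀ b, c.left.child b ∈ R ↔ c.right.child (!b) ∈ R := by
    intro b
    by_cases hk : k.IsAdditive
    · have hcons := hcons hk
      simp only [Inconsistent, hR.res_eq, not_exists, not_and] at hcons
      constructor
      · intro hb
        have h3 := pR.one _ _ (isAdditive_dual.2 hk) c2 (hcut.1 (pR.parent _ _ _ c1 hb))
        have h4 := hcons b hb
        cases b <;> simp_all [Xor]
      · intro hb
        have h3 := pR.one _ _ hk c1 (hcut.2 (pR.parent _ _ _ c2 hb))
        have h4 : c.left.child (!b) ∉ R := fun h => hcons _ h hb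
        cases b <;> simp_all [Xor]
    · have hk' : ¬ k.dual.IsAdditive := fun h => hk (isAdditive_dual.1 h)
      constructor
      · intro hb
        have := pR.both _ _ hk' c2 (hcut.1 (pR.parent _ _ _ c1 hb))
        cases b
        · exact this.2
        · exact this.1
      · intro hb
        have := pR.both _ _ hk c1 (hcut.2 (pR.parent _ _ _ c2 hb))
        cases b
        · exact this.1
        · exact this.2
  refine ⟨⟨_, h.isAdditiveResolution hR fun _ _ _ _ => ⟨key false, key true⟩, ?_⟩,
    hl.disjoint, hl.ne⟩
  rw [hR.2]
  ext v
  refine ⟨fun hv => (h.isLeaf_iff hR).2 ⟨hv, ?_, ?_⟩, fun hv => ((h.isLeaf_iff hR).1 hv).1⟩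
  · rintro rfl
    exact hv.2.not_conn c1
  · rintro rfl
    exact hv.2.not_conn c2

theorem step_isPreLinking {Θ Θ' : Set (Linking ι)} (h : Step (S, Θ) (S', Θ'))
    (hΘ : ∀ l ∈ Θ, S.IsPreLinking l) : ∀ l ∈ Θ', S'.IsPreLinking l := by
  obtain ⟨c, -, ⟨⟨X, b, hf⟩, rfl, hred⟩ | ⟨k, A₁, A₂, hf, hsub, hred, hinc, -⟩⟩ :=
    exists_reduct_of_step h
  · rintro _ ⟨l, hl, rfl⟩
    exact ((hred l).isPreLinking_elimAtom (hΘ l hl) hf).2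
  · exact fun l hl => (hred l hl).isPreLinking (hΘ l (hsub hl)) hf (hinc l hl)

section Balanced

variable (ρ : ι → ι)

/-- The right side of every cut pair is the dual occurrence of its left side. -/
def IsFlipped (S : CutSequent ι α) : Prop := ∀ c ∈ S.cuts, c.right = c.left.flip ρ

/-- The linking uses dual leaves on the two sides of every cut pair. -/
def Balanced (S : CutSequent ι α) (l : Linking ι) : Prop :=
  ∀ c ∈ S.cuts, ∀ v, c.left.Below v → (v ∈ l.support ↔ v.flip ρ ∈ l.support)

/-- `v` is in no cut pair. -/
def Outer (S : CutSequent ι α) (v : Occ ι) : Prop :=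
  ∀ c ∈ S.cuts, ¬ c.left.Below v ∧ ¬ c.right.Below v

theorem Reduct.outer (h : S.Reduct S' c l) {v : Occ ι} (hv : S.Outer v) : S'.Outer v := by
  intro d hd
  rcases h.old d hd with ⟨hd, -⟩ | ⟨k, A₁, A₂, hf, rfl | rfl⟩
  · exact hv d hd
  all_goals
    have := hv c h.mem
    exact ⟨fun h => this.1 ((Occ.below_child _ _).trans h),
      fun h => this.2 ((Occ.below_child _ _).trans h)⟩

variable {ρ}

theorem Reduct.isFlipped (h : S.Reduct S' c l) (hS : S.IsFlipped ρ) : S'.IsFlipped ρ := by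
  intro d hd
  rcases h.old d hd with ⟨hd, -⟩ | ⟨k, A₁, A₂, hf, rfl | rfl⟩
  · exact hS d hd
  all_goals
    have := hS c h.mem
    simp [CutPair.first, CutPair.second, this]

theorem balanced_of_unused {d : CutPair ι α} (hd : d.Unused l)
    (hflip : d.right = d.left.flip ρ) {v : Occ ι} (hv : d.left.Below v) :
    v ∈ l.support ↔ v.flip ρ ∈ l.support :=
  ⟨fun h => ((hd v h).1 hv).elim, fun h => ((hd _ h).2 (hflip ▸ hv.flip ρ)).elim⟩

theorem flip_injective (hρ : ∀ i, ρ (ρ i) = i) {u v : Occ ι} (h : u.flip ρ = v.flip ρ) : u = v := by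
  rw [← Occ.flip_flip hρ u, h, Occ.flip_flip hρ]

/-- In a step eliminating the cut `c` of a connective, balance is preserved. -/
theorem Reduct.balanced_iff (h : S.Reduct S' c l) (hl : S.IsPreLinking l) (hS : S.IsFlipped ρ)
    {k : Conn} {A₁ A₂ : Formula α} (hf : c.formula = .bin k A₁ A₂) :
    S.Balanced ρ l ↔ S'.Balanced ρ l := by
  obtain ⟨R, hR⟩ := hl.resolution
  obtain ⟨h1, h2⟩ := conn_left_right h.mem hf
  constructor
  · intro hb d hd v hv
    rcases h.old d hd with ⟨hd, -⟩ | ⟨k, B₁, B₂, hf', rfl | rfl⟩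
    · exact hb d hd v hv
    all_goals exact hb c h.mem v ((Occ.below_child _ _).trans hv)
  · intro hb d hd v hv
    rcases h.keep d hd with rfl | hd' | hd'
    · have hflip := hS d hd
      rcases hv.eq_or_child with rfl | ⟨b, hv⟩
      · refine iff_of_false (fun h => ?_) (fun h => ?_)
        · exact (hR.isLeaf h).not_conn ⟨_, _, h1⟩
        · exact (hR.isLeaf h).not_conn ⟨_, _, hflip ▸ h2⟩
      · cases b
        · rcases h.first _ _ _ hf with h' | h'
          · exact hb _ h' v hv
          · exact balanced_of_unused h' (by simp [CutPair.first, hflip]) hv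
        · rcases h.second _ _ _ hf with h' | h'
          · exact hb _ h' v hv
          · exact balanced_of_unused h' (by simp [CutPair.second, hflip]) hv
    · exact hb d hd' v hv
    · exact balanced_of_unused hd' (hS d hd) hv

/-- Balanced linkings are not deleted. -/
theorem Balanced.not_inconsistent (hb : S.Balanced ρ l) (hl : S.IsPreLinking l)
    (hS : S.IsFlipped ρ) (hc : c ∈ S.cuts) {k : Conn} {A₁ A₂ : Formula α}
    (hf : c.formula = .bin k A₁ A₂) (hk : k.IsAdditive) : ¬ S.Inconsistent c l := by
  obtain ⟨R, hR⟩ := hl.resolution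
  obtain ⟨h1, h2⟩ := conn_left_right hc hf
  rintro ⟨b, hb1, hb2⟩
  rw [hR.res_eq] at hb1 hb2
  obtain ⟨-, w, hw, hbw⟩ := hR.mem_iff.1 hb1
  have hw' := (hb c hc w ((Occ.below_child _ _).trans hbw)).1 hw
  have hbw' := hbw.flip ρ
  rw [Occ.flip_child, ← hS c hc] at hbw'
  exact hR.1.pruning.not_both (isAdditive_dual.2 hk) ⟨_, _, h2⟩ hb2
    (hR.1.pruning.of_below (h2.child _) hbw' (hR.mem_of_support hw'))

/-- An atomic cut is always balanced, since a resolution keeps both of its sides or neither, and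
eliminating it affects no leaf of the other cut pairs. -/
theorem Reduct.balanced_elimAtom_iff (hρ : ∀ i, ρ (ρ i) = i) (h : S.Reduct S' c l)
    (hl : S.IsPreLinking l) (hS : S.IsFlipped ρ) {X : α} {x : Bool} (hf : c.formula = .lit X x) :
    S.Balanced ρ l ↔ S'.Balanced ρ (elimAtom c l) := by
  obtain ⟨R, hR⟩ := hl.resolution
  obtain ⟨h1, h2⟩ := lit_left_right h.mem hf
  have hcc := (h.isPreLinking_elimAtom hl hf).1
  have hsupp := hl.support_elimAtom hcc
  have key : ∀ d ∈ S'.cuts, ∀ v, d.left.Below v → ((v ∈ l.support ↔ v.flip ρ ∈ l.support) ↔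
      (v ∈ (elimAtom c l).support ↔ v.flip ρ ∈ (elimAtom c l).support)) := by
    intro d hd v hv
    rcases h.old d hd with ⟨hd', a1, a2, a3, a4⟩ | ⟨k, B₁, B₂, hf', -⟩
    · have hv' := hv.flip ρ
      rw [← hS d hd'] at hv'
      have n1 : v ≠ c.left := fun e => a1.1 (e ▸ hv)
      have n2 : v ≠ c.right := fun e => a2.1 (e ▸ hv)
      have n3 : v.flip ρ ≠ c.left := fun e => a3.1 (e ▸ hv')
      have n4 : v.flip ρ ≠ c.right := fun e => a4.1 (e ▸ hv')
      rw [hsupp]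
      simp [n1, n2, n3, n4]
    · cases hf.symm.trans hf'
  constructor
  · intro hb d hd v hv
    refine (key d hd v hv).1 ?_
    rcases h.old d hd with ⟨hd', -⟩ | ⟨k, B₁, B₂, hf', -⟩
    · exact hb d hd' v hv
    · cases hf.symm.trans hf'
  · intro hb d hd v hv
    rcases h.keep d hd with rfl | hd' | hd'
    · have hflip := hS d hd
      by_cases he : v = d.left
      · subst he
        rw [← hflip]
        exact hcc
      · refine iff_of_false (fun hv' => he ?_) (fun hv' => he ?_)
        · obtain ⟨Y, y, hY⟩ := hR.isLeaf hv'
          exact h1.eq_of_lit hY hv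
        · obtain ⟨Y, y, hY⟩ := hR.isLeaf hv'
          have := h2.eq_of_lit hY (hflip ▸ hv.flip ρ)
          exact flip_injective hρ (this.trans hflip)
    · exact (key d hd' v hv).2 (hb d hd' v hv)
    · exact balanced_of_unused hd' (hS d hd) hv

end Balanced

end CutSequent

end MALL

/-! ### Following linkings through a complete reduction. -/

namespace MALL

variable {ι α : Type*}

namespace CutSequent

variable {S S' : CutSequent ι α} {l l' : Linking ι} {ρ : ι → ι}

/-- The linking `l'` of `S'` arises from the linking `l` of `S` by cut elimination: the leaves and
links in no cut are kept, and links meeting in the two sides of a cut are joined, now or later. -/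
structure Evolves (ρ : ι → ι) (S S' : CutSequent ι α) (l l' : Linking ι) : Prop where
  support : ∀ v, S.Outer v → (v ∈ l'.support ↔ v ∈ l.support)
  link : ∀ u v, S.Outer u → S.Outer v → s(u, v) ∈ l → s(u, v) ∈ l'
  join : ∀ c ∈ S.cuts, ∀ y, c.left.Below y → ∀ u w, S.Outer u → S.Outer w → s(u, y) ∈ l →
    s(w, y.flip ρ) ∈ l → s(u, w) ∈ l' ∨
      ∃ d ∈ S'.cuts, d.left.Below y ∧ s(u, y) ∈ l' ∧ s(w, y.flip ρ) ∈ l'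

theorem Outer.ne {v : Occ ι} (hv : S.Outer v) {c : CutPair ι α} (hc : c ∈ S.cuts) :
    v ≠ c.left ∧ v ≠ c.right := by
  have := hv c hc
  exact ⟨fun h => this.1 (h ▸ Occ.Below.refl _), fun h => this.2 (h ▸ Occ.Below.refl _)⟩

/-- The linking does not change. A meeting point `y` in the cut `c` just passes to the new cut pair
on the argument that contains it. -/
theorem Reduct.evolves {c : CutPair ι α} (h : S.Reduct S' c l) (hl : S.IsPreLinking l) {k : Conn}
    {A₁ A₂ : Formula α} (hf : c.formula = .bin k A₁ A₂) : Evolves ρ S S' l l := by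
  obtain ⟨R, hR⟩ := hl.resolution
  refine ⟨fun v _ => Iff.rfl, fun u v _ _ h => h, fun d hd y hy u w _ _ hu hw => .inr ?_⟩
  have hys : y ∈ l.support := ⟨_, hu, Sym2.mem_mk_right _ _⟩
  rcases h.keep d hd with rfl | hd' | hd'
  · rcases hy.eq_or_child with rfl | ⟨b, hy⟩
    · exact ((hR.isLeaf hys).not_conn ⟨_, _, (conn_left_right hd hf).1⟩).elim
    · cases b
      · rcases h.first _ _ _ hf with h' | h'
        · exact ⟨_, h', hy, hu, hw⟩
        · exact absurd hy (h' y hys).1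
      · rcases h.second _ _ _ hf with h' | h'
        · exact ⟨_, h', hy, hu, hw⟩
        · exact absurd hy (h' y hys).1
  · exact ⟨d, hd', hy, hu, hw⟩
  · exact absurd hy (hd' y hys).1

/-- Links meeting at `c` are joined by definition of `elimAtom`; those meeting elsewhere avoid the
sides of `c`, which are apart from all other cut pairs. -/
theorem Reduct.evolves_elimAtom {c : CutPair ι α} (h : S.Reduct S' c l) (hl : S.IsPreLinking l)
    (hS : S.IsFlipped ρ) {X : α} {x : Bool} (hf : c.formula = .lit X x) :
    Evolves ρ S S' l (elimAtom c l) := by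
  obtain ⟨R, hR⟩ := hl.resolution
  obtain ⟨h1, h2⟩ := lit_left_right h.mem hf
  have hcc := (h.isPreLinking_elimAtom hl hf).1
  have keep : ∀ u v, u ≠ c.left → u ≠ c.right → v ≠ c.left → v ≠ c.right → s(u, v) ∈ l →
      s(u, v) ∈ elimAtom c l := by
    intro u v h1 h2 h3 h4 h
    refine .inl ⟨h, ?_, ?_⟩ <;> rw [Sym2.mem_iff] <;> tauto
  refine ⟨?_, ?_, ?_⟩
  · intro v hv
    rw [hl.support_elimAtom hcc]
    exact ⟨fun h => h.1, fun h' => ⟨h', hv.ne h.mem⟩⟩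
  · intro u v hu hv huv
    have hu := hu.ne h.mem
    have hv := hv.ne h.mem
    exact keep u v hu.1 hu.2 hv.1 hv.2 huv
  · intro d hd y hy u w hu hw huy hwy
    have hys : y ∈ l.support := ⟨_, huy, Sym2.mem_mk_right _ _⟩
    have hu' := hu.ne h.mem
    have hw' := hw.ne h.mem
    rcases h.keep d hd with rfl | hd' | hd'
    · left
      obtain ⟨Y, b, hY⟩ := hR.isLeaf hys
      obtain rfl := h1.eq_of_lit hY hy
      rw [← hS d hd, Sym2.eq_swap] at hwy
      exact .inr ⟨u, w, hu'.2, hw'.1, huy, hwy, rfl⟩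
    · right
      rcases h.old d hd' with ⟨-, a1, a2, a3, a4⟩ | ⟨k, B₁, B₂, hf', -⟩
      · have hyf := hy.flip ρ
        rw [← hS d hd] at hyf
        exact ⟨d, hd', hy,
          keep _ _ hu'.1 hu'.2 (fun e => a1.1 (e ▸ hy)) (fun e => a2.1 (e ▸ hy)) huy,
          keep _ _ hw'.1 hw'.2 (fun e => a3.1 (e ▸ hyf)) (fun e => a4.1 (e ▸ hyf)) hwy⟩
      · cases hf.symm.trans hf'
    · exact absurd hy (hd' y hys).1

theorem Evolves.trans {S'' : CutSequent ι α} {l'' : Linking ι}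
    (hout : ∀ v, S.Outer v → S'.Outer v) (h : Evolves ρ S S' l l') (h' : Evolves ρ S' S'' l' l'') :
    Evolves ρ S S'' l l'' := by
  refine ⟨fun v hv => (h'.support v (hout v hv)).trans (h.support v hv),
    fun u v hu hv huv => h'.link u v (hout u hu) (hout v hv) (h.link u v hu hv huv), ?_⟩
  intro c hc y hy u w hu hw huy hwy
  rcases h.join c hc y hy u w hu hw huy hwy with h1 | ⟨d, hd, hdy, h1, h2⟩
  · exact .inl (h'.link u w (hout u hu) (hout w hw) h1)
  · exact h'.join d hd y hdy u w (hout u hu) (hout w hw) h1 h2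

theorem step_forward (hρ : ∀ i, ρ (ρ i) = i) {Θ Θ' : Set (Linking ι)} (h : Step (S, Θ) (S', Θ'))
    (hΘ : ∀ l ∈ Θ, S.IsPreLinking l) (hS : S.IsFlipped ρ) (hl : l ∈ Θ) (hb : S.Balanced ρ l) :
    ∃ l' ∈ Θ', S'.Balanced ρ l' ∧ Evolves ρ S S' l l' := by
  obtain ⟨c, hred₀, ⟨⟨X, b, hf⟩, rfl, hred⟩ | ⟨k, A₁, A₂, hf, hsub, hred, -, hmem⟩⟩ :=
    exists_reduct_of_step h
  · exact ⟨_, ⟨l, hl, rfl⟩, ((hred l).balanced_elimAtom_iff hρ (hΘ l hl) hS hf).1 hb,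
      (hred l).evolves_elimAtom (hΘ l hl) hS hf⟩
  · have hl' := hmem l hl fun hk => hb.not_inconsistent (hΘ l hl) hS hred₀.mem hf hk
    exact ⟨l, hl', ((hred l hl').balanced_iff (hΘ l hl) hS hf).1 hb,
      (hred l hl').evolves (hΘ l hl) hf⟩

/-- Balance is preserved in both directions, so it can be pulled back to the linking from which `l'`
comes. -/
theorem step_backward (hρ : ∀ i, ρ (ρ i) = i) {Θ Θ' : Set (Linking ι)} (h : Step (S, Θ) (S', Θ'))
    (hΘ : ∀ l ∈ Θ, S.IsPreLinking l) (hS : S.IsFlipped ρ) (hl' : l' ∈ Θ')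
    (hb : S'.Balanced ρ l') : ∃ l ∈ Θ, S.Balanced ρ l ∧ Evolves ρ S S' l l' := by
  obtain ⟨c, -, ⟨⟨X, b, hf⟩, rfl, hred⟩ | ⟨k, A₁, A₂, hf, hsub, hred, -, hmem⟩⟩ :=
    exists_reduct_of_step h
  · obtain ⟨l, hl, rfl⟩ := hl'
    exact ⟨l, hl, ((hred l).balanced_elimAtom_iff hρ (hΘ l hl) hS hf).2 hb,
      (hred l).evolves_elimAtom (hΘ l hl) hS hf⟩
  · have hl := hsub hl'
    exact ⟨l', hl, ((hred l' hl').balanced_iff (hΘ l' hl) hS hf).2 hb,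
      (hred l' hl').evolves (hΘ l' hl) hf⟩

/-- The composition of two sets of linkings, as computed by complete cut elimination. -/
theorem reduction_spec (hρ : ∀ i, ρ (ρ i) = i) {T : CutSequent ι α} {Θ Ψ : Set (Linking ι)}
    (h : Relation.ReflTransGen Step (S, Θ) (T, Ψ)) (hT : T.cuts = [])
    (hΘ : ∀ l ∈ Θ, S.IsPreLinking l) (hS : S.IsFlipped ρ) :
    (∀ l ∈ Θ, S.Balanced ρ l → ∃ m ∈ Ψ, Evolves ρ S T l m) ∧
      ∀ m ∈ Ψ, ∃ l ∈ Θ, S.Balanced ρ l ∧ Evolves ρ S T l m := by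
  generalize hp : (S, Θ) = p at h
  induction h using Relation.ReflTransGen.head_induction_on generalizing S Θ with
  | refl =>
    cases hp
    have key : ∀ m, Evolves ρ T T m m := fun m =>
      ⟨fun _ _ => Iff.rfl, fun _ _ _ _ h => h, fun c hc => by simp [hT] at hc⟩
    -- Without cuts balance is vacuous. Pulled back along the reduction, this makes every final
    -- linking descend from a balanced one.
    exact ⟨fun m hm _ => ⟨m, hm, key m⟩, fun m hm => ⟨m, hm, fun c hc => by simp [hT] at hc, key m⟩⟩
  | @head _ q h1 h2 ih =>
    cases hp
    clear h2
    obtain ⟨S', Θ'⟩ := q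
    obtain ⟨c, hred, -⟩ := exists_reduct_of_step h1
    obtain ⟨ih1, ih2⟩ := ih (step_isPreLinking h1 hΘ) (hred.isFlipped hS) rfl
    have hout : ∀ v, S.Outer v → S'.Outer v := fun v hv => hred.outer hv
    constructor
    · intro l hl hb
      obtain ⟨l', hl', hb', he⟩ := step_forward hρ h1 hΘ hS hl hb
      obtain ⟨m, hm, hem⟩ := ih1 l' hl' hb'
      exact ⟨m, hm, he.trans hout hem⟩
    · intro m hm
      obtain ⟨l', hl', hb', hem⟩ := ih2 m hm
      obtain ⟨l, hl, hb, he⟩ := step_backward hρ h1 hΘ hS hl' hb'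
      exact ⟨l, hl, hb, he.trans hout hem⟩

end CutSequent

end MALL

namespace MALL

variable {ι α : Type*}

/-! ### Distributed formulas -/

/-- The main connective of `F` is `c`. -/
def Formula.HasTop (c : Conn) (F : Formula α) : Prop := ∃ A B, F = .bin c A B

/-- A recursive form of distributivity. -/
def Formula.IsDist : Formula α → Prop
  | .lit _ _ => True
  | .bin c A B => A.IsDist ∧ B.IsDist ∧
      (c = .tens → ¬ A.HasTop .plus ∧ ¬ B.HasTop .plus) ∧
      (c = .parr → ¬ A.HasTop .amp ∧ ¬ B.HasTop .amp)

theorem Formula.Distributed.isDist {F : Formula α} (h : F.Distributed) : F.IsDist := by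
  induction F with
  | lit X b => trivial
  | bin c A B ihA ihB =>
    refine ⟨ihA fun P Q R => ?_, ihB fun P Q R => ?_, ?_, ?_⟩
    · obtain ⟨h1, h2, h3, h4⟩ := h P Q R
      exact ⟨fun k => h1 (k.left _ _), fun k => h2 (k.left _ _), fun k => h3 (k.left _ _),
        fun k => h4 (k.left _ _)⟩
    · obtain ⟨h1, h2, h3, h4⟩ := h P Q R
      exact ⟨fun k => h1 (k.right _ _), fun k => h2 (k.right _ _), fun k => h3 (k.right _ _),
        fun k => h4 (k.right _ _)⟩
    · rintro rfl
      constructor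
      · rintro ⟨P, Q, rfl⟩
        exact (h P Q B).2.1 (.refl _)
      · rintro ⟨P, Q, rfl⟩
        exact (h A P Q).1 (.refl _)
    · rintro rfl
      constructor
      · rintro ⟨P, Q, rfl⟩
        exact (h B Q P).2.2.1 (.refl _)
      · rintro ⟨P, Q, rfl⟩
        exact (h Q P A).2.2.2 (.refl _)

theorem Formula.hasTop_dual {F : Formula α} {c : Conn} : F.dual.HasTop c ↔ F.HasTop c.dual := by
  constructor
  · rintro ⟨A, B, h⟩
    refine ⟨B.dual, A.dual, ?_⟩
    rw [← F.dual_dual, h]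
    rfl
  · rintro ⟨A, B, rfl⟩
    refine ⟨B.dual, A.dual, ?_⟩
    cases c <;> rfl

theorem Formula.IsDist.dual {F : Formula α} (h : F.IsDist) : F.dual.IsDist := by
  induction F with
  | lit X b => trivial
  | bin c A B ihA ihB =>
    obtain ⟨hA, hB, h1, h2⟩ := h
    refine ⟨ihB hB, ihA hA, fun hc => ?_, fun hc => ?_⟩ <;> rw [hasTop_dual, hasTop_dual]
    · have := h2 (by cases c <;> simp_all [Conn.dual])
      exact ⟨this.2, this.1⟩
    · have := h1 (by cases c <;> simp_all [Conn.dual])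
      exact ⟨this.2, this.1⟩

instance Pt.nonempty (F : Formula α) : Nonempty (Pt F) := by
  induction F with
  | lit X b => exact ⟨()⟩
  | bin c A B ihA ihB =>
    obtain ⟨a⟩ := ihA
    obtain ⟨b⟩ := ihB
    cases c
    · exact ⟨(a, b)⟩
    · exact ⟨(a, b)⟩
    · exact ⟨.inl a⟩
    · exact ⟨.inl a⟩

/-! ### Changing a point step by step -/

open Classical in
/-- The signs `s` above `u`, and `0` elsewhere. -/
noncomputable def restrictSign (u : Occ ι) (s : Occ ι → SignType) (w : Occ ι) : SignType :=
  if u.Below w then s w else 0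

theorem typ_restrictSign {F : Formula α} {a b : Pt F} {u : Occ ι} {s : Occ ι → SignType} :
    typ F a b u (restrictSign u s) = typ F a b u s :=
  typ_congr fun _ hw => if_pos hw

theorem typ_restrictSign_self {F : Formula α} {a : Pt F} {u u' : Occ ι} {s : Occ ι → SignType}
    (h : ∀ w, u'.Below w → ¬ u.Below w) : typ F a a u' (restrictSign u s) = 0 :=
  typ_self_zero fun w hw => if_neg (h w (leaves_below hw))

theorem typ_self_single {F : Formula α} {a : Pt F} {v x : Occ ι} {s : Occ ι → SignType}
    (hx : x ∈ leaves F a v) (h : ∀ w ∈ leaves F a v, w ≠ x → s w = 0) : typ F a a v s = s x := by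
  induction F generalizing v with
  | lit X b =>
    obtain rfl : x = v := hx
    rfl
  | bin c A B ihA ihB =>
    cases c
    case tens | parr =>
      rcases hx with hx | hx
      · have h0 : typ B a.2 a.2 (v.child true) s = 0 :=
          typ_self_zero fun w hw => h w (.inr hw) fun he => leaves_disjoint hx (he ▸ hw)
        simp only [typ, ihA hx fun w hw => h w (.inl hw), h0, tensSign_zero, parrSign_zero]
      · have h0 : typ A a.1 a.1 (v.child false) s = 0 :=
          typ_self_zero fun w hw => h w (.inl hw) fun he => leaves_disjoint (he ▸ hw) hx
        simp only [typ, ihB hx fun w hw => h w (.inr hw), h0]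
        first | rw [tensSign_comm, tensSign_zero] | rw [parrSign_comm, parrSign_zero]
    case amp | plus =>
      rcases a with a | a
      · exact ihA hx h
      · exact ihB hx h

/-- The points `a` and `b` can be made equal or of coherence `ε`. -/
def Neutral (ε : SignType) (F : Formula α) (v : Occ ι) (a b : Pt F) : Prop :=
  ∃ s, typ F a b v s = 0 ∨ typ F a b v s = ε

open Classical in
/-- With suitable signs at the other leaves, the sign at the leaf `x` determines the coherence of
the points `a` and `b`. -/
def Matters (F : Formula α) (v x : Occ ι) (a b : Pt F) : Prop :=
  x ∈ leaves F a v ∧ x ∈ leaves F b v ∧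
    ∃ s, ∀ ε : SignType, ε ≠ 0 → typ F a b v (Function.update s x ε) = ε

theorem Matters.self {F : Formula α} {v x : Occ ι} {a : Pt F} (h : x ∈ leaves F a v) :
    Matters F v x a a := by
  classical
  refine ⟨h, h, 0, fun ε _ => ?_⟩
  rw [typ_self_single h fun w _ hw => by simp [hw]]
  simp

section Pairs

variable {A B : Formula α} {u u' : Occ ι} {op : SignType → SignType → SignType} {η : SignType}

/-- Coherence of pairs, for a given combination of signs. -/
def pairTyp (op : SignType → SignType → SignType) (u u' : Occ ι) (p q : Pt A × Pt B)
    (s : Occ ι → SignType) : SignType :=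
  op (typ A p.1 q.1 u s) (typ B p.2 q.2 u' s)

/-- The components are changed one after the other, with sign `0` on the whole component that stays
fixed. -/
theorem neutral_pairs (h0 : ∀ x, op x 0 = x) (h0' : ∀ x, op 0 x = x)
    (hu : ∀ w, u.Below w → ¬ u'.Below w) {p q : Pt A × Pt B}
    (hA : Relation.ReflTransGen (Neutral η A u) p.1 q.1)
    (hB : Relation.ReflTransGen (Neutral η B u') p.2 q.2) :
    Relation.ReflTransGen
      (fun p q => ∃ s, pairTyp op u u' p q s = 0 ∨ pairTyp op u u' p q s = η) p q := by
  refine Relation.ReflTransGen.trans (b := (q.1, p.2))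
    (hA.lift (fun a => (a, p.2)) fun a b ⟨s, hs⟩ => ⟨restrictSign u s, ?_⟩)
    (hB.lift (fun b => (q.1, b)) fun a b ⟨s, hs⟩ => ⟨restrictSign u' s, ?_⟩)
  · simp only [pairTyp]
    rwa [typ_restrictSign, typ_restrictSign_self fun w h1 h2 => hu w h2 h1, h0]
  · simp only [pairTyp]
    rwa [typ_restrictSign, typ_restrictSign_self hu, h0']

/-- Here `η` is absorbing: under the constant sign `η` the component that stays fixed alone decides
the sign of the pair. -/
theorem const_pairs (h : ∀ x, op x η = η) (h' : ∀ x, op η x = η) (p q : Pt A × Pt B) :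
    Relation.ReflTransGen
      (fun p q => ∃ s, pairTyp op u u' p q s = 0 ∨ pairTyp op u u' p q s = η) p q := by
  refine .tail (b := (q.1, p.2)) (.single ⟨fun _ => η, .inr ?_⟩) ⟨fun _ => η, .inr ?_⟩
  · simp only [pairTyp, typ_self_const, h]
  · simp only [pairTyp, typ_self_const, h']

-- The first component moves while the second has sign `0`; then the second moves while `x` alone
-- carries a sign in the first. The latter works because `η` does not disturb nonzero signs: it is
-- `1` for `⊗` and `-1` for `⅋`.
open Classical in
theorem matters_pairs (h0 : ∀ x, op x 0 = x) (hη : ∀ ε, ε ≠ 0 → op ε η = ε)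
    (hu : ∀ w, u.Below w → ¬ u'.Below w) {x : Occ ι} {p q : Pt A × Pt B}
    (hx : x ∈ leaves A q.1 u) (hA : Relation.ReflTransGen (Matters A u x) p.1 q.1)
    (hB : Relation.ReflTransGen (Neutral η B u') p.2 q.2) :
    Relation.ReflTransGen (fun p q => x ∈ leaves A p.1 u ∧ x ∈ leaves A q.1 u ∧
      ∃ s, ∀ ε : SignType, ε ≠ 0 → pairTyp op u u' p q (Function.update s x ε) = ε) p q := by
  have hxu := leaves_below hx
  refine Relation.ReflTransGen.trans (b := (q.1, p.2))
    (hA.lift (fun a => (a, p.2)) fun a b ⟨h1, h2, s, hs⟩ => ⟨h1, h2, restrictSign u s, ?_⟩)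
    (hB.lift (fun b => (q.1, b)) fun a b ⟨s, hs⟩ => ⟨hx, hx, restrictSign u' s, ?_⟩)
  · intro ε hε
    have : Function.update (restrictSign u s) x ε = restrictSign u (Function.update s x ε) := by
      ext w
      by_cases hw : w = x
      · subst hw
        simp [restrictSign, hxu]
      · simp [restrictSign, hw]
    simp only [pairTyp, this]
    rw [typ_restrictSign, typ_restrictSign_self fun w h1 h2 => hu w h2 h1, h0, hs ε hε]
  · intro ε hε
    have e1 : typ A q.1 q.1 u (Function.update (restrictSign u' s) x ε) = ε := by
      rw [typ_self_single hx, Function.update_self]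
      intro w hw hwx
      rw [Function.update_of_ne hwx]
      exact if_neg (hu w (leaves_below hw))
    have e2 : typ B a b u' (Function.update (restrictSign u' s) x ε) = typ B a b u' s := by
      rw [← typ_restrictSign (s := s)]
      refine typ_congr fun w hw => Function.update_of_ne ?_ _ _
      rintro rfl
      exact hu w hxu hw
    simp only [pairTyp, e1, e2]
    rcases hs with hs | hs
    · rw [hs, h0]
    · rw [hs, hη ε hε]

end Pairs

theorem child_apart (v : Occ ι) {b d : Bool} (h : b ≠ d) (w : Occ ι) (h1 : (v.child b).Below w) :
    ¬ (v.child d).Below w := fun h2 => h (Occ.child_below_inj h1 h2)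

/-- Two points of the same summand are connected by a detour through the other one. -/
theorem sum_chain {P Q : Type} [Nonempty P] [Nonempty Q] {r : P ⊕ Q → P ⊕ Q → Prop}
    (h1 : ∀ a b, r (.inl a) (.inr b)) (h2 : ∀ a b, r (.inr b) (.inl a)) (x y : P ⊕ Q) :
    Relation.ReflTransGen r x y := by
  obtain ⟨p⟩ := ‹Nonempty P›
  obtain ⟨q⟩ := ‹Nonempty Q›
  rcases x with x | x <;> rcases y with y | y
  · exact .tail (.single (h1 x q)) (h2 y q)
  · exact .single (h1 x y)
  · exact .single (h2 y x)
  · exact .tail (.single (h2 p x)) (h1 p y)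

/-- For the sign `1`: changing the argument of a `&` has sign `1`, which is absorbing in a `⅋`; a
`⊗` is treated componentwise, its arguments not being `⊕` by distributivity. An `⊕` is excluded as
changing its argument has sign `-1`. The other half is dual. -/
theorem neutral_chain {F : Formula α} (hF : F.IsDist) (v : Occ ι) :
    (¬ F.HasTop .plus → ∀ a b, Relation.ReflTransGen (Neutral 1 F v) a b) ∧
    (¬ F.HasTop .amp → ∀ a b, Relation.ReflTransGen (Neutral (-1) F v) a b) := by
  induction F generalizing v with
  | lit X b => exact ⟨fun _ _ _ => .refl, fun _ _ _ => .refl⟩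
  | bin c A B ihA ihB =>
    obtain ⟨hA, hB, ht, hp⟩ := hF
    cases c
    case tens =>
      obtain ⟨h1, h2⟩ := ht rfl
      exact ⟨fun _ a b => neutral_pairs (op := tensSign) (by decide) (by decide)
          (child_apart v Bool.false_ne_true) ((ihA hA _).1 h1 _ _) ((ihB hB _).1 h2 _ _),
        fun _ a b => const_pairs (op := tensSign) (by decide) (by decide) a b⟩
    case parr =>
      obtain ⟨h1, h2⟩ := hp rfl
      exact ⟨fun _ a b => const_pairs (op := parrSign) (by decide) (by decide) a b,
        fun _ a b => neutral_pairs (op := parrSign) (by decide) (by decide)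
          (child_apart v Bool.false_ne_true) ((ihA hA _).2 h1 _ _) ((ihB hB _).2 h2 _ _)⟩
    case amp =>
      exact ⟨fun _ => sum_chain (P := Pt A) (Q := Pt B) (fun _ _ => ⟨0, .inr rfl⟩)
        (fun _ _ => ⟨0, .inr rfl⟩), fun h => absurd ⟨A, B, rfl⟩ h⟩
    case plus =>
      exact ⟨fun h => absurd ⟨A, B, rfl⟩ h, fun _ => sum_chain (P := Pt A) (Q := Pt B)
        (fun _ _ => ⟨0, .inr rfl⟩) (fun _ _ => ⟨0, .inr rfl⟩)⟩

/-- In a distributed formula, any two points with a common leaf `x` are connected by a chain of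
points whose successive coherences are determined by the sign at `x`. -/
theorem matters_chain {F : Formula α} (hF : F.IsDist) {v x : Occ ι} {a b : Pt F}
    (ha : x ∈ leaves F a v) (hb : x ∈ leaves F b v) :
    Relation.ReflTransGen (Matters F v x) a b := by
  induction F generalizing v with
  | lit X b => exact .refl
  | bin c A B ihA ihB =>
    obtain ⟨hA, hB, ht, hp⟩ := hF
    -- `⊗` with `η = 1` and `⅋` with `η = -1` together: the factor without `x` moves through signs
    -- `0` and `η`, which leave the sign of the other factor visible.
    have mult : ∀ (op : SignType → SignType → SignType) (η : SignType) {p q : Pt A × Pt B},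
        (∀ x, op x 0 = x) → (∀ ε, ε ≠ 0 → op ε η = ε) → (∀ x y, op x y = op y x) →
        Relation.ReflTransGen (Neutral η A (v.child false)) p.1 q.1 →
        Relation.ReflTransGen (Neutral η B (v.child true)) p.2 q.2 →
        x ∈ leaves A p.1 (v.child false) ∪ leaves B p.2 (v.child true) →
        x ∈ leaves A q.1 (v.child false) ∪ leaves B q.2 (v.child true) →
        Relation.ReflTransGen (fun p q : Pt A × Pt B =>
          x ∈ leaves A p.1 (v.child false) ∪ leaves B p.2 (v.child true) ∧
          x ∈ leaves A q.1 (v.child false) ∪ leaves B q.2 (v.child true) ∧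
          ∃ s, ∀ ε : SignType, ε ≠ 0 → pairTyp op (v.child false) (v.child true) p q
            (open Classical in Function.update s x ε) = ε) p q := by
      intro op η p q h0 hη hcomm nA nB hp hq
      rcases hp with hp | hp <;> rcases hq with hq | hq
      · exact (matters_pairs h0 hη (child_apart v Bool.false_ne_true) hq (ihA hA hp hq) nB).lift id
          fun _ _ h => ⟨.inl h.1, .inl h.2.1, h.2.2⟩
      · exact (leaves_disjoint hp hq).elim
      · exact (leaves_disjoint hq hp).elim
      · have := matters_pairs (p := p.swap) (q := q.swap) h0 hη
          (child_apart v Bool.false_ne_true.symm) hq (ihB hB hp hq) nA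
        refine this.lift Prod.swap fun _ _ h => ⟨.inr h.1, .inr h.2.1, ?_⟩
        obtain ⟨s, hs⟩ := h.2.2
        exact ⟨s, fun ε hε => (hcomm _ _).trans (hs ε hε)⟩
    cases c
    case tens =>
      obtain ⟨h1, h2⟩ := ht rfl
      exact mult tensSign 1 (by decide) (by decide) (by decide) ((neutral_chain hA _).1 h1 _ _)
        ((neutral_chain hB _).1 h2 _ _) ha hb
    case parr =>
      obtain ⟨h1, h2⟩ := hp rfl
      exact mult parrSign (-1) (by decide) (by decide) (by decide) ((neutral_chain hA _).2 h1 _ _)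
        ((neutral_chain hB _).2 h2 _ _) ha hb
    case amp | plus =>
      rcases a with a | a <;> rcases b with b | b
      · exact (ihA hA ha hb).lift Sum.inl fun _ _ h => h
      · exact (leaves_disjoint ha hb).elim
      · exact (leaves_disjoint hb ha).elim
      · exact (ihB hB ha hb).lift Sum.inr fun _ _ h => h

/-! ### Uniqueness of links -/

section Unique

variable {F G : Formula α} {v w : Occ ι} {θ : Set (Linking ι)}

/-- The coherence of any two linkings of `θ` in `F` is opposite to the one in `G`. -/
def IsRigid (F G : Formula α) (v w : Occ ι) (θ : Set (Linking ι)) : Prop :=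
  ∀ l ∈ θ, ∀ l' ∈ θ, l ≠ l' → ∀ (f f' : Pt F) (g g' : Pt G),
    l.support = leaves F f v ∪ leaves G g w → l'.support = leaves F f' v ∪ leaves G g' w →
    ∀ s : Occ ι → SignType, (∀ y z, s(y, z) ∈ l → s(y, z) ∈ l' → s z = -s y) →
      typ F f f' v s = -typ G g g' w s

theorem link_eq_of_matters (hvw : ∀ z, v.Below z → ¬ w.Below z)
    (hbip : ∀ l ∈ θ, ∀ e ∈ l, ∃ y z, e = s(y, z) ∧ v.Below y ∧ w.Below z)
    (hdisj : ∀ l ∈ θ, ∀ e ∈ l, ∀ f ∈ l, ∀ z, z ∈ e → z ∈ f → e = f)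
    (hrig : IsRigid F G v w θ) {l l' : Linking ι} (hl : l ∈ θ) (hl' : l' ∈ θ)
    {f f' : Pt F} {g g' : Pt G} (hs : l.support = leaves F f v ∪ leaves G g w)
    (hs' : l'.support = leaves F f' v ∪ leaves G g' w) {x : Occ ι} (hx : Matters F v x f f')
    {e e' : Sym2 (Occ ι)} (he : e ∈ l) (he' : e' ∈ l') (hxe : x ∈ e) (hxe' : x ∈ e') : e = e' := by
  classical
  by_contra hne
  obtain ⟨-, -, σ, hσ⟩ := hx
  have hll : l ≠ l' := by
    rintro rfl
    exact hne (hdisj l hl e he e' he' x hxe hxe')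
  -- The signs in `G` are forced on shared links and `0` elsewhere. They do not involve the sign `ε`
  -- of `x`, because no shared link is at `x`.
  let t : Occ ι → SignType := fun z =>
    if h : ∃ y, s(y, z) ∈ l ∧ s(y, z) ∈ l' then -σ h.choose else 0
  let τ : SignType → Occ ι → SignType := fun ε y =>
    if v.Below y then Function.update σ x ε y else t y
  have hτ : ∀ ε y z, s(y, z) ∈ l → s(y, z) ∈ l' → τ ε z = -τ ε y := by
    have key : ∀ ε y z, s(y, z) ∈ l → s(y, z) ∈ l' → v.Below y → w.Below z →
        τ ε z = -τ ε y := by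
      intro ε y z h1 h2 hy hz
      have hyx : y ≠ x := by
        rintro rfl
        have e1 := hdisj l hl _ he _ h1 y hxe (Sym2.mem_mk_left _ _)
        have e2 := hdisj l' hl' _ he' _ h2 y hxe' (Sym2.mem_mk_left _ _)
        exact hne (e1.trans e2.symm)
      have hex : ∃ y, s(y, z) ∈ l ∧ s(y, z) ∈ l' := ⟨y, h1, h2⟩
      have hch : hex.choose = y := Sym2.congr_left.1
        (hdisj l hl _ hex.choose_spec.1 _ h1 z (Sym2.mem_mk_right _ _) (Sym2.mem_mk_right _ _))
      have hz' : ¬ v.Below z := fun h => hvw z h hz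
      simp only [τ, t, hz', hy, if_true, if_false, dif_pos hex, hch, Function.update_of_ne hyx]
    intro ε y z h1 h2
    obtain ⟨y', z', heq, hy', hz'⟩ := hbip l hl _ h1
    rw [Sym2.eq_iff] at heq
    rcases heq with ⟨rfl, rfl⟩ | ⟨rfl, rfl⟩
    · exact key ε _ _ h1 h2 hy' hz'
    · rw [Sym2.eq_swap] at h1 h2
      rw [key ε _ _ h1 h2 hy' hz', neg_neg]
  -- By rigidity the sign in `F`, which is `ε`, is minus the sign in `G`, which is fixed; so `1` and
  -- `-1` would coincide.
  have h1 : ∀ ε, ε ≠ 0 → ε = -typ G g g' w t := by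
    intro ε hε
    have e1 : typ F f f' v (τ ε) = ε := (typ_congr fun z hz => if_pos hz).trans (hσ ε hε)
    have e2 : typ G g g' w (τ ε) = typ G g g' w t :=
      typ_congr fun z hz => if_neg fun h => hvw z h hz
    rw [← e2, ← hrig l hl l' hl' hll f f' g g' hs hs' (τ ε) (hτ ε), e1]
  exact absurd ((h1 1 (by decide)).trans (h1 (-1) (by decide)).symm) (by decide)

/-- In a rigid set of linkings, there is at most one link on every leaf of a distributed formula. -/
theorem link_unique (hvw : ∀ z, v.Below z → ¬ w.Below z)
    (hbip : ∀ l ∈ θ, ∀ e ∈ l, ∃ y z, e = s(y, z) ∧ v.Below y ∧ w.Below z)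
    (hdisj : ∀ l ∈ θ, ∀ e ∈ l, ∀ f ∈ l, ∀ z, z ∈ e → z ∈ f → e = f)
    (hpt : ∀ l ∈ θ, ∃ f g, l.support = leaves F f v ∪ leaves G g w)
    (hfull : ∀ f, ∃ l ∈ θ, ∃ g, l.support = leaves F f v ∪ leaves G g w)
    (hrig : IsRigid F G v w θ) (hF : F.IsDist) {l l' : Linking ι} (hl : l ∈ θ) (hl' : l' ∈ θ)
    {x : Occ ι} (hx : v.Below x) {e e' : Sym2 (Occ ι)} (he : e ∈ l) (he' : e' ∈ l') (hxe : x ∈ e)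
    (hxe' : x ∈ e') : e = e' := by
  have leaf : ∀ {l : Linking ι} {f : Pt F} {g : Pt G} {e},
      l.support = leaves F f v ∪ leaves G g w → e ∈ l → x ∈ e → x ∈ leaves F f v := by
    intro l f g e hs he hxe
    have : x ∈ l.support := ⟨e, he, hxe⟩
    rw [hs] at this
    exact this.resolve_right fun h => hvw x hx (leaves_below h)
  obtain ⟨f, g, hs⟩ := hpt l hl
  obtain ⟨f', g', hs'⟩ := hpt l' hl'
  have hf := leaf hs he hxe
  have chain := matters_chain hF hf (leaf hs' he' hxe')
  clear hpt
  induction chain generalizing l' g' e' with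
  | refl =>
    exact link_eq_of_matters hvw hbip hdisj hrig hl hl' hs hs' (Matters.self hf) he he' hxe hxe'
  | tail _ hm ih =>
    -- Every intermediate point belongs to some linking, which carries the link at `x` along the
    -- chain.
    obtain ⟨k, hk, g₁, hks⟩ := hfull _
    have hxk : x ∈ k.support := by
      rw [hks]
      exact .inl hm.1
    obtain ⟨d, hd, hxd⟩ := hxk
    exact (ih hk hd hxd g₁ hks).trans
      (link_eq_of_matters hvw hbip hdisj hrig hk hl' hks hs' hm hd he' hxd hxe')

end Unique

end MALL

namespace MALL

variable {ι α : Type*}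

/-! ### Sequents of two formulas -/

section Seq

open CutSequent

variable {i j : ι} {h : i ≠ j} {F G : Formula α} {l l' : Linking ι} {θ : Set (Linking ι)}

theorem below_root {i : ι} {v : Occ ι} : Occ.Below (i, []) v ↔ v.1 = i :=
  ⟨fun h => h.1.symm, fun h => ⟨h.symm, List.nil_suffix⟩⟩

theorem mem_roots_seq {r : Occ ι × Formula α} :
    r ∈ (seq i j h F G).roots ↔ r = ((i, []), F) ∨ r = ((j, []), G) := by
  simp [roots, seq]

theorem at_seq_left : (seq i j h F G).At (i, []) F := .root (mem_roots_seq.2 (.inl rfl))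

theorem at_seq_right : (seq i j h F G).At (j, []) G := .root (mem_roots_seq.2 (.inr rfl))

theorem root_of_at_seq {v : Occ ι} {A : Formula α} (hv : (seq i j h F G).At v A) :
    v.1 = i ∨ v.1 = j := by
  obtain ⟨r, hr, hrv⟩ := hv.exists_root
  rcases mem_roots_seq.1 hr with rfl | rfl
  · exact .inl (below_root.1 hrv)
  · exact .inr (below_root.1 hrv)

theorem root_of_mem_leaves {F : Formula α} {f : Pt F} {i : ι} {v : Occ ι}
    (hv : v ∈ leaves F f (i, [])) : v.1 = i := below_root.1 (leaves_below hv)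

theorem support_seq {R : Set (Occ ι)} (hR : (seq i j h F G).IsResolutionOf l R) :
    l.support = leaves F (ptAt R F (i, [])) (i, []) ∪ leaves G (ptAt R G (j, [])) (j, []) := by
  have hi : ((i, []) : Occ ι) ∈ R := hR.1.concl ((i, []), F) (by simp [seq])
  have hj : ((j, []) : Occ ι) ∈ R := hR.1.concl ((j, []), G) (by simp [seq])
  ext v
  rw [Set.mem_union, mem_leaves_ptAt hR.1.pruning hi at_seq_left,
    mem_leaves_ptAt hR.1.pruning hj at_seq_right, below_root, below_root, hR.2]
  constructor
  · rintro ⟨h1, h2⟩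
    obtain ⟨X, b, hX⟩ := id h2
    exact (root_of_at_seq hX).imp (fun h => ⟨h, h1, h2⟩) (fun h => ⟨h, h1, h2⟩)
  · rintro (⟨-, h⟩ | ⟨-, h⟩) <;> exact h

theorem leaves_eq_of_union_eq (h : i ≠ j) {f f' : Pt F} {g g' : Pt G}
    (he : leaves F f (i, []) ∪ leaves G g (j, []) = leaves F f' (i, []) ∪ leaves G g' (j, [])) :
    f = f' ∧ g = g' := by
  have h1 : ∀ {f : Pt F} {g : Pt G} {v}, v ∈ leaves F f (i, []) → v ∈ leaves G g (j, []) → False :=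
    fun hf hg => h ((root_of_mem_leaves hf).symm.trans (root_of_mem_leaves hg))
  constructor
  · refine leaves_injective (v := (i, [])) (Set.ext fun v => ⟨fun hv => ?_, fun hv => ?_⟩)
    · exact (he.subset (.inl hv)).resolve_right (h1 hv)
    · exact (he.superset (.inl hv)).resolve_right (h1 hv)
  · refine leaves_injective (v := (j, [])) (Set.ext fun v => ⟨fun hv => ?_, fun hv => ?_⟩)
    · exact (he.subset (.inr hv)).resolve_left fun h => h1 h hv
    · exact (he.superset (.inr hv)).resolve_left fun h => h1 h hv

/-- Supports determine points, so those chosen by the resolutions in `IsProofNet.coherent` are the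
given ones. -/
theorem coherent_seq (hθ : (seq i j h F G).IsProofNet θ) (hl : l ∈ θ) (hl' : l' ∈ θ)
    {f f' : Pt F} {g g' : Pt G} (hs : l.support = leaves F f (i, []) ∪ leaves G g (j, []))
    (hs' : l'.support = leaves F f' (i, []) ∪ leaves G g' (j, [])) {s : Occ ι → SignType}
    (hanti : ∀ y z, s(y, z) ∈ l → s(y, z) ∈ l' → s z = -s y)
    (h1 : typ F f f' (i, []) s ≠ 1) (h2 : typ G g g' (j, []) s ≠ 1)
    (h3 : typ F f f' (i, []) s = -1 ∨ typ G g g' (j, []) s = -1) : False := by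
  have hR := hθ.isResolutionOf hl
  have hR' := hθ.isResolutionOf hl'
  obtain ⟨rfl, rfl⟩ := leaves_eq_of_union_eq h (hs.symm.trans (support_seq hR))
  obtain ⟨rfl, rfl⟩ := leaves_eq_of_union_eq h (hs'.symm.trans (support_seq hR'))
  refine hθ.coherent rfl hl hl' hR hR' hanti ?_ ?_
  · intro r hr
    have : r = ((i, []), F) ∨ r = ((j, []), G) := by simpa [seq] using hr
    rcases this with rfl | rfl
    · exact h1
    · exact h2
  · rcases h3 with h3 | h3
    · exact ⟨((i, []), F), by simp [seq], h3⟩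
    · exact ⟨((j, []), G), by simp [seq], h3⟩

theorem exists_point {S : CutSequent ι α} {v w : Occ ι} (hv : S.At v F) (hw : S.IsLeaf w)
    (hvw : v.Below w) : ∃ f, w ∈ leaves F f v := by
  obtain ⟨X, x, hX⟩ := id hw
  induction F generalizing v with
  | lit Y b => exact ⟨(), hv.eq_of_lit hX hvw⟩
  | bin c A B ihA ihB =>
    rcases hvw.eq_or_child with rfl | ⟨b, hb⟩
    · exact (hw.not_conn ⟨_, _, hv⟩).elim
    · obtain ⟨a₀⟩ := Pt.nonempty A
      obtain ⟨b₀⟩ := Pt.nonempty B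
      cases b
      · obtain ⟨a, ha⟩ := ihA hv.left hb
        cases c
        · exact ⟨(a, b₀), .inl ha⟩
        · exact ⟨(a, b₀), .inl ha⟩
        · exact ⟨.inl a, ha⟩
        · exact ⟨.inl a, ha⟩
      · obtain ⟨a, ha⟩ := ihB hv.right hb
        cases c
        · exact ⟨(a₀, a), .inr ha⟩
        · exact ⟨(a₀, a), .inr ha⟩
        · exact ⟨.inr a, ha⟩
        · exact ⟨.inr a, ha⟩

end Seq

theorem Pt.dual_surjective (F : Formula α) : Function.Surjective (Pt.dual F) := by
  induction F with
  | lit X b => exact fun _ => ⟨(), rfl⟩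
  | bin c A B ihA ihB =>
    cases c
    case tens | parr =>
      rintro ⟨b, a⟩
      obtain ⟨a, rfl⟩ := ihA a
      obtain ⟨b, rfl⟩ := ihB b
      exact ⟨(a, b), rfl⟩
    case amp | plus =>
      rintro (b | a)
      · obtain ⟨b, rfl⟩ := ihB b
        exact ⟨.inr b, rfl⟩
      · obtain ⟨a, rfl⟩ := ihA a
        exact ⟨.inl a, rfl⟩

/-! ### Unions of linkings on two sequents -/

namespace CutSequent

/-- The two forests are disjoint, so the union of the two resolutions is one of the sequent with
cuts. It contains every root, hence both sides of each cut. -/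
theorem isPreLinking_union {S S₁ S₂ : CutSequent ι α}
    (hroots : ∀ r, r ∈ S.roots ↔ r ∈ S₁.concl ∨ r ∈ S₂.concl) (hc₁ : S₁.cuts = [])
    (hc₂ : S₂.cuts = []) (hdisj : ∀ v A B, S₁.At v A → S₂.At v B → False)
    {θ₁ θ₂ : Set (Linking ι)} (h₁ : S₁.IsProofNet θ₁) (h₂ : S₂.IsProofNet θ₂) :
    ∀ l ∈ joins θ₁ θ₂, S.IsPreLinking l := by
  rintro _ ⟨l₁, hl₁, l₂, hl₂, rfl⟩
  have hr₁ : S₁.roots = S₁.concl := by simp [roots, hc₁]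
  have hr₂ : S₂.roots = S₂.concl := by simp [roots, hc₂]
  have hat : ∀ v A, S.At v A ↔ S₁.At v A ∨ S₂.At v A := by
    intro v A
    constructor
    · intro hv
      induction hv with
      | root hr =>
        exact ((hroots _).1 hr).imp (fun h => .root (hr₁ ▸ h)) (fun h => .root (hr₂ ▸ h))
      | left _ ih => exact ih.imp At.left At.left
      | right _ ih => exact ih.imp At.right At.right
    · rintro (hv | hv)
      · induction hv with
        | root hr => exact .root ((hroots _).2 (.inl (hr₁ ▸ hr)))
        | left _ ih => exact ih.left
        | right _ ih => exact ih.right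
      · induction hv with
        | root hr => exact .root ((hroots _).2 (.inr (hr₂ ▸ hr)))
        | left _ ih => exact ih.left
        | right _ ih => exact ih.right
  have hR₁ := h₁.isResolutionOf hl₁
  have hR₂ := h₂.isResolutionOf hl₂
  set R₁ := S₁.res l₁
  set R₂ := S₂.res l₂
  have p₁ := hR₁.1.pruning
  have p₂ := hR₂.1.pruning
  have hconn : ∀ c v, S.IsConn c v ↔ S₁.IsConn c v ∨ S₂.IsConn c v := by
    intro c v
    constructor
    · rintro ⟨A, B, h⟩
      exact ((hat _ _).1 h).imp (fun h => ⟨A, B, h⟩) (fun h => ⟨A, B, h⟩)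
    · rintro (⟨A, B, h⟩ | ⟨A, B, h⟩)
      · exact ⟨A, B, (hat _ _).2 (.inl h)⟩
      · exact ⟨A, B, (hat _ _).2 (.inr h)⟩
  have hleaf : ∀ v, S.IsLeaf v ↔ S₁.IsLeaf v ∨ S₂.IsLeaf v := by
    intro v
    constructor
    · rintro ⟨X, b, h⟩
      exact ((hat _ _).1 h).imp (fun h => ⟨X, b, h⟩) (fun h => ⟨X, b, h⟩)
    · rintro (⟨X, b, h⟩ | ⟨X, b, h⟩)
      · exact ⟨X, b, (hat _ _).2 (.inl h)⟩
      · exact ⟨X, b, (hat _ _).2 (.inr h)⟩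
  have n₁ : ∀ {v A}, S₁.At v A → v ∉ R₂ := fun hv h =>
    let ⟨_, hB⟩ := p₂.vertex _ h
    hdisj _ _ _ hv hB
  have n₂ : ∀ {v A}, S₂.At v A → v ∉ R₁ := fun hv h =>
    let ⟨_, hB⟩ := p₁.vertex _ h
    hdisj _ _ _ hB hv
  have e₁ : ∀ {c v} b, S₁.IsConn c v → (v.child b ∈ R₁ ∪ R₂ ↔ v.child b ∈ R₁) :=
    fun b ⟨_, _, hv⟩ => or_iff_left (n₁ (hv.child b))
  have e₂ : ∀ {c v} b, S₂.IsConn c v → (v.child b ∈ R₁ ∪ R₂ ↔ v.child b ∈ R₂) :=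
    fun b ⟨_, _, hv⟩ => or_iff_right (n₂ (hv.child b))
  have hrootR : ∀ r ∈ S.roots, r.1 ∈ R₁ ∪ R₂ := fun r hr =>
    ((hroots r).1 hr).imp (hR₁.1.concl r) (hR₂.1.concl r)
  refine ⟨⟨R₁ ∪ R₂, ⟨⟨?_, ?_, ?_, ?_⟩, ?_, ?_⟩, ?_⟩, ?_, ?_⟩
  · rintro v (hv | hv)
    · exact (p₁.vertex v hv).imp fun A hA => (hat _ _).2 (.inl hA)
    · exact (p₂.vertex v hv).imp fun A hA => (hat _ _).2 (.inr hA)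
  · intro c v b hc hb
    rcases (hconn c v).1 hc with hc | hc
    · exact .inl (p₁.parent c v b hc ((e₁ b hc).1 hb))
    · exact .inr (p₂.parent c v b hc ((e₂ b hc).1 hb))
  · intro c v hP hc hv
    rcases (hconn c v).1 hc with hc | hc
    · rw [e₁ _ hc, e₁ _ hc]
      obtain ⟨_, _, hv'⟩ := id hc
      exact p₁.both c v hP hc (hv.resolve_right (n₁ hv'))
    · rw [e₂ _ hc, e₂ _ hc]
      obtain ⟨_, _, hv'⟩ := id hc
      exact p₂.both c v hP hc (hv.resolve_left (n₂ hv'))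
  · intro c v hP hc hv
    rcases (hconn c v).1 hc with hc | hc
    · rw [e₁ _ hc, e₁ _ hc]
      obtain ⟨_, _, hv'⟩ := id hc
      exact p₁.one c v hP hc (hv.resolve_right (n₁ hv'))
    · rw [e₂ _ hc, e₂ _ hc]
      obtain ⟨_, _, hv'⟩ := id hc
      exact p₂.one c v hP hc (hv.resolve_left (n₂ hv'))
  · exact fun r hr => hrootR r (List.mem_append_left _ hr)
  · exact fun c hc => iff_of_true (hrootR (c.left, c.formula) (mem_roots.2 (.inr ⟨c, hc, .inl rfl⟩)))
      (hrootR (c.right, c.formula.dual) (mem_roots.2 (.inr ⟨c, hc, .inr rfl⟩)))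
  · ext v
    constructor
    · rintro ⟨e, he | he, hv⟩
      · have : v ∈ Linking.support l₁ := ⟨e, he, hv⟩
        exact ⟨.inl (hR₁.mem_of_support this), (hleaf v).2 (.inl (hR₁.isLeaf this))⟩
      · have : v ∈ Linking.support l₂ := ⟨e, he, hv⟩
        exact ⟨.inr (hR₂.mem_of_support this), (hleaf v).2 (.inr (hR₂.isLeaf this))⟩
    · rintro ⟨hv, hl⟩
      rcases (hleaf v).1 hl with hl | hl
      · obtain ⟨X, b, hX⟩ := id hl
        have : v ∈ Linking.support l₁ := by
          rw [hR₁.2]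
          exact ⟨hv.resolve_right (n₁ hX), hl⟩
        obtain ⟨e, he, hv⟩ := this
        exact ⟨e, .inl he, hv⟩
      · obtain ⟨X, b, hX⟩ := id hl
        have : v ∈ Linking.support l₂ := by
          rw [hR₂.2]
          exact ⟨hv.resolve_left (n₂ hX), hl⟩
        obtain ⟨e, he, hv⟩ := this
        exact ⟨e, .inr he, hv⟩
  · have cross : ∀ e ∈ l₁, ∀ f ∈ l₂, ∀ v, v ∈ e → v ∈ f → False := by
      intro e he f hf v hve hvf
      obtain ⟨X, b, hX⟩ := hR₁.isLeaf ⟨e, he, hve⟩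
      exact n₁ hX (hR₂.mem_of_support ⟨f, hf, hvf⟩)
    rintro e (he | he) f (hf | hf) v hve hvf
    · exact (h₁.linking l₁ hl₁).disjoint e he f hf v hve hvf
    · exact (cross e he f hf v hve hvf).elim
    · exact (cross f hf e he v hvf hve).elim
    · exact (h₂.linking l₂ hl₂).disjoint e he f hf v hve hvf
  · rintro u v (h | h)
    · exact h₁.link_ne hl₁ h
    · exact h₂.link_ne hl₂ h

end CutSequent

end MALL

namespace MALL

variable {ι α : Type*}

/-! ### Isomorphisms and composition -/

/-- Two sets of linkings witnessing an isomorphism between `A` and `B`, the formulas `A` and `B`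
being named `a` and `b`, and their duals `ρ a` and `ρ b`. -/
structure Iso (ρ : ι → ι) (a b : ι) (A B : Formula α) (θ θ' : Set (Linking ι)) : Prop where
  inv : ∀ i, ρ (ρ i) = i
  ne_a : ρ a ≠ a
  ne_b : ρ b ≠ b
  ne_ab : a ≠ b
  ne_dual : ρ a ≠ b
  net : ∀ h, (seq (ρ a) b h A.dual B).IsProofNet θ
  net' : ∀ h, (seq (ρ b) a h B.dual A).IsProofNet θ'
  comp_B : ∀ h h', Relation.ReflTransGen Step
    (cutSeq b (ρ b) (ρ a) a h B A.dual A, joins θ θ')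
    (seq (ρ a) a h' A.dual A, idNet A (ρ a, []) (a, []))
  comp_A : ∀ h h', Relation.ReflTransGen Step
    (cutSeq a (ρ a) (ρ b) b h A B.dual B, joins θ' θ)
    (seq (ρ b) b h' B.dual B, idNet B (ρ b, []) (b, []))

/-- The linkings `l` of `A⊥, B` and `m` of `B⊥, A` compose to the identity linking of the point
`p` of `A`. -/
structure ComposesTo (ρ : ι → ι) (a b : ι) {A : Formula α} (p : Pt A) (l m : Linking ι) :
    Prop where
  right : ∀ v : Occ ι, v.1 = a → (v ∈ m.support ↔ v ∈ leaves A p (a, []))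
  left : ∀ v : Occ ι, v.1 = a → (v.flip ρ ∈ l.support ↔ v ∈ leaves A p (a, []))
  not_left : ∀ u v : Occ ι, u.1 = ρ a → v.1 = ρ a → s(u, v) ∉ l
  not_right : ∀ u v : Occ ι, u.1 = a → v.1 = a → s(u, v) ∉ m
  join : ∀ u y w : Occ ι, u.1 = ρ a → y.1 = b → w.1 = a → s(u, y) ∈ l → s(w, y.flip ρ) ∈ m →
    u = w.flip ρ

/-- The linkings `l` of `A⊥, B` and `m` of `B⊥, A` use dual leaves and dual links. -/
structure Matched (ρ : ι → ι) (a b : ι) {A B : Formula α} (p : Pt A) (q : Pt B)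
    (l m : Linking ι) : Prop where
  support : l.support = leaves A.dual (Pt.dual A p) (ρ a, []) ∪ leaves B q (b, [])
  support' : m.support = leaves B.dual (Pt.dual B q) (ρ b, []) ∪ leaves A p (a, [])
  link : ∀ e ∈ l, ∃ y z : Occ ι, e = s(y, z) ∧ y.1 = ρ a ∧ z.1 = b
  flip : ∀ y z, s(y, z) ∈ m → s(y.flip ρ, z.flip ρ) ∈ l

open CutSequent

theorem IsProofNet.root_of_mem_support {i j : ι} {h : i ≠ j} {F G : Formula α}
    {θ : Set (Linking ι)} (hθ : (seq i j h F G).IsProofNet θ) {l : Linking ι} (hl : l ∈ θ)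
    {v : Occ ι} (hv : v ∈ l.support) : v.1 = i ∨ v.1 = j := by
  obtain ⟨X, b, hX⟩ := (hθ.isResolutionOf hl).isLeaf hv
  exact root_of_at_seq hX

theorem mem_leaves_dual {ρ : ι → ι} (hρ : ∀ i, ρ (ρ i) = i) {F : Formula α} {p : Pt F} {i : ι}
    {v : Occ ι} : v ∈ leaves F.dual (Pt.dual F p) (ρ i, []) ↔ v.flip ρ ∈ leaves F p (i, []) := by
  have h := leaves_dual ρ p ((i, []) : Occ ι)
  change v ∈ leaves F.dual (Pt.dual F p) (Occ.flip ρ (i, [])) ↔ _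
  rw [h]
  constructor
  · rintro ⟨w, hw, rfl⟩
    rwa [Occ.flip_flip hρ]
  · exact fun hv => ⟨_, hv, Occ.flip_flip hρ v⟩

namespace Iso

variable {ρ : ι → ι} {a b : ι} {A B : Formula α} {θ θ' : Set (Linking ι)}

/-- Everything shown for `θ` and composition over `B` also applies to `θ'` and composition over `A`.
-/
theorem symm (H : Iso ρ a b A B θ θ') : Iso ρ b a B A θ' θ where
  inv := H.inv
  ne_a := H.ne_b
  ne_b := H.ne_a
  ne_ab := H.ne_ab.symm
  ne_dual h := H.ne_dual (by rw [← h, H.inv])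
  net := H.net'
  net' := H.net
  comp_B := H.comp_A
  comp_A := H.comp_B

theorem root (H : Iso ρ a b A B θ θ') {l : Linking ι} (hl : l ∈ θ) {v : Occ ι}
    (hv : v ∈ l.support) : v.1 = ρ a ∨ v.1 = b :=
  IsProofNet.root_of_mem_support (H.net H.ne_dual) hl hv

theorem flip_mem_iff (H : Iso ρ a b A B θ θ') {v : Occ ι} {i : ι} :
    (v.flip ρ).1 = i ↔ v.1 = ρ i :=
  ⟨fun h => by rw [← h]; exact (H.inv _).symm, fun h => by simp [Occ.flip, h, H.inv]⟩

/-- What lies outside the cut is still visible in the normal form, a linking of the identity, all of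
whose links join a leaf of `p` to its mirror image. -/
theorem composesTo_of_evolves (H : Iso ρ a b A B θ θ') {T : CutSequent ι α} (hT : T.cuts = [])
    {h : [b, ρ b, ρ a, a].Nodup} {l m k : Linking ι} (hl : l ∈ θ) (hm : m ∈ θ')
    (he : Evolves ρ (cutSeq b (ρ b) (ρ a) a h B A.dual A) T (l ∪ m) k)
    (hk : k ∈ idNet A (ρ a, []) (a, [])) : ∃ p : Pt A, ComposesTo ρ a b p l m := by
  obtain ⟨p, rfl⟩ := (mem_idNet ρ (v := ((a, []) : Occ ι))).1 hk
  have n1 := H.ne_a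
  have n2 := H.ne_ab
  have n3 := H.ne_dual
  have n4 : a ≠ ρ b := fun h => H.symm.ne_dual h.symm
  have n5 : ρ a ≠ ρ b := fun h => n2 (by rw [← H.inv a, h, H.inv])
  have outer : ∀ v : Occ ι, v.1 = ρ a ∨ v.1 = a →
      (cutSeq b (ρ b) (ρ a) a h B A.dual A).Outer v := by
    intro v hv c hc
    obtain rfl : c = ⟨(b, []), (ρ b, []), B⟩ := by simpa [cutSeq] using hc
    simp only [below_root]
    rcases hv with hv | hv <;> rw [hv] <;> constructor <;> assumption
  have supp : ∀ v, v ∈ Linking.support (l ∪ m) ↔ v ∈ l.support ∨ v ∈ m.support := by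
    intro v
    constructor
    · rintro ⟨e, he | he, hv⟩
      · exact .inl ⟨e, he, hv⟩
      · exact .inr ⟨e, he, hv⟩
    · rintro (⟨e, he, hv⟩ | ⟨e, he, hv⟩)
      · exact ⟨e, .inl he, hv⟩
      · exact ⟨e, .inr he, hv⟩
  have root_leaf : ∀ {w : Occ ι}, w ∈ leaves A p (a, []) → w.1 = a ∧ (w.flip ρ).1 = ρ a := by
    intro w hw
    have := root_of_mem_leaves hw
    exact ⟨this, congrArg ρ this⟩
  refine ⟨p, ?_, ?_, ?_, ?_, ?_⟩
  · intro v hv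
    have h1 := (he.support v (outer v (.inr hv))).trans (supp v)
    rw [or_iff_right fun h => ?_] at h1
    · rw [← h1]
      constructor
      · rintro ⟨_, ⟨w, hw, rfl⟩, hvw⟩
        rcases Sym2.mem_iff.1 hvw with rfl | rfl
        · exact (n1 ((root_leaf hw).2.symm.trans hv)).elim
        · exact hw
      · exact fun hw => ⟨_, ⟨v, hw, rfl⟩, Sym2.mem_mk_right _ _⟩
    · rcases H.root hl h with h | h
      · exact n1 (h.symm.trans hv)
      · exact n2 (hv.symm.trans h)
  · intro v hv
    have hv' : (v.flip ρ).1 = ρ a := congrArg ρ hv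
    have h1 := (he.support _ (outer _ (.inl hv'))).trans (supp _)
    rw [or_iff_left fun h => ?_] at h1
    · rw [← h1]
      constructor
      · rintro ⟨_, ⟨w, hw, rfl⟩, hvw⟩
        rcases Sym2.mem_iff.1 hvw with hvw | hvw
        · rwa [flip_injective H.inv hvw]
        · exact (n1 (hv'.symm.trans ((congrArg Prod.fst hvw).trans (root_leaf hw).1))).elim
      · exact fun hw => ⟨_, ⟨v, hw, rfl⟩, Sym2.mem_mk_left _ _⟩
    · rcases H.symm.root hm h with h | h
      · exact n5 (hv'.symm.trans h)
      · exact n1 (hv'.symm.trans h)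
  · intro u v hu hv huv
    obtain ⟨w, hw, he⟩ := he.link u v (outer u (.inl hu)) (outer v (.inl hv)) (.inl huv)
    have : w ∈ s(u, v) := he ▸ Sym2.mem_mk_right _ _
    rcases Sym2.mem_iff.1 this with rfl | rfl
    · exact n1 (hu.symm.trans (root_leaf hw).1)
    · exact n1 (hv.symm.trans (root_leaf hw).1)
  · intro u v hu hv huv
    obtain ⟨w, hw, he⟩ := he.link u v (outer u (.inr hu)) (outer v (.inr hv)) (.inr huv)
    have : w.flip ρ ∈ s(u, v) := he ▸ Sym2.mem_mk_left _ _
    rcases Sym2.mem_iff.1 this with rfl | rfl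
    · exact n1 ((root_leaf hw).2.symm.trans hu)
    · exact n1 ((root_leaf hw).2.symm.trans hv)
  · intro u y w hu hy hw huy hwy
    rcases he.join ⟨(b, []), (ρ b, []), B⟩ (by simp [cutSeq]) y (below_root.2 hy) u w
      (outer u (.inl hu)) (outer w (.inr hw)) (.inl huy) (.inr hwy) with ⟨x, hx, he⟩ | ⟨d, hd, -⟩
    · rcases Sym2.eq_iff.1 he with ⟨rfl, rfl⟩ | ⟨-, rfl⟩
      · rfl
      · exact (n1 (hu.symm.trans (root_leaf hx).1)).elim
    · simp [hT] at hd

/-- The two halves of `reduction_spec`: linkings with dual leaves on `B` survive, and every linking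
of the identity has an ancestor. -/
theorem composition (H : Iso ρ a b A B θ θ') :
    (∀ l ∈ θ, ∀ m ∈ θ', (∀ v : Occ ι, v.1 = b → (v ∈ l.support ↔ v.flip ρ ∈ m.support)) →
      ∃ p : Pt A, ComposesTo ρ a b p l m) ∧
    ∀ p : Pt A, ∃ l ∈ θ, ∃ m ∈ θ', ComposesTo ρ a b p l m := by
  have n1 := H.ne_a
  have n2 := H.ne_ab
  have n3 := H.ne_dual
  have n4 : a ≠ ρ b := fun h => H.symm.ne_dual h.symm
  have n5 : ρ a ≠ ρ b := fun h => n2 (by rw [← H.inv a, h, H.inv])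
  have n6 := H.ne_b
  have hnd : [b, ρ b, ρ a, a].Nodup := by
    simp [n1, n6.symm, n2.symm, n3.symm, n4.symm, n5.symm]
  have hpre := isPreLinking_union (S := cutSeq b (ρ b) (ρ a) a hnd B A.dual A)
    (S₁ := seq (ρ a) b n3 A.dual B) (S₂ := seq (ρ b) a n4.symm B.dual A)
    (by
      intro r
      simp only [roots, cutSeq, seq, CutPair.sides, List.flatMap_cons, List.flatMap_nil,
        List.append_nil, List.cons_append, List.nil_append, List.mem_cons, List.not_mem_nil,
        or_false]
      tauto) rfl rfl
    (by
      intro v C D h1 h2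
      rcases root_of_at_seq h1 with h1 | h1 <;> rcases root_of_at_seq h2 with h2 | h2 <;>
        rw [h1] at h2 <;> first | exact n5 h2 | exact n1 h2 | exact n6 h2.symm | exact n2 h2.symm)
    (H.net _) (H.net' _)
  have hflip : (cutSeq b (ρ b) (ρ a) a hnd B A.dual A).IsFlipped ρ := by
    intro c hc
    obtain rfl : c = ⟨(b, []), (ρ b, []), B⟩ := by simpa [cutSeq] using hc
    rfl
  obtain ⟨h1, h2⟩ := reduction_spec H.inv (H.comp_B hnd n1) rfl hpre hflip
  constructor
  · intro l hl m hm hlm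
    obtain ⟨k, hk, he⟩ := h1 (l ∪ m) ⟨l, hl, m, hm, rfl⟩ (by
      intro c hc v hv
      obtain rfl : c = ⟨(b, []), (ρ b, []), B⟩ := by simpa [cutSeq] using hc
      have hv : v.1 = b := below_root.1 hv
      constructor
      · rintro ⟨e, he | he, hve⟩
        · obtain ⟨e', he', hv'⟩ := (hlm v hv).1 ⟨e, he, hve⟩
          exact ⟨e', .inr he', hv'⟩
        · rcases H.symm.root hm ⟨e, he, hve⟩ with h | h
          · exact (n6 (h.symm.trans hv)).elim
          · exact (n2 (h.symm.trans hv)).elim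
      · rintro ⟨e, he | he, hve⟩
        · have hv' : (v.flip ρ).1 = ρ b := congrArg ρ hv
          rcases H.root hl ⟨e, he, hve⟩ with h | h
          · exact (n5 (h.symm.trans hv')).elim
          · exact (n6 (hv'.symm.trans h)).elim
        · obtain ⟨e', he', hv'⟩ := (hlm v hv).2 ⟨e, he, hve⟩
          exact ⟨e', .inl he', hv'⟩)
    exact H.composesTo_of_evolves rfl hl hm he hk
  · intro p
    have hk := (mem_idNet ρ (v := ((a, []) : Occ ι))).2 ⟨p, rfl⟩
    obtain ⟨_, ⟨l, hl, m, hm, rfl⟩, -, he⟩ := h2 _ hk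
    obtain ⟨p', hp⟩ := H.composesTo_of_evolves rfl hl hm he hk
    -- The previous step yields the point of the normal form only up to existence; comparing leaves
    -- in `A` identifies it.
    have : p' = p := by
      refine leaves_injective (v := ((a, []) : Occ ι)) (Set.ext fun v => ?_)
      have key : ∀ q : Pt A, v ∈ leaves A q (a, []) → v.1 = a := fun q h => root_of_mem_leaves h
      by_cases hv : v.1 = a
      · rw [← hp.right v hv]
        have ho : (cutSeq b (ρ b) (ρ a) a hnd B A.dual A).Outer v := by
          intro c hc
          obtain rfl : c = ⟨(b, []), (ρ b, []), B⟩ := by simpa [cutSeq] using hc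
          simp only [below_root, hv]
          exact ⟨n2, n4⟩
        constructor
        · rintro ⟨e, he', hve⟩
          obtain ⟨_, ⟨w, hw, rfl⟩, hvw⟩ := (he.support v ho).2 ⟨e, .inr he', hve⟩
          rcases Sym2.mem_iff.1 hvw with rfl | rfl
          · exact (n1 ((congrArg ρ (root_of_mem_leaves hw)).symm.trans hv)).elim
          · exact hw
        · intro hw
          obtain ⟨e, he' | he', hve⟩ := (he.support v ho).1 ⟨_, ⟨v, hw, rfl⟩, Sym2.mem_mk_right _ _⟩
          · rcases H.root hl ⟨e, he', hve⟩ with h | h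
            · exact (n1 (h.symm.trans hv)).elim
            · exact (n2 (hv.symm.trans h)).elim
          · exact ⟨e, he', hve⟩
      · exact iff_of_false (fun h => hv (key _ h)) fun h => hv (key _ h)
    exact ⟨l, hl, m, hm, this ▸ hp⟩

/-- The source of bipartiteness: a link inside `A⊥` would survive in the identity of `A`, one inside
`B` in the identity of `B`, and identities have none of these. -/
theorem link_of_composesTo (H : Iso ρ a b A B θ θ') {l m : Linking ι} (hl : l ∈ θ) {p : Pt A}
    {q : Pt B} (hp : ComposesTo ρ a b p l m) (hq : ComposesTo ρ b a q m l) {e : Sym2 (Occ ι)}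
    (he : e ∈ l) : ∃ y z : Occ ι, e = s(y, z) ∧ y.1 = ρ a ∧ z.1 = b := by
  induction e using Sym2.ind with
  | _ y z =>
    rcases H.root hl ⟨_, he, Sym2.mem_mk_left _ _⟩ with hy | hy <;>
    rcases H.root hl ⟨_, he, Sym2.mem_mk_right _ _⟩ with hz | hz
    · exact (hp.not_left y z hy hz he).elim
    · exact ⟨y, z, rfl, hy, hz⟩
    · exact ⟨z, y, Sym2.eq_swap, hz, hy⟩
    · exact (hq.not_right y z hy hz he).elim

theorem matched_of_composesTo (H : Iso ρ a b A B θ θ') {l m : Linking ι} (hl : l ∈ θ)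
    (hm : m ∈ θ') {p : Pt A} {q : Pt B} (hp : ComposesTo ρ a b p l m)
    (hq : ComposesTo ρ b a q m l) : Matched ρ a b p q l m := by
  have hlink := fun e he => H.link_of_composesTo hl hp hq (e := e) he
  refine ⟨?_, ?_, hlink, ?_⟩
  · ext v
    rw [Set.mem_union, mem_leaves_dual H.inv]
    constructor
    · intro hv
      rcases H.root hl hv with h | h
      · exact .inl ((hp.left _ (H.flip_mem_iff.2 h)).1 (by rwa [Occ.flip_flip H.inv]))
      · exact .inr ((hq.right v h).1 hv)
    · rintro (hv | hv)
      · have := (hp.left _ (root_of_mem_leaves hv)).2 hv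
        rwa [Occ.flip_flip H.inv] at this
      · exact (hq.right v (root_of_mem_leaves hv)).2 hv
  · ext v
    rw [Set.mem_union, mem_leaves_dual H.inv]
    constructor
    · intro hv
      rcases H.symm.root hm hv with h | h
      · exact .inl ((hq.left _ (H.flip_mem_iff.2 h)).1 (by rwa [Occ.flip_flip H.inv]))
      · exact .inr ((hp.right v h).1 hv)
    · rintro (hv | hv)
      · have := (hq.left _ (root_of_mem_leaves hv)).2 hv
        rwa [Occ.flip_flip H.inv] at this
      · exact (hp.right v (root_of_mem_leaves hv)).2 hv
  -- The dual of the leaf `z` carries a link of `l`, whose other end `z'` is in `B`. Composition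
  -- over `A` joins it to the link `(y, z)` of `m`, and since the result is an identity link, `y` is
  -- dual to `z'`.
  · have key : ∀ y z : Occ ι, y.1 = ρ b → z.1 = a → s(y, z) ∈ m →
        s(y.flip ρ, z.flip ρ) ∈ l := by
      intro y z hy hz hyz
      obtain ⟨e, he, hze⟩ :=
        (hp.left z hz).2 ((hp.right z hz).1 ⟨_, hyz, Sym2.mem_mk_right _ _⟩)
      obtain ⟨y', z', rfl, hy', hz'⟩ := hlink e he
      rcases Sym2.mem_iff.1 hze with rfl | rfl
      · obtain rfl := hq.join y z z' hy hz hz' hyz (Sym2.eq_swap ▸ he)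
        rwa [Occ.flip_flip H.inv, Sym2.eq_swap]
      · exact (H.ne_dual ((congrArg ρ hz).symm.trans hz')).elim
    intro y z hyz
    obtain ⟨y', z', he, hy', hz'⟩ := H.symm.link_of_composesTo hm hq hp hyz
    have := key y' z' hy' hz' (he ▸ hyz)
    rcases Sym2.eq_iff.1 he with ⟨rfl, rfl⟩ | ⟨rfl, rfl⟩
    · exact this
    · rwa [Sym2.eq_swap]

/-- Two linkings that compose over `B` to an identity linking use dual leaves on `A`, so they
compose over `A` as well. -/
theorem exists_matched_of_point (H : Iso ρ a b A B θ θ') (p : Pt A) :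
    ∃ l ∈ θ, ∃ m ∈ θ', ∃ q : Pt B, Matched ρ a b p q l m := by
  obtain ⟨l, hl, m, hm, hp⟩ := H.composition.2 p
  obtain ⟨q, hq⟩ := H.symm.composition.1 m hm l hl fun v hv =>
    (hp.right v hv).trans (hp.left v hv).symm
  exact ⟨l, hl, m, hm, q, H.matched_of_composesTo hl hm hp hq⟩

/-- The identity of `B` supplies a linking `m` on the dual of the point that `l` has in `B`. So `l`
and `m` compose over `B`, and then also over `A`. -/
theorem exists_matched (H : Iso ρ a b A B θ θ') {l : Linking ι} (hl : l ∈ θ) :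
    ∃ m ∈ θ', ∃ (p : Pt A) (q : Pt B), Matched ρ a b p q l m := by
  have hs := support_seq ((H.net H.ne_dual).isResolutionOf hl)
  obtain ⟨m, hm, l', -, hq'⟩ := H.symm.composition.2 (ptAt _ B (b, []))
  obtain ⟨p, hp⟩ := H.composition.1 l hl m hm fun v hv => by
    rw [hq'.left v hv, hs, Set.mem_union, or_iff_right]
    exact fun h => H.ne_dual ((root_of_mem_leaves h).symm.trans hv)
  obtain ⟨q, hq⟩ := H.symm.composition.1 m hm l hl fun v hv =>
    (hp.right v hv).trans (hp.left v hv).symm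
  exact ⟨m, hm, p, q, H.matched_of_composesTo hl hm hp hq⟩

/-- Let `x` and `y` be the signs in `A⊥` and `B`. Coherence of `l` and `l'` forbids that neither is
`1` while one is `-1`. Coherence of their mirror images, under reversed signs, forbids that neither
is `-1` while one is `1`. Both being `0` would give equal supports, hence equal linkings. Only
opposite nonzero signs remain. -/
theorem isRigid (H : Iso ρ a b A B θ θ') : IsRigid A.dual B (ρ a, []) (b, []) θ := by
  intro l hl l' hl' hne f f' g g' hs hs' s hanti
  obtain ⟨m, hm, p, q, h⟩ := H.exists_matched hl
  obtain ⟨m', hm', p', q', h'⟩ := H.exists_matched hl'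
  obtain ⟨rfl, rfl⟩ := leaves_eq_of_union_eq H.ne_dual (hs.symm.trans h.support)
  obtain ⟨rfl, rfl⟩ := leaves_eq_of_union_eq H.ne_dual (hs'.symm.trans h'.support)
  have e1 := typ_dual ρ p p' ((a, []) : Occ ι) s
  have e2 := typ_dual ρ g g' ((b, []) : Occ ι) fun w => -s (w.flip ρ)
  simp only [Occ.flip_flip H.inv, neg_neg] at e2
  have c1 := coherent_seq (H.net H.ne_dual) hl hl' hs hs' hanti
  have c2 := coherent_seq (H.net' H.symm.ne_dual) hm hm' h.support' h'.support'
    (s := fun w => -s (w.flip ρ)) fun y z hy hz => congrArg _ (hanti _ _ (h.flip y z hy) (h'.flip y z hz))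
  have c3 : ¬ (typ A.dual (Pt.dual A p) (Pt.dual A p') (ρ a, []) s = 0 ∧
      typ B g g' (b, []) s = 0) := by
    rintro ⟨h1, h2⟩
    have h1 := eq_of_typ_eq_zero h1
    have h2 := eq_of_typ_eq_zero h2
    rw [← h1, ← h2] at hs'
    exact hne ((H.net H.ne_dual).eq_of_support_eq hl hl' (hs.trans hs'.symm))
  change typ A.dual (Pt.dual A p) (Pt.dual A p') (ρ a, []) s = _ at e1
  change typ B.dual (Pt.dual B g) (Pt.dual B g') (ρ b, []) _ = _ at e2
  have e1' := (neg_eq_iff_eq_neg.2 e1).symm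
  rw [e2, e1'] at c2
  clear e1 e2 e1'
  generalize typ A.dual (Pt.dual A p) (Pt.dual A p') (ρ a, []) s = x at *
  generalize typ B g g' (b, []) s = y at *
  clear * - c1 c2 c3
  revert x y
  decide

/-- A leaf has a link because it lies on some point, and every point of either conclusion belongs to
a linking. Uniqueness is `link_unique` for either conclusion, rigidity being symmetric in the two.
-/
theorem isBipartite_isAxUnique (H : Iso ρ a b A B θ θ') (hA : A.IsDist) (hB : B.IsDist)
    (h : ρ a ≠ b) : (seq (ρ a) b h A.dual B).IsBipartite θ ∧
      (seq (ρ a) b h A.dual B).IsAxUnique θ := by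
  have hnet := H.net h
  have leaf : ∀ l ∈ θ, ∀ e ∈ l, ∀ v ∈ e, (seq (ρ a) b h A.dual B).IsLeaf v :=
    fun l hl e he v hv => (hnet.isResolutionOf hl).isLeaf ⟨e, he, hv⟩
  have hbip : ∀ l ∈ θ, ∀ e ∈ l, ∃ y z : Occ ι, e = s(y, z) ∧ Occ.Below (ρ a, []) y ∧
      Occ.Below (b, []) z := by
    intro l hl e he
    obtain ⟨m, -, p, q, hm⟩ := H.exists_matched hl
    obtain ⟨y, z, rfl, hy, hz⟩ := hm.link e he
    exact ⟨y, z, rfl, below_root.2 hy, below_root.2 hz⟩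
  refine ⟨⟨rfl, _, _, rfl, ?_⟩, ?_⟩
  · intro l hl e he
    obtain ⟨y, z, rfl, hy, hz⟩ := hbip l hl e he
    exact ⟨y, z, rfl, leaf l hl _ he y (Sym2.mem_mk_left _ _), hy,
      leaf l hl _ he z (Sym2.mem_mk_right _ _), hz⟩
  have hvw : ∀ z : Occ ι, Occ.Below (ρ a, []) z → ¬ Occ.Below (b, []) z :=
    fun z h1 h2 => h ((below_root.1 h1).symm.trans (below_root.1 h2))
  have hdisj : ∀ l ∈ θ, ∀ e ∈ l, ∀ f ∈ l, ∀ z, z ∈ e → z ∈ f → e = f :=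
    fun l hl => (hnet.linking l hl).disjoint
  have hpt : ∀ l ∈ θ, ∃ f g, l.support = leaves A.dual f (ρ a, []) ∪ leaves B g (b, []) := by
    intro l hl
    obtain ⟨m, -, p, q, hm⟩ := H.exists_matched hl
    exact ⟨_, _, hm.support⟩
  have hfull : ∀ f, ∃ l ∈ θ, ∃ g, l.support = leaves A.dual f (ρ a, []) ∪ leaves B g (b, []) := by
    intro f
    obtain ⟨p, rfl⟩ := Pt.dual_surjective A f
    obtain ⟨l, hl, m, -, q, hm⟩ := H.exists_matched_of_point p
    exact ⟨l, hl, q, hm.support⟩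
  have hfull' : ∀ g, ∃ l ∈ θ, ∃ f, l.support = leaves A.dual f (ρ a, []) ∪ leaves B g (b, []) := by
    intro g
    obtain ⟨m, -, l, hl, p, hm⟩ := H.symm.exists_matched_of_point g
    exact ⟨l, hl, _, hm.support'⟩
  have hrig := H.isRigid
  intro v hv
  have hroot : v.1 = ρ a ∨ v.1 = b := by
    obtain ⟨X, x, hX⟩ := hv
    exact root_of_at_seq hX
  rcases hroot with hr | hr
  · have hb := below_root.2 hr
    obtain ⟨f, hf⟩ := exists_point at_seq_left hv hb
    obtain ⟨l, hl, g, hs⟩ := hfull f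
    obtain ⟨e, he, hve⟩ : v ∈ l.support := hs ▸ .inl hf
    refine ⟨e, ⟨⟨l, hl, he⟩, hve⟩, ?_⟩
    rintro e' ⟨⟨l', hl', he'⟩, hve'⟩
    exact link_unique hvw hbip hdisj hpt hfull hrig hA.dual hl' hl hb he' he hve' hve
  · have hb := below_root.2 hr
    obtain ⟨g, hg⟩ := exists_point at_seq_right hv hb
    obtain ⟨l, hl, f, hs⟩ := hfull' g
    obtain ⟨e, he, hve⟩ : v ∈ l.support := hs ▸ .inr hg
    refine ⟨e, ⟨⟨l, hl, he⟩, hve⟩, ?_⟩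
    rintro e' ⟨⟨l', hl', he'⟩, hve'⟩
    refine link_unique (F := B) (G := A.dual) (fun z h1 h2 => hvw z h2 h1) ?_ hdisj ?_ ?_ ?_ hB hl' hl hb he' he hve' hve
    · intro l hl e he
      obtain ⟨y, z, rfl, hy, hz⟩ := hbip l hl e he
      exact ⟨z, y, Sym2.eq_swap, hz, hy⟩
    · intro l hl
      obtain ⟨f, g, hs⟩ := hpt l hl
      exact ⟨g, f, hs.trans (Set.union_comm _ _)⟩
    · intro g
      obtain ⟨l, hl, f, hs⟩ := hfull' g
      exact ⟨l, hl, f, hs.trans (Set.union_comm _ _)⟩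
    · intro l hl l' hl' hne f f' g g' hs hs' s hanti
      rw [Set.union_comm] at hs hs'
      rw [hrig l hl l' hl' hne g g' f f' hs hs' s hanti, neg_neg]

end Iso

/-- The involution exchanging the names of dual formulas. -/
def Root.dual : Root → Root
  | .dualA => .A
  | .B => .dualB
  | .dualB => .B
  | .A => .dualA

theorem IsIso.iso {A B : Formula α} {θ θ' : Set (Linking Root)} (h : IsIso A B θ θ') :
    Iso Root.dual .A .B A B θ θ' where
  inv i := by cases i <;> rfl
  ne_a := by simp [Root.dual]
  ne_b := by simp [Root.dual]
  ne_ab := by simp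
  ne_dual := by simp [Root.dual]
  net _ := h.net
  net' _ := h.net'
  comp_B _ _ := h.comp_B
  comp_A _ _ := h.comp_A

end MALL

theorem mainTheorem6 {α : Type*} (A B : MALL.Formula α)
    (hA : A.Distributed) (hB : B.Distributed)
    (θ θ' : Set (MALL.Linking MALL.Root)) (h : MALL.IsIso A B θ θ') :
    ((MALL.seqAB A B).IsBipartite θ ∧ (MALL.seqAB A B).IsAxUnique θ) ∧
      ((MALL.seqBA A B).IsBipartite θ' ∧ (MALL.seqBA A B).IsAxUnique θ') :=
  ⟨h.iso.isBipartite_isAxUnique hA.isDist hB.isDist h.iso.ne_dual,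
    h.iso.symm.isBipartite_isAxUnique hB.isDist hA.isDist h.iso.symm.ne_dual⟩
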